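/- **Theorem 5.1.** Let $K:\mathbb{R}^2\to\mathbb{R}$ be Lipschitz continuous and suppose that there are constants $k_m>0$, $r_0>0$ and $k_0$ such that $K(x)\ge k_m$ for all $x\in\mathbb{R}^2$ and $K(x)=k_0$ for all $|x|>r_0$. Let $\|\nabla K\|_\infty$ be the essential supremum over $\mathbb{R}^2$ of the Euclidean length $|\nabla K|$ of the gradient (which exists almost everywhere), and assume that $$\eta_0:=\frac{r_0}{k_m}\,\|\nabla K\|_\infty\in[0,1).$$ Let $u_0,u_1\in C_0^\infty(\mathbb{R}^2)$ be real-valued with supports contained in $\{|x|\le L\}$ for some $L>0$, and let $u\in C([0,\infty);H^1(\mathbb{R}^2))\cap C^1([0,\infty);L^2(\mathbb{R}^2))$ be a real-valued solution of $$u_{tt}-\nabla\cdot(K(x)\nabla u)=0\ \text{ in }(0,\infty)\times\mathbb{R}^2,\qquad u(0,\cdot)=u_0,\quad u_t(0,\cdot)=u_1,$$ the equation being understood weakly: $\frac{d}{dt}\int_{\mathbb{R}^2} u_t(t,x)\varphi(x)\,dx=-\int_{\mathbb{R}^2} K(x)\nabla u(t,x)\cdot\nabla\varphi(x)\,dx$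 for all $t>0$ and all $\varphi\in C_0^\infty(\mathbb{R}^2)$. Then, for every $R>r_0$, the local energy $$E_{u,R}(t):=\frac12\int_{|x|\le R}\bigl(|u_t(t,x)|^2+K(x)|\nabla u(t,x)|^2\bigr)\,dx$$ satisfies $$E_{u,R}(t)=O\bigl(t^{\eta_0-1}\sqrt{\log t}\bigr)\qquad(t\to\infty).$$ -/

import Mathlib

open MeasureTheory Set Filter Asymptotics
open scoped ContDiff ENNReal NNReal

/-- The Euclidean plane `ℝ²`. -/
abbrev Plane : Type := EuclideanSpace ℝ (Fin 2)

/-- `g ∈ L²(ℝ²; ℝ²)` is the weak (distributional) gradient of `f ∈ L²(ℝ²)`: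
`∫ f ∇φ = - ∫ φ g` for all test functions `φ ∈ C₀^∞(ℝ²)`. In particular `f ∈ H¹(ℝ²)`. -/
def IsWeakGradient (f : Lp ℝ 2 (volume : Measure Plane))
    (g : Lp Plane 2 (volume : Measure Plane)) : Prop :=
  ∀ φ : Plane → ℝ, ContDiff ℝ ∞ φ → HasCompactSupport φ →
    ∫ x, f x • gradient φ x = - ∫ x, φ x • g x

/-- `u` is a (finite energy, weak) solution on `[0, ∞) × ℝ²` of
`u_tt - ∇ · (K ∇u) = 0`, `u(0, ·) = u₀`, `u_t(0, ·) = u₁`,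
in the class `C([0, ∞); H¹(ℝ²)) ∩ C¹([0, ∞); L²(ℝ²))`. The function `ut` is its time derivative
and `Du` its spatial gradient; both are determined by `u` for `t ≥ 0`. Values at `t < 0` are
irrelevant. -/
structure IsWaveSolution (K u₀ u₁ : Plane → ℝ)
    (u ut : ℝ → Lp ℝ 2 (volume : Measure Plane))
    (Du : ℝ → Lp Plane 2 (volume : Measure Plane)) : Prop where
  /-- `Du(t) = ∇u(t)` weakly, so `u(t) ∈ H¹(ℝ²)` -/
  isWeakGradient : ∀ t, 0 ≤ t → IsWeakGradient (u t) (Du t)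
  /-- together with the next field: `u ∈ C([0, ∞); H¹(ℝ²))` -/
  continuousOn_grad : ContinuousOn Du (Ici 0)
  /-- `ut` is the time derivative of `u` in `L²(ℝ²)` (one-sided at `t = 0`) -/
  hasDerivWithinAt : ∀ t, 0 ≤ t → HasDerivWithinAt u (ut t) (Ici 0) t
  /-- `u ∈ C¹([0, ∞); L²(ℝ²))` -/
  continuousOn_deriv : ContinuousOn ut (Ici 0)
  /-- the equation: `d/dt ∫ u_t φ = - ∫ K ∇u · ∇φ` for all test functions `φ` and all `t > 0` -/
  equation : ∀ φ : Plane → ℝ, ContDiff ℝ ∞ φ → HasCompactSupport φ → ∀ t, 0 < t →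
    HasDerivAt (fun s => ∫ x, ut s x * φ x)
      (- ∫ x, K x * inner ℝ (Du t x) (gradient φ x)) t
  /-- initial displacement -/
  initial : u 0 =ᵐ[volume] u₀
  /-- initial velocity -/
  initial_deriv : ut 0 =ᵐ[volume] u₁

/-- The local energy `E_{u,R}(t) = ½ ∫_{|x| ≤ R} (|u_t(t,x)|² + K(x) |∇u(t,x)|²) dx`, written in
terms of `ut = u_t` and `Du = ∇u`. -/
noncomputable def localEnergy (K : Plane → ℝ) (ut : ℝ → Lp ℝ 2 (volume : Measure Plane))
    (Du : ℝ → Lp Plane 2 (volume : Measure Plane)) (R t : ℝ) : ℝ :=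
  (1 / 2) * ∫ x in Metric.closedBall (0 : Plane) R, (|ut t x| ^ 2 + K x * ‖Du t x‖ ^ 2)

/-- `‖∇K‖_∞`, the essential supremum over `ℝ²` of the Euclidean length of the gradient of `K`.
It is used for Lipschitz `K`, which is differentiable almost everywhere and has bounded gradient. -/
noncomputable def gradSupNorm (K : Plane → ℝ) : ℝ :=
  (eLpNorm (gradient K) ⊤ (volume : Measure Plane)).toReal

/-! The proof is a Morawetz argument. Let `E` be the conserved total energy and `E_R` the local one.
In two dimensions the functional `t E + ∫ u_t x·∇u + ½ ∫ u_t u` has derivative `∫ ∇·(K∇u) x·∇u`,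
which is formally `½ ∫ (x·∇K) |∇u|²`. The field `∇K` lives in the ball of radius `r₀`, where `x·∇K ≤
r₀ ‖∇K‖_∞ ≤ η₀ K`. The derivative is therefore at most `η₀` times the energy in that ball, hence at
most `η₀ E_R`.

Two further estimates turn this into an inequality for `E_R`.

Lower bound (`le_morawetz`). For `|x| > R` the coefficient is `k₀`, and the solution vanishes beyond
`|x| = √k₀ t + M` (`IsMildSolution.vanishesOutside`). There `|x u_t ∇u|` is at most `t + M/√k₀`
times the energy density, so `t E` absorbs it up to a constant. Inside the ball the loss is only
`R/√k_m` times the density. What survives is `(t - R/√k_m) E_R` minus a constant. It matters that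
the support spreads with the exterior speed `√k₀`, however fast waves travel where `K` varies.

Growth of `u` (`exists_norm_le_sqrt_log`). The time primitive `v = ∫₀ᵗ u` satisfies `‖u‖² + ∫ K
|∇v|² = ‖u₀‖² + 2 ∫ u₁ v`. A logarithmic Poincaré inequality (`IsWeakGradient.setIntegral_sq_le`)
bounds `v` on the support of `u₁` by `√(log t) ‖∇v‖`. Absorption gives `‖u(t)‖ = O(√(log t))`, hence
the same bound for `∫ u_t u`.

Together, `(t - c) E_R(t) ≤ A √(log t) + η₀ ∫₀ᵗ E_R`, and a Gronwall argument
(`isBigO_of_mul_le_integral`) yields the rate.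

Two regularity questions remain. A finite energy solution cannot be differentiated as above; since
`K` does not depend on time, its Steklov averages in time solve the same equation with velocity in
`H¹`, and all identities are proved for them and passed to the limit. Moreover `∇u` need not be
weakly differentiable in `x`, so the Rellich identity for `∫ ∇·(K∇u) x·∇u` is not obtained by
integrating by parts. It is replaced by an inequality (`IsCoefficient.rellich_le`): test the
equation with the dilate `u(s·)`, use convexity of the Dirichlet form, and let `s` increase to `1`.
-/

open scoped Topology

/-- Scalar square integrable functions on the plane. -/
abbrev L2s : Type := Lp ℝ 2 (volume : Measure Plane)

/-- Square integrable vector fields on the plane. -/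
abbrev L2v : Type := Lp Plane 2 (volume : Measure Plane)

/-! ### Test functions and weak gradients. -/

section Basic

variable {E : Type*} [NormedAddCommGroup E] [NormedSpace ℝ E]

lemma MeasureTheory.MemLp.integrable_smul_two {f : Plane → ℝ} {g : Plane → E}
    (hf : MemLp f 2 volume) (hg : MemLp g 2 volume) :
    Integrable (fun x => f x • g x) volume := by
  have h : MemLp (f • g) 1 volume := hg.smul hf
  exact memLp_one_iff_integrable.1 h

lemma continuous_gradient_of_contDiff {φ : Plane → ℝ} (hφ : ContDiff ℝ ∞ φ) :
    Continuous (gradient φ) := by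
  unfold gradient
  exact (LinearIsometryEquiv.continuous _).comp (hφ.continuous_fderiv (by simp))

lemma HasCompactSupport.gradient {φ : Plane → ℝ} (h : HasCompactSupport φ) :
    HasCompactSupport (gradient φ) := by
  have := (h.fderiv (𝕜 := ℝ)).comp_left (g := (InnerProductSpace.toDual ℝ Plane).symm) (map_zero _)
  exact this

lemma memLp_test {φ : Plane → ℝ} (hφ : ContDiff ℝ ∞ φ) (h : HasCompactSupport φ) :
    MemLp φ 2 volume := hφ.continuous.memLp_of_hasCompactSupport h

lemma memLp_gradient_test {φ : Plane → ℝ} (hφ : ContDiff ℝ ∞ φ) (h : HasCompactSupport φ) :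
    MemLp (gradient φ) 2 volume :=
  (continuous_gradient_of_contDiff hφ).memLp_of_hasCompactSupport h.gradient

lemma gradient_mul {φ ψ : Plane → ℝ} {x : Plane} (hφ : DifferentiableAt ℝ φ x)
    (hψ : DifferentiableAt ℝ ψ x) :
    gradient (fun y => φ y * ψ y) x = φ x • gradient ψ x + ψ x • gradient φ x := by
  unfold gradient
  have := fderiv_mul hφ hψ
  rw [show (fun y => φ y * ψ y) = φ * ψ from rfl, this]
  simp

lemma inner_gradient_apply (φ : Plane → ℝ) (x y : Plane) :
    inner ℝ (gradient φ x) y = fderiv ℝ φ x y := inner_gradient_left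

end Basic

/-- Multiplication by a smooth function. -/
lemma IsWeakGradient.mul {f : L2s} {g : L2v} (h : IsWeakGradient f g) {ψ : Plane → ℝ}
    (hψ : ContDiff ℝ ∞ ψ) {F : L2s} {G : L2v} (hF : F =ᵐ[volume] fun x => ψ x * f x)
    (hG : G =ᵐ[volume] fun x => ψ x • g x + f x • gradient ψ x) : IsWeakGradient F G := by
  intro φ hφ hφc
  have h1 := h (fun x => φ x * ψ x) (hφ.mul hψ) hφc.mul_right
  have e1 : ∀ x, gradient (fun y => φ y * ψ y) x = φ x • gradient ψ x + ψ x • gradient φ x :=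
    fun x => gradient_mul (hφ.differentiable (by simp) x) (hψ.differentiable (by simp) x)
  have c1 : MemLp (fun x => φ x • gradient ψ x) 2 volume :=
    (hφ.continuous.smul (continuous_gradient_of_contDiff hψ)).memLp_of_hasCompactSupport
      hφc.smul_right
  have c2 : MemLp (fun x => ψ x • gradient φ x) 2 volume :=
    (hψ.continuous.smul (continuous_gradient_of_contDiff hφ)).memLp_of_hasCompactSupport
      (hφc.gradient.smul_left)
  have c3 : MemLp (fun x => φ x * ψ x) 2 volume :=
    (hφ.continuous.mul hψ.continuous).memLp_of_hasCompactSupport hφc.mul_right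
  have i1 := (Lp.memLp f).integrable_smul_two c1
  have i2 := (Lp.memLp f).integrable_smul_two c2
  have i3 := c3.integrable_smul_two (Lp.memLp g)
  simp only [e1, smul_add] at h1
  rw [integral_add i1 i2] at h1
  have r1 : ∫ x, F x • gradient φ x = ∫ x, f x • ψ x • gradient φ x := by
    refine integral_congr_ae ?_
    filter_upwards [hF] with x hx
    rw [hx, smul_smul, mul_comm]
  have r2 : ∫ x, φ x • G x = (∫ x, (φ x * ψ x) • g x) + ∫ x, f x • φ x • gradient ψ x := by
    rw [← integral_add i3 i1]
    refine integral_congr_ae ?_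
    filter_upwards [hG] with x hx
    rw [hx, smul_add, smul_smul, smul_comm (φ x) (f x)]
  rw [r1, r2, neg_add, ← h1]
  abel

/-- Componentwise form of the weak gradient. -/
lemma IsWeakGradient.integral_mul_inner_gradient {f : L2s} {g : L2v} (h : IsWeakGradient f g) {φ : Plane → ℝ}
    (hφ : ContDiff ℝ ∞ φ) (hφc : HasCompactSupport φ) (e : Plane) :
    ∫ x, f x * inner ℝ (gradient φ x) e = - ∫ x, φ x * inner ℝ (g x) e := by
  have h1 := congrArg (fun v => inner ℝ e v) (h φ hφ hφc)
  simp only [inner_neg_right] at h1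
  rw [← integral_inner ((Lp.memLp f).integrable_smul_two (memLp_gradient_test hφ hφc)),
    ← integral_inner ((memLp_test hφ hφc).integrable_smul_two (Lp.memLp g))] at h1
  simp only [real_inner_smul_right] at h1
  simpa only [real_inner_comm] using h1

/-! ### Mollification, and passage from test functions to `H¹`. -/

section Mollify

variable {E : Type*} [NormedAddCommGroup E] [InnerProductSpace ℝ E]

/-- Translations act continuously on `L²`; here they appear as the additive action of the domain. -/
lemma tendsto_integral_inner_translate (a f : Lp E 2 (volume : Measure Plane)) :
    Tendsto (fun t : Plane => ∫ x, inner ℝ (a x) (f (x + t))) (𝓝 0)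
      (𝓝 (∫ x, inner ℝ (a x) (f x))) := by
  have : Fact ((2:ℝ≥0∞) ≠ ⊤) := ⟨by simp⟩
  have hc : Continuous (fun t : Plane => DomAddAct.mk t +ᵥ f) :=
    (continuous_vadd.comp (Continuous.prodMk (DomAddAct.continuous_mk) continuous_const))
  have h2 : Continuous (fun t : Plane => inner ℝ a (DomAddAct.mk t +ᵥ f)) :=
    continuous_const.inner hc
  have h3 := h2.tendsto 0
  have e : ∀ t : Plane, inner ℝ a (DomAddAct.mk t +ᵥ f) = ∫ x, inner ℝ (a x) (f (x + t)) := by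
    intro t
    rw [L2.inner_def]
    refine integral_congr_ae ?_
    filter_upwards [Lp.coeFn_compMeasurePreserving (E := E) (p := 2) (μ := volume) (μb := volume) f
      (measurePreserving_vadd t (volume : Measure Plane))] with x hx
    have : (DomAddAct.mk t +ᵥ f : Lp E 2 (volume : Measure Plane)) x = f (x + t) := by
      rw [add_comm]; exact hx
    rw [this]
  simp only [e] at h3
  simpa using h3

/-- The hypothesis of Fubini for pairing `a` with the convolution of `ρ` and `f`: by Young's
inequality the integrand is dominated by `|ρ| (|a|² + |f|²)`, with `f` translated. -/
lemma integrable_prod_bump_inner {ρ : Plane → ℝ} (hρ : Integrable ρ) (hρc : Continuous ρ)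
    {a f : Plane → E} (ha : MemLp a 2 volume) (hf : MemLp f 2 volume) :
    Integrable (fun p : Plane × Plane => ρ p.2 * inner ℝ (a p.1) (f (p.1 - p.2)))
      (volume.prod volume) := by
  have A : Integrable (fun x => ‖a x‖ ^ 2) := (memLp_two_iff_integrable_sq_norm ha.1).1 ha
  have F : Integrable (fun x => ‖f x‖ ^ 2) := (memLp_two_iff_integrable_sq_norm hf.1).1 hf
  have h1 := A.mul_prod (hρ.norm)
  have h2 := Integrable.convolution_integrand (ContinuousLinearMap.mul ℝ ℝ) hρ.norm F
  have mf : AEStronglyMeasurable (fun p : Plane × Plane => f (p.1 - p.2)) (volume.prod volume) :=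
    hf.1.comp_quasiMeasurePreserving
      (quasiMeasurePreserving_sub_of_right_invariant volume volume)
  have m : AEStronglyMeasurable (fun p : Plane × Plane => ρ p.2 * inner ℝ (a p.1) (f (p.1 - p.2)))
      (volume.prod volume) :=
    (hρc.comp continuous_snd).aestronglyMeasurable.mul (ha.1.comp_fst.inner mf)
  refine (h1.add h2).mono' m (Eventually.of_forall fun p => ?_)
  simp only [ContinuousLinearMap.mul_apply', Pi.add_apply]
  rw [norm_mul]
  have := norm_inner_le_norm (𝕜 := ℝ) (a p.1) (f (p.1 - p.2))
  nlinarith [norm_nonneg (ρ p.2), sq_nonneg (‖a p.1‖ - ‖f (p.1 - p.2)‖),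
    mul_le_mul_of_nonneg_left this (norm_nonneg (ρ p.2)),
    mul_nonneg (norm_nonneg (ρ p.2)) (sq_nonneg (‖a p.1‖ - ‖f (p.1 - p.2)‖)),
    mul_nonneg (norm_nonneg (ρ p.2)) (sq_nonneg (‖a p.1‖)),
    mul_nonneg (norm_nonneg (ρ p.2)) (sq_nonneg (‖f (p.1 - p.2)‖))]

/-- Mollification converges weakly. -/
lemma exists_mollify_close [CompleteSpace E] {a f : Plane → E} (ha : MemLp a 2 volume) (hf : MemLp f 2 volume)
    {ε : ℝ} (hε : 0 < ε) :
    ∀ᶠ δ in 𝓝[>] (0:ℝ), ∀ ρ : ContDiffBump (0 : Plane), ρ.rOut = δ →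
      |(∫ x, inner ℝ (a x) (convolution (ρ.normed volume) f (ContinuousLinearMap.lsmul ℝ ℝ)
        volume x)) - ∫ x, inner ℝ (a x) (f x)| ≤ ε := by
  have ht := tendsto_integral_inner_translate (ha.toLp a) (hf.toLp f)
  have ea : ∀ t : Plane, ∫ x, inner ℝ (ha.toLp a x) (hf.toLp f (x + t))
      = ∫ x, inner ℝ (a x) (f (x + t)) := by
    intro t
    refine integral_congr_ae ?_
    have h2 := (measurePreserving_add_right volume t).quasiMeasurePreserving.ae_eq_comp
      (hf.coeFn_toLp)
    filter_upwards [ha.coeFn_toLp, h2] with x h1 h2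
    simp only [Function.comp] at h2
    rw [h1, h2]
  have ea0 := ea 0
  simp only [add_zero] at ea0
  simp only [ea, ea0] at ht
  obtain ⟨δ, hδ, hball⟩ := Metric.tendsto_nhds_nhds.1 ht ε hε
  filter_upwards [Ioo_mem_nhdsGT hδ] with r hr ρ hρ
  -- By Fubini the pairing of `a` with the mollified `f` is an average, over small translations, of
  -- the correlation of `a` and `f`, which is continuous at zero.
  have key := ContDiffBump.dist_normed_convolution_le (φ := ρ) (μ := volume) (x₀ := (0:Plane))
    (g := fun t : Plane => ∫ x, inner ℝ (a x) (f (x + t))) (ε := ε) ?_ ?_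
  · rw [Real.dist_eq] at key
    simp only [add_zero] at key
    convert key using 3
    simp only [convolution, ContinuousLinearMap.lsmul_apply, zero_sub]
    have i := integrable_prod_bump_inner (ρ.integrable_normed (μ := volume))
      ρ.continuous_normed ha hf
    have sw := integral_integral_swap (f := fun x t => ρ.normed volume t * inner ℝ (a x) (f (x - t))) i
    simp only [integral_const_mul] at sw
    simp only [smul_eq_mul, ← sub_eq_add_neg]
    rw [← sw]
    refine integral_congr_ae ?_
    have hloc : LocallyIntegrable f volume := hf.locallyIntegrable (by norm_num)
    filter_upwards with x
    have hint : Integrable (fun t => ρ.normed volume t • f (x - t)) volume :=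
      (ρ.hasCompactSupport_normed (μ := volume)).convolutionExists_left
        (ContinuousLinearMap.lsmul ℝ ℝ) ρ.continuous_normed hloc x
    rw [← integral_inner hint]
    simp only [real_inner_smul_right]
  · refine AEStronglyMeasurable.integral_prod_right' (f := fun p : Plane × Plane =>
      (inner ℝ (a p.2) (f (p.2 + p.1)) : ℝ)) ?_
    refine ha.1.comp_snd.inner ?_
    simp only [add_comm]
    exact hf.1.comp_quasiMeasurePreserving (quasiMeasurePreserving_add volume volume)
  · intro t ht
    rw [hρ] at ht
    simp only [add_zero]
    exact (hball (lt_trans (by simpa using ht) hr.2)).le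

end Mollify

lemma gradient_comp_sub_left {ρ : Plane → ℝ} (hρ : ContDiff ℝ ∞ ρ) (x y : Plane) :
    gradient (fun y => ρ (x - y)) y = - gradient ρ (x - y) := by
  unfold gradient
  have h := ((hρ.differentiable (by simp) (x - y)).hasFDerivAt.comp y
    ((hasFDerivAt_id y).const_sub x)).fderiv
  have e : fderiv ℝ (fun y => ρ (x - y)) y = - fderiv ℝ ρ (x - y) := by
    refine Eq.trans h ?_
    ext v; simp
  rw [e, map_neg]

lemma memLp_mul_bounded {E : Type*} [NormedAddCommGroup E] [NormedSpace ℝ E] {ψ : Plane → ℝ}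
    {C : ℝ} (hψ : AEStronglyMeasurable ψ volume) (hb : ∀ x, |ψ x| ≤ C) {f : Plane → E}
    (hf : MemLp f 2 volume) : MemLp (fun x => ψ x • f x) 2 volume := by
  refine hf.of_le_mul (c := C) (hψ.smul hf.1) (Eventually.of_forall fun x => ?_)
  rw [norm_smul]
  exact mul_le_mul_of_nonneg_right (hb x) (norm_nonneg _)

lemma memLp_smul_bounded {E : Type*} [NormedAddCommGroup E] [NormedSpace ℝ E] {X : Plane → E}
    {C : ℝ} (hX : AEStronglyMeasurable X volume) (hb : ∀ x, ‖X x‖ ≤ C) {f : Plane → ℝ}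
    (hf : MemLp f 2 volume) : MemLp (fun x => f x • X x) 2 volume := by
  refine hf.of_le_mul (c := C) (hf.1.smul hX) (Eventually.of_forall fun x => ?_)
  rw [norm_smul, mul_comm]
  exact mul_le_mul_of_nonneg_right (hb x) (norm_nonneg _)

lemma MeasureTheory.MemLp.integrable_inner_two {E : Type*} [NormedAddCommGroup E]
    [InnerProductSpace ℝ E] {f g : Plane → E}
    (hf : MemLp f 2 volume) (hg : MemLp g 2 volume) :
    Integrable (fun x => inner ℝ (f x) (g x)) volume := by
  have := L2.integrable_inner (𝕜 := ℝ) (hf.toLp f) (hg.toLp g)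
  refine this.congr ?_
  filter_upwards [hf.coeFn_toLp, hg.coeFn_toLp] with x h1 h2
  rw [h1, h2]

lemma MeasureTheory.MemLp.integrable_mul_two {f g : Plane → ℝ}
    (hf : MemLp f 2 volume) (hg : MemLp g 2 volume) :
    Integrable (fun x => f x * g x) volume := hf.integrable_smul_two hg

/-- The gradient of a mollified function is the mollified weak gradient. -/
lemma IsWeakGradient.gradient_convolution {f : L2s} {g : L2v} (h : IsWeakGradient f g)
    {ρ : Plane → ℝ} (hρ : ContDiff ℝ ∞ ρ) (hρc : HasCompactSupport ρ) (x : Plane) :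
    gradient (convolution ρ f (ContinuousLinearMap.lsmul ℝ ℝ) volume) x
      = convolution ρ g (ContinuousLinearMap.lsmul ℝ ℝ) volume x := by
  have hf : LocallyIntegrable f volume := (Lp.memLp f).locallyIntegrable (by norm_num)
  have hg : LocallyIntegrable g volume := (Lp.memLp g).locallyIntegrable (by norm_num)
  refine ext_inner_right ℝ fun e => ?_
  rw [inner_gradient_apply, (hρc.hasFDerivAt_convolution_left (ContinuousLinearMap.lsmul ℝ ℝ)
    (hρ.of_le (by simp)) hf x).fderiv]
  have hφ : ContDiff ℝ ∞ (fun y => ρ (x - y)) := hρ.comp (contDiff_const.sub contDiff_id)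
  have hφc : HasCompactSupport (fun y => ρ (x - y)) :=
    hρc.comp_homeomorph (Homeomorph.subLeft x)
  have hw := h.integral_mul_inner_gradient hφ hφc e
  simp only [gradient_comp_sub_left hρ, inner_neg_left, inner_gradient_apply, mul_neg,
    integral_neg, neg_inj] at hw
  simp only [convolution]
  have hex := (hρc.fderiv (𝕜 := ℝ)).convolutionExists_left
    (((ContinuousLinearMap.lsmul ℝ ℝ : ℝ →L[ℝ] ℝ →L[ℝ] ℝ)).precompL Plane)
      (hρ.continuous_fderiv (by simp)) hf x
  rw [ContinuousLinearMap.integral_apply hex]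
  have hex2 := hρc.convolutionExists_left (ContinuousLinearMap.lsmul ℝ ℝ) hρ.continuous hg x
  rw [real_inner_comm, ← integral_inner hex2]
  simp only [ContinuousLinearMap.precompL_apply, ContinuousLinearMap.lsmul_apply, smul_eq_mul,
    real_inner_smul_right]
  rw [← integral_sub_left_eq_self _ volume x]
  rw [← integral_sub_left_eq_self (fun t => ρ t * inner ℝ e (g (x - t))) volume x]
  simp only [sub_sub_cancel]
  simp only [real_inner_comm] at hw ⊢
  rw [← hw]
  exact integral_congr_ae (Eventually.of_forall fun t => mul_comm _ _)

/-- Bounded support makes the mollification of `f` a test function. Weak convergence of the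
mollified pair suffices because the form is linear. -/
lemma inner_weakForm_eq_zero_of_support {a : L2s} {b : L2v}
    (h : ∀ φ : Plane → ℝ, ContDiff ℝ ∞ φ → HasCompactSupport φ →
      (∫ x, a x * φ x) + ∫ x, inner ℝ (b x) (gradient φ x) = 0)
    {f : L2s} {g : L2v} (hfg : IsWeakGradient f g) {r : ℝ}
    (hf : ∀ᵐ x, r < ‖x‖ → f x = 0) :
    (inner ℝ a f : ℝ) + inner ℝ b g = 0 := by
  by_contra hne
  set d := |(inner ℝ a f : ℝ) + inner ℝ b g| with hd
  have hdpos : 0 < d := abs_pos.2 hne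
  -- Two errors of at most `d / 3` cannot add up to the supposed defect `d`.
  have e1 := exists_mollify_close (Lp.memLp a) (Lp.memLp f) (ε := d / 3) (by positivity)
  have e2 := exists_mollify_close (Lp.memLp b) (Lp.memLp g) (ε := d / 3) (by positivity)
  obtain ⟨δ, ⟨h1, h2⟩, hδ⟩ := ((e1.and e2).and self_mem_nhdsWithin).exists
  have hδ : 0 < δ := hδ
  let ρ : ContDiffBump (0 : Plane) := ⟨δ / 2, δ, by positivity, by linarith⟩
  specialize h1 ρ rfl
  specialize h2 ρ rfl
  have hf' : LocallyIntegrable f volume := (Lp.memLp f).locallyIntegrable (by norm_num)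
  have hρ : ContDiff ℝ ∞ (ρ.normed volume) := ρ.contDiff_normed
  have hρc : HasCompactSupport (ρ.normed (volume : Measure Plane)) := ρ.hasCompactSupport_normed
  set φ := convolution (ρ.normed volume) f (ContinuousLinearMap.lsmul ℝ ℝ) volume with hφdef
  have hφ : ContDiff ℝ ∞ φ := hρc.contDiff_convolution_left _ hρ hf'
  have hφc : HasCompactSupport φ := by
    have : φ = convolution (ρ.normed volume) ((Metric.closedBall 0 r).indicator f)
        (ContinuousLinearMap.lsmul ℝ ℝ) volume := by
      refine convolution_congr _ (EventuallyEq.refl _ _) ?_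
      filter_upwards [hf] with x hx
      by_cases hxr : r < ‖x‖
      · rw [hx hxr, indicator_of_notMem]; simpa using hxr
      · rw [indicator_of_mem]; simpa using hxr
    rw [this]
    refine hρc.convolution _ (HasCompactSupport.intro (isCompact_closedBall (0:Plane) r) ?_)
    intro x hx
    exact indicator_of_notMem hx _
  have := h φ hφ hφc
  simp only [hφdef, hfg.gradient_convolution hρ hρc] at this
  rw [← hφdef] at this
  have ea : ∫ x, inner ℝ (a x) (φ x) = ∫ x, a x * φ x :=
    integral_congr_ae (Eventually.of_forall fun x => by simp [mul_comm])
  rw [ea] at h1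
  rw [L2.inner_def, L2.inner_def] at hd
  rw [abs_le] at h1 h2
  rcases abs_cases ((∫ x, inner ℝ (a x) (f x)) + ∫ x, (inner ℝ (b x) (g x) : ℝ)) with h3 | h3 <;>
    linarith [h1.1, h1.2, h2.1, h2.2]

/-- A smooth cutoff at scale `n`. -/
noncomputable def cutoff (r : ℝ) (x : Plane) : ℝ :=
  (⟨1, 2, by norm_num, by norm_num⟩ : ContDiffBump (0 : Plane)) (r⁻¹ • x)

lemma contDiff_cutoff (r : ℝ) : ContDiff ℝ ∞ (cutoff r) :=
  (ContDiffBump.contDiff _).comp (contDiff_const_smul _)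

lemma cutoff_mem_Icc (r : ℝ) (x : Plane) : cutoff r x ∈ Icc (0 : ℝ) 1 :=
  ⟨ContDiffBump.nonneg _, ContDiffBump.le_one _⟩

lemma abs_cutoff_le (r : ℝ) (x : Plane) : |cutoff r x| ≤ 1 :=
  abs_le.2 ⟨by linarith [(cutoff_mem_Icc r x).1], (cutoff_mem_Icc r x).2⟩

lemma cutoff_eq_one {r : ℝ} (hr : 0 < r) {x : Plane} (hx : ‖x‖ ≤ r) : cutoff r x = 1 := by
  refine ContDiffBump.one_of_mem_closedBall _ ?_
  simp only [Metric.mem_closedBall, dist_zero_right, norm_smul, norm_inv, Real.norm_eq_abs,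
    abs_of_pos hr]
  rw [inv_mul_le_one₀ hr]
  exact hx

lemma cutoff_eq_zero {r : ℝ} (hr : 0 < r) {x : Plane} (hx : 2 * r ≤ ‖x‖) : cutoff r x = 0 := by
  refine ContDiffBump.zero_of_le_dist _ ?_
  simp only [dist_zero_right, norm_smul, norm_inv, Real.norm_eq_abs, abs_of_pos hr]
  rwa [le_inv_mul_iff₀ hr, mul_comm]

/-- All cutoffs are rescalings of one bump, so a single constant serves every scale. -/
lemma exists_norm_gradient_cutoff_le :
    ∃ C : ℝ, 0 ≤ C ∧ ∀ r > 0, ∀ x, ‖gradient (cutoff r) x‖ ≤ C / r := by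
  let χ : ContDiffBump (0 : Plane) := ⟨1, 2, by norm_num, by norm_num⟩
  have hc : Continuous (gradient χ) := continuous_gradient_of_contDiff χ.contDiff
  obtain ⟨C, hC⟩ := hc.bounded_above_of_compact_support χ.hasCompactSupport.gradient
  refine ⟨C, (norm_nonneg _).trans (hC 0), fun r hr x => ?_⟩
  have : gradient (cutoff r) x = r⁻¹ • gradient χ (r⁻¹ • x) := by
    unfold gradient
    have : cutoff r = fun x => χ (r⁻¹ • x) := rfl
    rw [this, fderiv_comp_smul]
    simp
  rw [this, norm_smul, norm_inv, Real.norm_eq_abs, abs_of_pos hr, div_eq_inv_mul]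
  gcongr
  exact hC _

/-- A weak form that vanishes on test functions vanishes on `H¹`. -/
theorem inner_weakForm_eq_zero {a : L2s} {b : L2v}
    (h : ∀ φ : Plane → ℝ, ContDiff ℝ ∞ φ → HasCompactSupport φ →
      (∫ x, a x * φ x) + ∫ x, inner ℝ (b x) (gradient φ x) = 0)
    {f : L2s} {g : L2v} (hfg : IsWeakGradient f g) :
    (inner ℝ a f : ℝ) + inner ℝ b g = 0 := by
  obtain ⟨C, hC0, hC⟩ := exists_norm_gradient_cutoff_le
  have hpos : ∀ n : ℕ, (0:ℝ) < n + 1 := fun n => by positivity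
  have m1 : ∀ n : ℕ, MemLp (fun x => cutoff (n+1) x • f x) 2 volume := fun n =>
    memLp_mul_bounded (contDiff_cutoff _).continuous.aestronglyMeasurable (abs_cutoff_le _)
      (Lp.memLp f)
  have m2 : ∀ n : ℕ, MemLp (fun x => cutoff (n+1) x • g x) 2 volume := fun n =>
    memLp_mul_bounded (contDiff_cutoff _).continuous.aestronglyMeasurable (abs_cutoff_le _)
      (Lp.memLp g)
  have m3 : ∀ n : ℕ, MemLp (fun x => f x • gradient (cutoff (n+1)) x) 2 volume := fun n =>
    memLp_smul_bounded (continuous_gradient_of_contDiff (contDiff_cutoff _)).aestronglyMeasurable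
      (hC _ (hpos n)) (Lp.memLp f)
  have key : ∀ n : ℕ, (∫ x, cutoff (n+1) x * (a x * f x)) + ((∫ x, cutoff (n+1) x *
      inner ℝ (b x) (g x)) + ∫ x, f x * inner ℝ (b x) (gradient (cutoff (n+1)) x)) = 0 := by
    intro n
    have := inner_weakForm_eq_zero_of_support h
      (hfg.mul (contDiff_cutoff (n+1)) (F := (m1 n).toLp _) (G := ((m2 n).add (m3 n)).toLp _)
      (m1 n).coeFn_toLp ((m2 n).add (m3 n)).coeFn_toLp) (r := 2 * (n+1)) ?_
    · rw [← this, L2.inner_def, L2.inner_def]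
      congr 1
      · refine integral_congr_ae ?_
        filter_upwards [(m1 n).coeFn_toLp] with x hx
        rw [hx]; simp; ring
      · have i2 := (Lp.memLp b).integrable_inner_two (m2 n)
        have i3 := (Lp.memLp b).integrable_inner_two (m3 n)
        simp only [real_inner_smul_right] at i2 i3
        rw [← integral_add i2 i3]
        refine integral_congr_ae ?_
        filter_upwards [((m2 n).add (m3 n)).coeFn_toLp] with x hx
        rw [hx]
        simp [inner_add_right, real_inner_smul_right]
    · filter_upwards [(m1 n).coeFn_toLp] with x hx hxn
      rw [hx, cutoff_eq_zero (hpos n) hxn.le]; simp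
  have ev : ∀ x : Plane, ∀ᶠ n : ℕ in atTop, cutoff (n+1) x = 1 := by
    intro x
    obtain ⟨N, hN⟩ := exists_nat_ge ‖x‖
    filter_upwards [eventually_ge_atTop N] with n hn
    refine cutoff_eq_one (hpos n) ?_
    have : (N:ℝ) ≤ n := by exact_mod_cast hn
    linarith
  have lim : ∀ F : Plane → ℝ, Integrable F volume →
      Tendsto (fun n : ℕ => ∫ x, cutoff (n+1) x * F x) atTop (𝓝 (∫ x, F x)) := by
    intro F hF
    refine tendsto_integral_of_dominated_convergence (fun x => ‖F x‖)
      (fun n => (contDiff_cutoff _).continuous.aestronglyMeasurable.mul hF.1) hF.norm ?_ ?_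
    · intro n
      filter_upwards with x
      rw [norm_mul]
      exact mul_le_of_le_one_left (norm_nonneg _) (abs_cutoff_le _ _)
    · filter_upwards with x
      refine tendsto_const_nhds.congr' ?_
      filter_upwards [ev x] with n hn
      rw [hn, one_mul]
  have l1 := lim _ ((Lp.memLp a).integrable_mul_two (Lp.memLp f))
  have l2 := lim _ ((Lp.memLp b).integrable_inner_two (Lp.memLp g))
  -- The commutator with the cutoff is `O(1/n)`, since `f b` is integrable.
  have l3 : Tendsto (fun n : ℕ => ∫ x, f x * inner ℝ (b x) (gradient (cutoff (n+1)) x)) atTop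
      (𝓝 0) := by
    have hi : Integrable (fun x => ‖f x‖ * ‖b x‖) :=
      (Lp.memLp f).norm.integrable_mul_two (Lp.memLp b).norm
    have hb : ∀ n : ℕ, ‖∫ x, f x * inner ℝ (b x) (gradient (cutoff (n+1)) x)‖
        ≤ (∫ x, ‖f x‖ * ‖b x‖) * (C / (n+1)) := by
      intro n
      rw [← integral_mul_const]
      refine norm_integral_le_of_norm_le (hi.mul_const _) ?_
      filter_upwards with x
      rw [norm_mul, mul_assoc]
      gcongr
      refine (norm_inner_le_norm _ _).trans ?_
      gcongr
      exact hC _ (hpos n) x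
    refine squeeze_zero_norm hb ?_
    rw [← mul_zero (∫ x, ‖f x‖ * ‖b x‖)]
    refine Tendsto.const_mul _ ?_
    exact Tendsto.div_atTop tendsto_const_nhds
      (tendsto_atTop_add_const_right _ _ tendsto_natCast_atTop_atTop)
  have l := l1.add (l2.add l3)
  simp only [key, add_zero] at l
  have := tendsto_nhds_unique l tendsto_const_nhds
  rw [← this, L2.inner_def, L2.inner_def]
  congr 1
  exact integral_congr_ae (Eventually.of_forall fun x => by simp [mul_comm])

/-! ### Bounded multipliers on `L²`, and functions vanishing outside a ball. -/

section Operators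

variable {E : Type*} [NormedAddCommGroup E] [NormedSpace ℝ E]

/-- Multiplication by an essentially bounded function, as an operator on `L²`. -/
noncomputable def mulOp {ψ : Plane → ℝ} (hψ : MemLp ψ ⊤ volume) :
    Lp E 2 (volume : Measure Plane) →L[ℝ] Lp E 2 (volume : Measure Plane) :=
  (ContinuousLinearMap.lsmul ℝ ℝ).holderL volume ⊤ 2 2 (hψ.toLp ψ)

lemma coeFn_mulOp {ψ : Plane → ℝ} (hψ : MemLp ψ ⊤ volume) (f : Lp E 2 (volume : Measure Plane)) :
    mulOp hψ f =ᵐ[volume] fun x => ψ x • f x := by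
  filter_upwards [ContinuousLinearMap.coeFn_holder (r := 2)
    (ContinuousLinearMap.lsmul ℝ ℝ : ℝ →L[ℝ] E →L[ℝ] E)
    (hψ.toLp ψ) f, hψ.coeFn_toLp] with x h1 h2
  rw [h2] at h1
  exact h1

/-- Inner product with an essentially bounded vector field, as an operator on `L²`. -/
noncomputable def dotOp {X : Plane → Plane} (hX : MemLp X ⊤ volume) : L2v →L[ℝ] L2s :=
  (innerSL ℝ).holderL volume ⊤ 2 2 (hX.toLp X)

lemma coeFn_dotOp {X : Plane → Plane} (hX : MemLp X ⊤ volume) (g : L2v) :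
    dotOp hX g =ᵐ[volume] fun x => inner ℝ (X x) (g x) := by
  filter_upwards [ContinuousLinearMap.coeFn_holder (r := 2) (innerSL ℝ : Plane →L[ℝ] Plane →L[ℝ] ℝ)
    (hX.toLp X) g, hX.coeFn_toLp] with x h1 h2
  rw [h2] at h1
  exact h1

/-- Multiplication of a function by an essentially bounded vector field. -/
noncomputable def smulOp {X : Plane → Plane} (hX : MemLp X ⊤ volume) : L2s →L[ℝ] L2v :=
  (ContinuousLinearMap.lsmul ℝ ℝ : ℝ →L[ℝ] Plane →L[ℝ] Plane).flip.holderL volume ⊤ 2 2 (hX.toLp X)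

lemma coeFn_smulOp {X : Plane → Plane} (hX : MemLp X ⊤ volume) (f : L2s) :
    smulOp hX f =ᵐ[volume] fun x => f x • X x := by
  filter_upwards [ContinuousLinearMap.coeFn_holder (r := 2)
    (ContinuousLinearMap.lsmul ℝ ℝ : ℝ →L[ℝ] Plane →L[ℝ] Plane).flip
    (hX.toLp X) f, hX.coeFn_toLp] with x h1 h2
  rw [h2] at h1
  exact h1

end Operators

section Support

variable {E : Type*} [NormedAddCommGroup E] [NormedSpace ℝ E]

/-- `f` vanishes almost everywhere outside the closed ball of radius `r`. -/
def VanishesOutside (r : ℝ) (f : Plane → E) : Prop := ∀ᵐ x, r < ‖x‖ → f x = 0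

lemma exists_bound_on_ball {F : Type*} [NormedAddCommGroup F] {ψ : Plane → F} (hψ : Continuous ψ)
    (r : ℝ) : ∃ C, ∀ x, ‖x‖ ≤ r → ‖ψ x‖ ≤ C := by
  obtain ⟨C, hC⟩ := (isCompact_closedBall (0:Plane) r).exists_bound_of_continuousOn hψ.continuousOn
  exact ⟨C, fun x hx => hC x (by simpa using hx)⟩

lemma VanishesOutside.memLp_smul {r : ℝ} {f : Plane → E} (h : VanishesOutside r f)
    (hf : MemLp f 2 volume) {ψ : Plane → ℝ} (hψ : Continuous ψ) :
    MemLp (fun x => ψ x • f x) 2 volume := by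
  obtain ⟨C, hC⟩ := exists_bound_on_ball hψ r
  refine hf.of_le_mul (c := C) (hψ.aestronglyMeasurable.smul hf.1) ?_
  filter_upwards [h] with x hx
  rcases le_or_gt ‖x‖ r with hr | hr
  · rw [norm_smul]; exact mul_le_mul_of_nonneg_right (hC x hr) (norm_nonneg _)
  · simp [hx hr]

lemma VanishesOutside.memLp_smul_vec {r : ℝ} {f : Plane → ℝ} (h : VanishesOutside r f)
    (hf : MemLp f 2 volume) {X : Plane → E} (hX : Continuous X) :
    MemLp (fun x => f x • X x) 2 volume := by
  obtain ⟨C, hC⟩ := exists_bound_on_ball hX r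
  refine hf.of_le_mul (c := C) (hf.1.smul hX.aestronglyMeasurable) ?_
  filter_upwards [h] with x hx
  rcases le_or_gt ‖x‖ r with hr | hr
  · rw [norm_smul, mul_comm]; exact mul_le_mul_of_nonneg_right (hC x hr) (norm_nonneg _)
  · simp [hx hr]

lemma VanishesOutside.memLp_inner {r : ℝ} {g : Plane → Plane} (h : VanishesOutside r g)
    (hg : MemLp g 2 volume) {X : Plane → Plane} (hX : Continuous X) :
    MemLp (fun x => inner ℝ (X x) (g x)) 2 volume := by
  obtain ⟨C, hC⟩ := exists_bound_on_ball hX r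
  refine hg.of_le_mul (c := C) (hX.aestronglyMeasurable.inner hg.1) ?_
  filter_upwards [h] with x hx
  rcases le_or_gt ‖x‖ r with hr | hr
  · exact (norm_inner_le_norm _ _).trans (mul_le_mul_of_nonneg_right (hC x hr) (norm_nonneg _))
  · simp [hx hr]

end Support

/-! ### Integration by parts in `H¹` and against the position field. -/

lemma memLp_top_of_forall_le {E : Type*} [NormedAddCommGroup E] {X : Plane → E} {C : ℝ}
    (hX : AEStronglyMeasurable X volume) (hb : ∀ x, ‖X x‖ ≤ C) : MemLp X ⊤ volume :=
  memLp_top_of_bound hX C (Eventually.of_forall hb)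

/-- Integration by parts for two `H¹` functions. -/
lemma IsWeakGradient.integral_mul_inner_add {f₁ f₂ : L2s} {g₁ g₂ : L2v}
    (h₁ : IsWeakGradient f₁ g₁) (h₂ : IsWeakGradient f₂ g₂) (e : Plane) :
    (∫ x, f₂ x * inner ℝ e (g₁ x)) + ∫ x, f₁ x * inner ℝ e (g₂ x) = 0 := by
  have he : MemLp (fun _ : Plane => e) ⊤ volume :=
    memLp_top_of_forall_le aestronglyMeasurable_const (fun _ => le_refl ‖e‖)
  -- On test functions this weak form is the definition of the weak gradient of `f₁`; it is then
  -- extended to the `H¹` function `f₂`.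
  have key := inner_weakForm_eq_zero (a := dotOp he g₁) (b := smulOp he f₁) ?_ h₂
  · rw [L2.inner_def, L2.inner_def] at key
    rw [← key]
    congr 1
    · refine integral_congr_ae ?_
      filter_upwards [coeFn_dotOp he g₁] with x hx
      rw [hx]; simp
    · refine integral_congr_ae ?_
      filter_upwards [coeFn_smulOp he f₁] with x hx
      rw [hx, real_inner_smul_left]
  · intro φ hφ hφc
    have := h₁.integral_mul_inner_gradient hφ hφc e
    rw [← neg_eq_iff_add_eq_zero]
    have e1 : ∫ x, dotOp he g₁ x * φ x = ∫ x, φ x * inner ℝ (g₁ x) e := by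
      refine integral_congr_ae ?_
      filter_upwards [coeFn_dotOp he g₁] with x hx
      rw [hx, mul_comm, real_inner_comm]
    have e2 : ∫ x, inner ℝ (smulOp he f₁ x) (gradient φ x)
        = ∫ x, f₁ x * inner ℝ (gradient φ x) e := by
      refine integral_congr_ae ?_
      filter_upwards [coeFn_smulOp he f₁] with x hx
      rw [hx, real_inner_smul_left, real_inner_comm]
    rw [e1, e2, this]

/-- The `i`-th unit vector. -/
noncomputable def unitVec (i : Fin 2) : Plane := EuclideanSpace.single i (1:ℝ)

lemma inner_unitVec (i : Fin 2) (x : Plane) : inner ℝ (unitVec i) x = x i := by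
  simp [unitVec, EuclideanSpace.inner_single_left]

lemma contDiff_coord (i : Fin 2) : ContDiff ℝ ∞ (fun x : Plane => x i) := by
  simp only [← inner_unitVec]
  exact contDiff_const.inner ℝ contDiff_id

lemma gradient_coord (i : Fin 2) (x : Plane) : gradient (fun x : Plane => x i) x = unitVec i := by
  refine ext_inner_right ℝ fun v => ?_
  rw [inner_gradient_apply]
  have : HasFDerivAt (fun x : Plane => x i) (innerSL ℝ (unitVec i)) x := by
    simp only [← inner_unitVec]
    exact (innerSL ℝ (unitVec i)).hasFDerivAt
  rw [this.fderiv]; simp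

lemma sum_coord_mul_inner (x v : Plane) :
    ∑ i, x i * inner ℝ (unitVec i) v = inner ℝ x v := by
  simp only [inner_unitVec, Fin.sum_univ_two]
  simp [PiLp.inner_apply, Fin.sum_univ_two, mul_comm]

/-- Integration by parts with `x_i f₂` in place of `f₂`, summed over `i`. The factor `2` is the
divergence of `x` in the plane, and the support hypotheses keep `x_i f₂` in `H¹`. -/
lemma integral_mul_inner_position_add {f₁ f₂ : L2s} {g₁ g₂ : L2v}
    (h₁ : IsWeakGradient f₁ g₁) (h₂ : IsWeakGradient f₂ g₂) {r : ℝ}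
    (hf₂ : VanishesOutside r f₂) (hg₂ : VanishesOutside r g₂) :
    (∫ x, f₂ x * inner ℝ x (g₁ x)) + ∫ x, f₁ x * inner ℝ x (g₂ x) = - 2 * ∫ x, f₁ x * f₂ x := by
  have m1 := fun i => hf₂.memLp_smul (Lp.memLp f₂) (contDiff_coord i).continuous
  have m2 := fun i => hg₂.memLp_smul (Lp.memLp g₂) (contDiff_coord i).continuous
  have m3 := fun i => hf₂.memLp_smul_vec (Lp.memLp f₂)
    (continuous_gradient_of_contDiff (contDiff_coord i))
  have mu := fun (i : Fin 2) (g : L2v) => (Lp.memLp g).const_inner (𝕜 := ℝ) (unitVec i)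
  have key : ∀ i : Fin 2, (∫ x, f₂ x * (x i * inner ℝ (unitVec i) (g₁ x)))
      + (∫ x, f₁ x * (x i * inner ℝ (unitVec i) (g₂ x))) = - ∫ x, f₁ x * f₂ x := by
    intro i
    have hp : IsWeakGradient ((m1 i).toLp _) (((m2 i).add (m3 i)).toLp _) :=
      h₂.mul (contDiff_coord i) (m1 i).coeFn_toLp ((m2 i).add (m3 i)).coeFn_toLp
    have := h₁.integral_mul_inner_add hp (unitVec i)
    have e1 : ∫ x, (m1 i).toLp _ x * inner ℝ (unitVec i) (g₁ x)
        = ∫ x, f₂ x * (x i * inner ℝ (unitVec i) (g₁ x)) := by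
      refine integral_congr_ae ?_
      filter_upwards [(m1 i).coeFn_toLp] with x hx
      rw [hx, smul_eq_mul]; ring
    have i2 : Integrable (fun x => f₁ x * (x i * inner ℝ (unitVec i) (g₂ x))) := by
      have := (Lp.memLp f₁).integrable_mul_two ((m2 i).const_inner (𝕜 := ℝ) (unitVec i))
      simpa only [real_inner_smul_right] using this
    have i3 := (Lp.memLp f₁).integrable_mul_two (Lp.memLp f₂)
    have e2 : ∫ x, f₁ x * inner ℝ (unitVec i) (((m2 i).add (m3 i)).toLp _ x)
        = (∫ x, f₁ x * (x i * inner ℝ (unitVec i) (g₂ x))) + ∫ x, f₁ x * f₂ x := by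
      rw [← integral_add i2 i3]
      refine integral_congr_ae ?_
      filter_upwards [((m2 i).add (m3 i)).coeFn_toLp] with x hx
      rw [hx]
      simp only [Pi.add_apply, gradient_coord, inner_add_right, real_inner_smul_right]
      simp [unitVec]
      ring
    rw [e1, e2] at this
    linarith
  have i1 : ∀ i : Fin 2, Integrable (fun x => f₂ x * (x i * inner ℝ (unitVec i) (g₁ x))) := by
    intro i
    refine ((m1 i).integrable_mul_two (mu i g₁)).congr (Eventually.of_forall fun x => ?_)
    simp only [smul_eq_mul]; ring
  have i2 : ∀ i : Fin 2, Integrable (fun x => f₁ x * (x i * inner ℝ (unitVec i) (g₂ x))) := by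
    intro i
    have := (Lp.memLp f₁).integrable_mul_two ((m2 i).const_inner (𝕜 := ℝ) (unitVec i))
    simpa only [real_inner_smul_right] using this
  have k : ∑ i : Fin 2, ((∫ x, f₂ x * (x i * inner ℝ (unitVec i) (g₁ x)))
      + (∫ x, f₁ x * (x i * inner ℝ (unitVec i) (g₂ x)))) = - 2 * ∫ x, f₁ x * f₂ x := by
    simp only [key]; simp
  rw [Finset.sum_add_distrib, ← integral_finsetSum _ (fun i _ => i1 i),
    ← integral_finsetSum _ (fun i _ => i2 i)] at k
  simpa only [← Finset.mul_sum, sum_coord_mul_inner] using k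

/-- The bracket on the left is the divergence of the field `φ x`; the weak gradient is tested with
each component `x_i φ`. -/
lemma IsWeakGradient.integral_mul_divergence {f : L2s} {g : L2v} (h : IsWeakGradient f g)
    {φ : Plane → ℝ} (hφ : ContDiff ℝ ∞ φ) (hφc : HasCompactSupport φ) :
    ∫ x, f x * (2 * φ x + inner ℝ x (gradient φ x)) = - ∫ x, φ x * inner ℝ x (g x) := by
  have hx := fun i => contDiff_coord i
  have hc : ∀ i, HasCompactSupport (fun x : Plane => x i * φ x) := fun i => hφc.mul_left
  have hs : ∀ i, ContDiff ℝ ∞ (fun x : Plane => x i * φ x) := fun i => (hx i).mul hφ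
  have key := fun i => h.integral_mul_inner_gradient (hs i) (hc i) (unitVec i)
  have k : ∑ i, ∫ x, f x * inner ℝ (gradient (fun y : Plane => y i * φ y) x) (unitVec i)
      = ∑ i, - ∫ x, x i * φ x * inner ℝ (g x) (unitVec i) := Finset.sum_congr rfl fun i _ => key i
  rw [Finset.sum_neg_distrib, ← integral_finsetSum, ← integral_finsetSum] at k
  · refine Eq.trans ?_ (k.trans (congrArg Neg.neg ?_))
    · refine integral_congr_ae (Eventually.of_forall fun x => ?_)
      simp only
      rw [← Finset.mul_sum]
      congr 1
      have : ∀ i, gradient (fun y : Plane => y i * φ y) x = x i • gradient φ x + φ x • unitVec i := by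
        intro i
        rw [gradient_mul ((hx i).differentiable (by simp) x) (hφ.differentiable (by simp) x),
          gradient_coord]
      have hi : ∀ i, (inner ℝ (gradient φ x) (unitVec i) : ℝ) = inner ℝ (unitVec i) (gradient φ x) :=
        fun i => real_inner_comm _ _
      simp only [this, inner_add_left, real_inner_smul_left, Finset.sum_add_distrib, hi]
      rw [sum_coord_mul_inner]
      simp [unitVec]; ring
    · refine integral_congr_ae (Eventually.of_forall fun x => ?_)
      simp only
      rw [← sum_coord_mul_inner x (g x), Finset.mul_sum]
      refine Finset.sum_congr rfl fun i _ => ?_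
      rw [real_inner_comm]; ring
  · intro i _
    exact (memLp_test (hs i) (hc i)).integrable_mul_two ((Lp.memLp g).inner_const _)
  · intro i _
    exact (Lp.memLp f).integrable_mul_two ((memLp_gradient_test (hs i) (hc i)).inner_const _)

/-! ### Dilations and the radial derivative `x·∇f`. -/

section Dilation

variable {E : Type*} [NormedAddCommGroup E]

lemma quasiMeasurePreserving_dilation {s : ℝ} (hs : 0 < s) :
    Measure.QuasiMeasurePreserving (fun x : Plane => s • x) volume volume := by
  refine ⟨measurable_const_smul s, ?_⟩
  rw [Measure.map_addHaar_smul _ hs.ne']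
  exact Measure.smul_absolutelyContinuous

lemma memLp_dilation {f : Plane → E} (hf : MemLp f 2 volume) {s : ℝ} (hs : 0 < s) :
    MemLp (fun x => f (s • x)) 2 volume := by
  have h : MemLp f 2 (Measure.map (fun x : Plane => s • x) volume) := by
    rw [Measure.map_addHaar_smul _ hs.ne']
    exact hf.smul_measure (by simp)
  exact h.comp_of_map (measurable_const_smul s).aemeasurable

lemma integral_dilation [NormedSpace ℝ E] (F : Plane → E) (s : ℝ) :
    ∫ x, F (s • x) = (s ^ 2)⁻¹ • ∫ x, F x := by
  rw [Measure.integral_comp_smul]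
  simp

lemma VanishesOutside.dilation {f : Plane → E} [NormedSpace ℝ E] {r : ℝ}
    (h : VanishesOutside r f) {s : ℝ}
    (hs : 0 < s) : VanishesOutside (r / s) (fun x => f (s • x)) := by
  filter_upwards [(quasiMeasurePreserving_dilation hs).ae h] with x hx hr
  refine hx ?_
  rw [norm_smul, Real.norm_eq_abs, abs_of_pos hs]
  rw [div_lt_iff₀ hs] at hr
  linarith

lemma gradient_dilation (φ : Plane → ℝ) (s : ℝ) (x : Plane) :
    gradient (fun y => φ (s • y)) x = s • gradient φ (s • x) := by
  unfold gradient
  rw [fderiv_comp_smul]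
  simp

end Dilation

lemma IsWeakGradient.dilation {f : L2s} {g : L2v} (h : IsWeakGradient f g) {s : ℝ} (hs : 0 < s)
    {F : L2s} {G : L2v} (hF : F =ᵐ[volume] fun x => f (s • x))
    (hG : G =ᵐ[volume] fun x => s • g (s • x)) : IsWeakGradient F G := by
  intro φ hφ hφc
  have hψ : ContDiff ℝ ∞ (fun x => φ (s⁻¹ • x)) := hφ.comp (contDiff_const_smul _)
  have hψc : HasCompactSupport (fun x => φ (s⁻¹ • x)) := hφc.comp_smul (by positivity)
  have key := h _ hψ hψc
  simp only [gradient_dilation] at key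
  have e1 : ∫ x, F x • gradient φ x = (s ^ 2)⁻¹ • ∫ x, f x • gradient φ (s⁻¹ • x) := by
    rw [← integral_dilation _ s]
    refine integral_congr_ae ?_
    filter_upwards [hF] with x hx
    rw [hx, smul_smul, inv_mul_cancel₀ hs.ne', one_smul]
  have e2 : ∫ x, φ x • G x = (s ^ 2)⁻¹ • ∫ x, φ (s⁻¹ • x) • s • g x := by
    rw [← integral_dilation _ s]
    refine integral_congr_ae ?_
    filter_upwards [hG] with x hx
    rw [hx, smul_smul s⁻¹ s, inv_mul_cancel₀ hs.ne', one_smul]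
  rw [e1, e2, ← smul_neg]
  congr 1
  have k2 := congrArg (fun v => s • v) key
  simp only [smul_neg, ← integral_smul] at k2
  have e3 : ∀ (c : ℝ) (v : Plane), s • c • s⁻¹ • v = c • v := by
    intro c v
    rw [smul_comm s c, smul_smul s, mul_inv_cancel₀ hs.ne', one_smul]
  simp only [e3] at k2
  exact k2.trans (congrArg Neg.neg (integral_congr_ae (Eventually.of_forall fun x =>
    smul_comm _ _ _)))

/-- The differentiated function is `s ↦ ∫ φ(x) f(s x) dx`, with the dilation moved onto the smooth
factor so that differentiation under the integral is legitimate. The result is rewritten through the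
divergence of `φ(·/s) x`. -/
lemma hasDerivAt_integral_dilation {f : L2s} {g : L2v} (h : IsWeakGradient f g) {r : ℝ}
    (hf : VanishesOutside r f) {φ : Plane → ℝ} (hφ : ContDiff ℝ ∞ φ)
    (hφc : HasCompactSupport φ) {s : ℝ} (hs : 0 < s) :
    HasDerivAt (fun s : ℝ => (s ^ 2)⁻¹ * ∫ x, φ (s⁻¹ • x) * f x)
      ((s ^ 3)⁻¹ * ∫ x, φ (s⁻¹ • x) * inner ℝ x (g x)) s := by
  have hψ : ContDiff ℝ ∞ (fun x => φ (s⁻¹ • x)) := hφ.comp (contDiff_const_smul _)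
  have hψc : HasCompactSupport (fun x => φ (s⁻¹ • x)) := hφc.comp_smul (by positivity)
  have hdiv := h.integral_mul_divergence hψ hψc
  obtain ⟨C₂, hC₂⟩ := (hφ.continuous_fderiv (by simp)).bounded_above_of_compact_support
    (hφc.fderiv (𝕜 := ℝ))
  have hC₂0 : 0 ≤ C₂ := (norm_nonneg _).trans (hC₂ 0)
  have fint : Integrable f volume := by
    have : Integrable (fun x => (Metric.closedBall (0:Plane) r).indicator (fun _ => (1:ℝ)) x * f x) :=
      ((memLp_indicator_const 2 measurableSet_closedBall 1
        (Or.inr (isCompact_closedBall (0:Plane) r).measure_lt_top.ne)) :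
        MemLp _ 2 volume).integrable_mul_two (Lp.memLp f)
    refine this.congr ?_
    filter_upwards [hf] with x hx
    by_cases hxr : r < ‖x‖
    · rw [hx hxr, mul_zero]
    · rw [indicator_of_mem (by simpa using hxr), one_mul]
  have i1 := (memLp_test hψ hψc).integrable_mul_two (Lp.memLp f)
  have hder : HasDerivAt (fun s : ℝ => ∫ x, φ (s⁻¹ • x) * f x)
      (∫ x, fderiv ℝ φ (s⁻¹ • x) (-(s ^ 2)⁻¹ • x) * f x) s := by
    refine (hasDerivAt_integral_of_dominated_loc_of_deriv_le
      (F' := fun s x => fderiv ℝ φ (s⁻¹ • x) (-(s ^ 2)⁻¹ • x) * f x)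
      (bound := fun x => C₂ * (((s/2) ^ 2)⁻¹ * r) * ‖f x‖)
      (Ioi_mem_nhds (show s / 2 < s by linarith)) ?_ i1 ?_ ?_ (fint.norm.const_mul _) ?_).2
    · refine Eventually.of_forall fun t => ?_
      exact (hφ.continuous.comp (continuous_const_smul _)).aestronglyMeasurable.mul fint.1
    · refine AEStronglyMeasurable.mul (Continuous.aestronglyMeasurable ?_) fint.1
      exact ((hφ.continuous_fderiv (by simp)).comp (continuous_const_smul _)).clm_apply
        (continuous_const_smul _)
    · filter_upwards [hf] with x hx t ht
      by_cases hxr : r < ‖x‖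
      · simp [hx hxr]
      · rw [norm_mul]
        have ht : s / 2 < t := ht
        have htpos : 0 < t := by linarith
        gcongr
        refine (ContinuousLinearMap.le_opNorm _ _).trans ?_
        refine mul_le_mul (hC₂ _) ?_ (norm_nonneg _) hC₂0
        rw [norm_smul, norm_neg, norm_inv, norm_pow, Real.norm_eq_abs, abs_of_pos htpos]
        gcongr
        exact not_lt.1 hxr
    · filter_upwards with x t ht
      have ht : s / 2 < t := ht
      have htpos : t ≠ 0 := by linarith
      have h1 : HasDerivAt (fun t : ℝ => t⁻¹ • x) (-(t ^ 2)⁻¹ • x) t :=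
        (hasDerivAt_inv htpos).smul_const x
      have h2 := ((hφ.differentiable (by simp) (t⁻¹ • x)).hasFDerivAt).comp_hasDerivAt t h1
      exact h2.mul_const _
  have hinv : HasDerivAt (fun s : ℝ => (s ^ 2)⁻¹) (-(2 * s) / (s ^ 2) ^ 2) s := by
    refine ((hasDerivAt_pow 2 s).inv (pow_ne_zero 2 hs.ne')).congr_deriv ?_
    simp
  refine (hinv.mul hder).congr_deriv ?_
  have : ∫ x, φ (s⁻¹ • x) * inner ℝ x (g x) = - ∫ x, f x * (2 * φ (s⁻¹ • x) +
      inner ℝ x (gradient (fun x => φ (s⁻¹ • x)) x)) := by rw [hdiv, neg_neg]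
  rw [this]
  have e : ∀ x, f x * (2 * φ (s⁻¹ • x) + inner ℝ x (gradient (fun x => φ (s⁻¹ • x)) x))
      = 2 * (φ (s⁻¹ • x) * f x) - s * (fderiv ℝ φ (s⁻¹ • x) (-(s ^ 2)⁻¹ • x) * f x) := by
    intro x
    rw [gradient_dilation, real_inner_smul_right, real_inner_comm, inner_gradient_apply, map_smul,
      smul_eq_mul]
    field_simp
    ring
  simp only [e]
  have i2 : Integrable (fun x => fderiv ℝ φ (s⁻¹ • x) (-(s ^ 2)⁻¹ • x) * f x) := by
    have hc : Continuous (fun x => fderiv ℝ φ (s⁻¹ • x) (-(s ^ 2)⁻¹ • x)) :=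
      ((hφ.continuous_fderiv (by simp)).comp (continuous_const_smul _)).clm_apply
        (continuous_const_smul _)
    obtain ⟨C, hC⟩ := exists_bound_on_ball hc r
    refine (fint.norm.const_mul C).mono' (hc.aestronglyMeasurable.mul fint.1) ?_
    filter_upwards [hf] with x hx
    by_cases hxr : r < ‖x‖
    · simp [hx hxr]
    · rw [norm_mul]
      exact mul_le_mul_of_nonneg_right (hC x (not_lt.1 hxr)) (norm_nonneg _)
  rw [integral_sub (i1.const_mul 2) (i2.const_mul s), integral_const_mul, integral_const_mul]
  field_simp
  ring

/-- Weak convergence needs to be checked only on a dense set once the family is bounded; the bound,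
too, is asked only on that set. -/
lemma tendsto_inner_of_dense {H ι : Type*} [NormedAddCommGroup H] [InnerProductSpace ℝ H]
    {S : Set H} (hS : Dense S) {q : ι → H} {l : Filter ι} {z : H} {C : ℝ}
    (hb : ∀ᶠ i in l, ∀ φ ∈ S, |inner ℝ φ (q i)| ≤ C * ‖φ‖)
    (ht : ∀ φ ∈ S, Tendsto (fun i => (inner ℝ φ (q i) : ℝ)) l (𝓝 (inner ℝ φ z))) (a : H) :
    Tendsto (fun i => (inner ℝ a (q i) : ℝ)) l (𝓝 (inner ℝ a z)) := by
  have hb' : ∀ᶠ i in l, ∀ φ : H, |inner ℝ φ (q i)| ≤ C * ‖φ‖ := by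
    filter_upwards [hb] with i hi
    have hcl : IsClosed {φ : H | |inner ℝ φ (q i)| ≤ C * ‖φ‖} := by
      refine isClosed_le ?_ ?_ <;> fun_prop
    have := hcl.closure_subset_iff.2 (show S ⊆ _ from hi)
    intro φ
    exact this (hS φ)
  rw [Metric.tendsto_nhds]
  intro ε hε
  set D := |C| + ‖z‖ + 1 with hD
  have hDpos : 0 < D := by positivity
  obtain ⟨φ, hφS, hφ⟩ := hS.exists_dist_lt a (ε := ε / (2 * D)) (by positivity)
  filter_upwards [hb', Metric.tendsto_nhds.1 (ht φ hφS) (ε / 2) (by positivity)] with i h1 h2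
  rw [Real.dist_eq] at h2 ⊢
  rw [dist_eq_norm] at hφ
  have h3 := h1 (a - φ)
  have h4 := abs_real_inner_le_norm (a - φ) z
  have e : (inner ℝ a (q i) : ℝ) - inner ℝ a z
      = inner ℝ (a - φ) (q i) + (inner ℝ φ (q i) - inner ℝ φ z) - inner ℝ (a - φ) z := by
    simp only [inner_sub_left]; ring
  have h5 : ‖a - φ‖ * D < ε / 2 := by
    rw [lt_div_iff₀ (by positivity)] at hφ
    linarith
  have h6 : C * ‖a - φ‖ ≤ |C| * ‖a - φ‖ := by gcongr; exact le_abs_self C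
  rw [e]
  rw [abs_lt] at h2 ⊢
  rw [abs_le] at h3 h4
  have : ‖a - φ‖ * D = |C| * ‖a - φ‖ + ‖a - φ‖ * ‖z‖ + ‖a - φ‖ := by rw [hD]; ring
  have := norm_nonneg (a - φ)
  constructor <;> linarith [h3.1, h3.2, h4.1, h4.2, h2.1, h2.2]

/-- The quotients `(f - f(s·)) / (1 - s)` converge weakly in `L²` to `x·∇f`. Against test functions
this is the derivative at `s = 1` computed in `hasDerivAt_integral_dilation`; boundedness comes from
the mean value inequality. -/
lemma tendsto_integral_dilation_quotient {f : L2s} {g : L2v} (h : IsWeakGradient f g) {r : ℝ}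
    (hf : VanishesOutside r f) (hg : VanishesOutside r g) (a : L2s) :
    Tendsto (fun s : ℝ => (1 - s)⁻¹ * ((∫ x, a x * f x) - ∫ x, a x * f (s • x))) (𝓝[<] 1)
      (𝓝 (∫ x, a x * inner ℝ x (g x))) := by
  have hz : MemLp (fun x => inner ℝ x (g x)) 2 volume :=
    hg.memLp_inner (Lp.memLp g) continuous_id
  classical
  let fs : ℝ → L2s := fun s => if hs : 0 < s then (memLp_dilation (Lp.memLp f) hs).toLp _ else 0
  have efs : ∀ s, 0 < s → fs s =ᵐ[volume] fun x => f (s • x) := by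
    intro s hs
    simp only [fs, hs, dif_pos]
    exact MemLp.coeFn_toLp _
  let q : ℝ → L2s := fun s => (1 - s)⁻¹ • (f - fs s)
  have inner_eq : ∀ (a : L2s) (s : ℝ), 0 < s → inner ℝ a (q s)
      = (1 - s)⁻¹ * ((∫ x, a x * f x) - ∫ x, a x * f (s • x)) := by
    intro a s hs
    simp only [q]
    rw [real_inner_smul_right, inner_sub_right, L2.inner_def, L2.inner_def]
    congr 2
    · exact integral_congr_ae (Eventually.of_forall fun x => by simp [mul_comm])
    · refine integral_congr_ae ?_
      filter_upwards [efs s hs] with x hx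
      rw [hx]; simp [mul_comm]
  have hev : ∀ᶠ s : ℝ in 𝓝[<] 1, s ∈ Ioo (1/2 : ℝ) 1 := Ioo_mem_nhdsLT (by norm_num)
  have main := tendsto_inner_of_dense (Lp.dense_hasCompactSupport_contDiff (E := Plane) (F := ℝ)
    (μ := volume) (p := 2) (by simp)) (q := q) (l := 𝓝[<] (1:ℝ)) (z := hz.toLp _)
    (C := 8 * ‖hz.toLp _‖) ?_ ?_ a
  · have ez : inner ℝ a (hz.toLp _) = ∫ x, a x * inner ℝ x (g x) := by
      rw [L2.inner_def]
      refine integral_congr_ae ?_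
      filter_upwards [hz.coeFn_toLp] with x hx
      rw [hx]; simp [mul_comm]
    rw [ez] at main
    refine main.congr' ?_
    filter_upwards [hev] with s hs
    exact inner_eq a s (by linarith [hs.1])
  all_goals
    have hN : ∀ φ : Plane → ℝ, ∀ s : ℝ, 0 < s →
        ∫ x, φ x * f (s • x) = (s ^ 2)⁻¹ * ∫ x, φ (s⁻¹ • x) * f x := by
      intro φ s hs
      have := integral_dilation (fun x => φ (s⁻¹ • x) * f x) s
      simp only [smul_smul, inv_mul_cancel₀ hs.ne', one_smul, smul_eq_mul] at this
      exact this
    -- Pairing with a test function gives the difference quotient between `s` and `1` of the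
    -- function differentiated in `hasDerivAt_integral_dilation`.
    have hφN : ∀ (φ : L2s) (ψ : Plane → ℝ), φ =ᵐ[volume] ψ → ∀ s : ℝ, 0 < s → inner ℝ φ (q s)
        = (1 - s)⁻¹ * (((1:ℝ) ^ 2)⁻¹ * (∫ x, ψ ((1:ℝ)⁻¹ • x) * f x) -
          (s ^ 2)⁻¹ * ∫ x, ψ (s⁻¹ • x) * f x) := by
      intro φ ψ hφ s hs
      rw [inner_eq φ s hs, ← hN ψ s hs, ← hN ψ 1 one_pos]
      congr 2
      · exact integral_congr_ae (hφ.mono fun x hx => by simp only [hx, one_smul])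
      · exact integral_congr_ae (hφ.mono fun x hx => by simp only [hx])
  · filter_upwards [hev] with s hs φ hφ
    obtain ⟨ψ, hφψ, hψc, hψ⟩ := hφ
    have hs0 : 0 < s := by linarith [hs.1]
    rw [hφN φ ψ hφψ s hs0]
    -- In the plane `ψ(·/t)` has norm `t ‖φ‖`, which leaves the factor `t⁻² ≤ 4` for `t ≥ 1/2`; the
    -- constant `8` has room to spare.
    have hbound : ∀ t ∈ Icc s 1,
        ‖(t ^ 3)⁻¹ * ∫ x, ψ (t⁻¹ • x) * inner ℝ x (g x)‖ ≤ 8 * ‖hz.toLp _‖ * ‖φ‖ := by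
      intro t ht
      have ht0 : 0 < t := by linarith [ht.1]
      have ht2 : 1 / 2 ≤ t := by linarith [ht.1, hs.1]
      have hψt : MemLp (fun x => ψ (t⁻¹ • x)) 2 volume :=
        memLp_dilation (memLp_test hψ hψc) (by positivity)
      have e1 : ∫ x, ψ (t⁻¹ • x) * inner ℝ x (g x) = inner ℝ (hψt.toLp _) (hz.toLp _) := by
        rw [L2.inner_def]
        refine integral_congr_ae ?_
        filter_upwards [hz.coeFn_toLp, hψt.coeFn_toLp] with x hx hx2
        rw [hx, hx2]; simp [mul_comm]
      have e2 : ‖hψt.toLp _‖ = t * ‖φ‖ := by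
        refine (sq_eq_sq₀ (norm_nonneg _) (by positivity)).1 ?_
        rw [mul_pow, ← real_inner_self_eq_norm_sq, ← real_inner_self_eq_norm_sq, L2.inner_def,
          L2.inner_def]
        have e3 : ∫ x, inner ℝ (hψt.toLp _ x) (hψt.toLp _ x)
            = ∫ x, (inner ℝ (ψ (t⁻¹ • x)) (ψ (t⁻¹ • x)) : ℝ) := by
          refine integral_congr_ae ?_
          filter_upwards [hψt.coeFn_toLp] with x hx
          rw [hx]
        have e4 : ∫ x, inner ℝ (φ x) (φ x) = ∫ x, (inner ℝ (ψ x) (ψ x) : ℝ) :=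
          integral_congr_ae (hφψ.mono fun x hx => by simp only [hx])
        rw [e3, e4, integral_dilation (fun x => (inner ℝ (ψ x) (ψ x) : ℝ)) t⁻¹]
        simp
      rw [e1, norm_mul, norm_inv, norm_pow, Real.norm_eq_abs t, abs_of_pos ht0]
      have h1 := norm_inner_le_norm (𝕜 := ℝ) (hψt.toLp _) (hz.toLp _)
      rw [e2] at h1
      calc (t ^ 3)⁻¹ * ‖(inner ℝ (hψt.toLp _) (hz.toLp _) : ℝ)‖
          ≤ (t ^ 3)⁻¹ * (t * ‖φ‖ * ‖hz.toLp _‖) := by gcongr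
        _ = (t ^ 2)⁻¹ * (‖hz.toLp _‖ * ‖φ‖) := by field_simp
        _ ≤ 8 * (‖hz.toLp _‖ * ‖φ‖) := by
          gcongr
          rw [inv_le_comm₀ (by positivity) (by norm_num)]
          nlinarith
        _ = _ := by ring
    have mv := (convex_Icc s 1).norm_image_sub_le_of_norm_hasDerivWithin_le
      (fun t ht => (hasDerivAt_integral_dilation h hf hψ hψc
        (show 0 < t by linarith [ht.1])).hasDerivWithinAt) hbound
      (left_mem_Icc.2 hs.2.le) (right_mem_Icc.2 hs.2.le)
    rw [Real.norm_eq_abs, Real.norm_eq_abs, abs_of_pos (show (0:ℝ) < 1 - s by linarith [hs.2])] at mv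
    rw [abs_mul, abs_inv, abs_of_pos (show (0:ℝ) < 1 - s by linarith [hs.2]),
      inv_mul_le_iff₀ (by linarith [hs.2])]
    linarith
  · intro φ hφ
    obtain ⟨ψ, hφψ, hψc, hψ⟩ := hφ
    have hd := (hasDerivAt_integral_dilation h hf hψ hψc one_pos)
    have hsl := (hasDerivAt_iff_tendsto_slope.1 hd).mono_left
      (nhdsWithin_mono 1 (show Iio (1:ℝ) ⊆ {1}ᶜ from fun x hx => ne_of_lt hx))
    have ez : inner ℝ φ (hz.toLp _) = (((1:ℝ) ^ 3)⁻¹ * ∫ x, ψ ((1:ℝ)⁻¹ • x) * inner ℝ x (g x)) := by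
      rw [L2.inner_def]
      simp only [one_pow, inv_one, one_mul, one_smul]
      refine integral_congr_ae ?_
      filter_upwards [hz.coeFn_toLp, hφψ] with x hx hx2
      rw [hx, hx2]; simp [mul_comm]
    rw [ez]
    refine hsl.congr' ?_
    filter_upwards [hev] with s hs
    rw [hφN φ ψ hφψ s (by linarith [hs.1]), slope_def_field]
    have : 1 - s ≠ 0 := by linarith [hs.2]
    have : s - 1 ≠ 0 := by linarith [hs.2]
    field_simp
    ring

/-! ### The coefficient and the Rellich inequality. -/

/-- A Lipschitz coefficient that is bounded below, constant outside the ball of radius `r₀`, and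
whose radial derivative is at most `η` times the coefficient itself. -/
structure IsCoefficient (K : Plane → ℝ) (km k₀ r₀ η : ℝ) : Prop where
  lipschitz : ∃ C : ℝ≥0, LipschitzWith C K
  km_pos : 0 < km
  km_le : ∀ x, km ≤ K x
  r₀_pos : 0 < r₀
  eq_const : ∀ x, r₀ < ‖x‖ → K x = k₀
  eta_nonneg : 0 ≤ η
  radial_le : ∀ᵐ x, ‖x‖ ≤ r₀ → fderiv ℝ K x x ≤ η * K x

namespace IsCoefficient

variable {K : Plane → ℝ} {km k₀ r₀ η : ℝ}

lemma continuous (hK : IsCoefficient K km k₀ r₀ η) : Continuous K := by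
  obtain ⟨C, hC⟩ := hK.lipschitz
  exact hC.continuous

lemma pos (hK : IsCoefficient K km k₀ r₀ η) (x : Plane) : 0 < K x :=
  hK.km_pos.trans_le (hK.km_le x)

lemma exists_bound (hK : IsCoefficient K km k₀ r₀ η) : ∃ B, ∀ x, ‖K x‖ ≤ B := by
  obtain ⟨C, hC⟩ := exists_bound_on_ball hK.continuous r₀
  refine ⟨max C |k₀|, fun x => ?_⟩
  rcases le_or_gt ‖x‖ r₀ with h | h
  · exact (hC x h).trans (le_max_left _ _)
  · rw [hK.eq_const x h]; exact le_max_right _ _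

lemma memLp (hK : IsCoefficient K km k₀ r₀ η) : MemLp K ⊤ volume := by
  obtain ⟨B, hB⟩ := hK.exists_bound
  exact memLp_top_of_forall_le hK.continuous.aestronglyMeasurable hB

lemma integrable_mul (hK : IsCoefficient K km k₀ r₀ η) {F : Plane → ℝ} (hF : Integrable F) :
    Integrable (fun x => K x * F x) := by
  obtain ⟨B, hB⟩ := hK.exists_bound
  exact hF.bdd_mul hK.continuous.aestronglyMeasurable (Eventually.of_forall hB)

lemma k₀_pos (hK : IsCoefficient K km k₀ r₀ η) : 0 < k₀ := by
  have hn : r₀ < ‖((r₀ + 1) • unitVec 0 : Plane)‖ := by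
    rw [norm_smul]
    simp only [unitVec, PiLp.norm_single, norm_one, mul_one, Real.norm_eq_abs]
    rw [abs_of_pos (by linarith [hK.r₀_pos])]; linarith
  rw [← hK.eq_const _ hn]
  exact hK.pos _

/-- Rademacher's theorem gives the pointwise limit; the Lipschitz bound, together with `|x| ≤ r`
where `g` lives, gives the domination. -/
lemma integral_difference_quotient_tendsto (hK : IsCoefficient K km k₀ r₀ η) {g : L2v} {r : ℝ}
    (hg : VanishesOutside r g) :
    Tendsto (fun s : ℝ => ∫ x, (1 - s)⁻¹ * (K (s⁻¹ • x) - K x) * ‖g x‖ ^ 2) (𝓝[<] 1)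
      (𝓝 (∫ x, fderiv ℝ K x x * ‖g x‖ ^ 2)) := by
  obtain ⟨C, hC⟩ := hK.lipschitz
  have G : Integrable (fun x => ‖g x‖ ^ 2) :=
    (memLp_two_iff_integrable_sq_norm (Lp.memLp g).1).1 (Lp.memLp g)
  have hev : ∀ᶠ s : ℝ in 𝓝[<] 1, s ∈ Ioo (1/2 : ℝ) 1 := Ioo_mem_nhdsLT (by norm_num)
  refine tendsto_integral_filter_of_dominated_convergence (fun x => C * (2 * r) * ‖g x‖ ^ 2)
    (Eventually.of_forall fun s => ?_) ?_ (G.const_mul _) ?_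
  · refine AEStronglyMeasurable.mul (Continuous.aestronglyMeasurable ?_) G.1
    exact continuous_const.mul ((hK.continuous.comp (continuous_const_smul _)).sub hK.continuous)
  · filter_upwards [hev] with s hs
    filter_upwards [hg] with x hx
    by_cases hxr : r < ‖x‖
    · simp [hx hxr]
    · have hs0 : 0 < s := by linarith [hs.1]
      have h1s : 0 < 1 - s := by linarith [hs.2]
      rw [norm_mul, norm_mul, norm_inv, Real.norm_of_nonneg h1s.le,
        Real.norm_of_nonneg (sq_nonneg ‖g x‖)]
      refine mul_le_mul_of_nonneg_right ?_ (sq_nonneg _)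
      rw [inv_mul_le_iff₀ h1s]
      have h1 := hC.dist_le_mul (s⁻¹ • x) x
      rw [dist_eq_norm, dist_eq_norm] at h1
      have h2 : s⁻¹ • x - x = (s⁻¹ * (1 - s)) • x := by
        rw [mul_sub, inv_mul_cancel₀ hs0.ne', mul_one, sub_smul, one_smul]
      rw [h2, norm_smul, Real.norm_of_nonneg (show 0 ≤ s⁻¹ * (1 - s) by positivity)] at h1
      refine h1.trans ?_
      have h3 : s⁻¹ ≤ 2 := by
        rw [inv_le_comm₀ hs0 (by norm_num)]; linarith [hs.1]
      calc (C : ℝ) * (s⁻¹ * (1 - s) * ‖x‖) ≤ C * (2 * (1 - s) * r) := by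
            gcongr
            exact not_lt.1 hxr
        _ = _ := by ring
  · filter_upwards [hC.ae_differentiableAt (μ := volume)] with x hx
    refine Tendsto.mul_const _ ?_
    have h1 : HasDerivAt (fun t : ℝ => t⁻¹ • x) (-((1:ℝ) ^ 2)⁻¹ • x) 1 :=
      (hasDerivAt_inv one_ne_zero).smul_const x
    have hx' : HasFDerivAt K (fderiv ℝ K x) ((1:ℝ)⁻¹ • x) := by simpa using hx.hasFDerivAt
    have h2 := hx'.comp_hasDerivAt (1:ℝ) h1
    have hsl := (hasDerivAt_iff_tendsto_slope.1 h2).mono_left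
      (nhdsWithin_mono 1 (show Iio (1:ℝ) ⊆ {1}ᶜ from fun x hx => ne_of_lt hx))
    have h3 := hsl.neg
    simp only [one_pow, inv_one, neg_smul, one_smul, map_neg, neg_neg] at h3
    refine h3.congr' ?_
    filter_upwards [hev] with s hs
    rw [slope_def_field]
    have : 1 - s ≠ 0 := by linarith [hs.2]
    have : s - 1 ≠ 0 := by linarith [hs.2]
    simp only [Function.comp, inv_one, one_smul]
    field_simp
    ring

/-- The radial derivative of the coefficient is controlled by the energy near the origin. -/
lemma integral_radial_le (hK : IsCoefficient K km k₀ r₀ η) {g : L2v} {r : ℝ}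
    (hg : VanishesOutside r g) :
    ∫ x, fderiv ℝ K x x * ‖g x‖ ^ 2
      ≤ η * ∫ x in Metric.closedBall (0 : Plane) r₀, K x * ‖g x‖ ^ 2 := by
  obtain ⟨C, hC⟩ := hK.lipschitz
  have G : Integrable (fun x => ‖g x‖ ^ 2) :=
    (memLp_two_iff_integrable_sq_norm (Lp.memLp g).1).1 (Lp.memLp g)
  rw [← integral_const_mul, ← integral_indicator measurableSet_closedBall]
  refine integral_mono_ae ?_ (((hK.integrable_mul G).const_mul η).indicator
    measurableSet_closedBall) ?_
  · refine (G.const_mul (C * r)).mono' ?_ ?_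
    · refine AEStronglyMeasurable.mul ?_ G.1
      have hm : Measurable (gradient K) :=
        (InnerProductSpace.toDual ℝ Plane).symm.continuous.measurable.comp (measurable_fderiv ℝ K)
      have : Measurable (fun x => (inner ℝ (gradient K x) x : ℝ)) := hm.inner measurable_id
      simp only [inner_gradient_apply] at this
      exact this.aestronglyMeasurable
    · filter_upwards [hg] with x hx
      by_cases hxr : r < ‖x‖
      · simp [hx hxr]
      · rw [norm_mul, Real.norm_of_nonneg (sq_nonneg ‖g x‖)]
        gcongr
        refine (ContinuousLinearMap.le_opNorm _ _).trans ?_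
        gcongr
        · exact norm_fderiv_le_of_lipschitz ℝ hC
        · exact not_lt.1 hxr
  · filter_upwards [hK.radial_le] with x hx
    by_cases hxr : r₀ < ‖x‖
    · have : fderiv ℝ K x = 0 := by
        have : K =ᶠ[𝓝 x] fun _ => k₀ := by
          filter_upwards [(isOpen_lt continuous_const continuous_norm).mem_nhds hxr] with y hy
          exact hK.eq_const y hy
        rw [this.fderiv_eq]; simp
      rw [this, indicator_of_notMem (by simpa using hxr)]
      simp
    · rw [indicator_of_mem (by simpa using hxr)]
      rw [← mul_assoc]
      exact mul_le_mul_of_nonneg_right (hx (not_lt.1 hxr)) (sq_nonneg _)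

/-- Rellich-type inequality for `∇ · (K ∇f) = a`. -/
theorem rellich_le (hK : IsCoefficient K km k₀ r₀ η) {a f : L2s} {g : L2v}
    (h : IsWeakGradient f g) {r : ℝ} (hf : VanishesOutside r f)
    (hg : VanishesOutside r g)
    (hw : ∀ (φ : L2s) (G : L2v), IsWeakGradient φ G →
      inner ℝ a φ = - inner ℝ (mulOp hK.memLp g) G) :
    ∫ x, a x * inner ℝ x (g x)
      ≤ η * (1 / 2 * ∫ x in Metric.closedBall (0 : Plane) r₀, K x * ‖g x‖ ^ 2) := by
  have G : Integrable (fun x => ‖g x‖ ^ 2) :=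
    (memLp_two_iff_integrable_sq_norm (Lp.memLp g).1).1 (Lp.memLp g)
  have lim1 := tendsto_integral_dilation_quotient h hf hg a
  have lim2 := (hK.integral_difference_quotient_tendsto hg).const_mul (1 / 2 : ℝ)
  have hev : ∀ᶠ s : ℝ in 𝓝[<] 1, s ∈ Ioo (1/2 : ℝ) 1 := Ioo_mem_nhdsLT (by norm_num)
  have hle := le_of_tendsto_of_tendsto lim1 lim2 ?_
  · have := hK.integral_radial_le hg
    linarith
  filter_upwards [hev] with s hs
  have hs0 : 0 < s := by linarith [hs.1]
  have h1s : 0 < 1 - s := by linarith [hs.2]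
  -- The equation is tested with `f` and with its dilate `f(s·)`, whose gradient is `s g(s·)`.
  have mf := memLp_dilation (Lp.memLp f) hs0
  have mg : MemLp (fun x => s • g (s • x)) 2 volume := (memLp_dilation (Lp.memLp g) hs0).const_smul s
  have hp : IsWeakGradient (mf.toLp _) (mg.toLp _) := h.dilation hs0 mf.coeFn_toLp mg.coeFn_toLp
  have Gs : Integrable (fun x => ‖s • g (s • x)‖ ^ 2) :=
    (memLp_two_iff_integrable_sq_norm mg.1).1 mg
  have w1 := hw f g h
  have w2 := hw _ _ hp
  have a1 : inner ℝ a f = ∫ x, a x * f x := by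
    rw [L2.inner_def]
    exact integral_congr_ae (Eventually.of_forall fun x => by simp [mul_comm])
  have a2 : inner ℝ a (mf.toLp _) = ∫ x, a x * f (s • x) := by
    rw [L2.inner_def]
    refine integral_congr_ae ?_
    filter_upwards [mf.coeFn_toLp] with x hx
    rw [hx]; simp [mul_comm]
  have b1 : inner ℝ (mulOp hK.memLp g) g = ∫ x, K x * ‖g x‖ ^ 2 := by
    rw [L2.inner_def]
    refine integral_congr_ae ?_
    filter_upwards [coeFn_mulOp hK.memLp g] with x hx
    rw [hx, real_inner_smul_left, real_inner_self_eq_norm_sq]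
  have b2 : inner ℝ (mulOp hK.memLp g) (mg.toLp _) = ∫ x, K x * inner ℝ (g x) (s • g (s • x)) := by
    rw [L2.inner_def]
    refine integral_congr_ae ?_
    filter_upwards [coeFn_mulOp hK.memLp g, mg.coeFn_toLp] with x hx hx2
    rw [hx, hx2, real_inner_smul_left]
  rw [a1, b1] at w1
  rw [a2, b2] at w2
  have c1 := hK.integrable_mul G
  have c2 := hK.integrable_mul Gs
  have c3 := hK.integrable_mul ((Lp.memLp g).integrable_inner_two mg)
  -- Convexity of the Dirichlet form: `K |g - s g(s·)|²` is nonnegative. This replaces second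
  -- derivatives of `f`, and it is why an inequality rather than an identity results.
  have am : ∫ x, K x * inner ℝ (g x) (s • g (s • x))
      ≤ ∫ x, (1 / 2 * (K x * ‖g x‖ ^ 2) + 1 / 2 * (K x * ‖s • g (s • x)‖ ^ 2)) := by
    refine integral_mono c3 ((c1.const_mul _).add (c2.const_mul _)) fun x => ?_
    have := norm_sub_sq_real (g x) (s • g (s • x))
    have h0 := sq_nonneg ‖g x - s • g (s • x)‖
    have := hK.pos x
    simp only
    nlinarith [mul_nonneg this.le h0]
  rw [integral_add (c1.const_mul _) (c2.const_mul _), integral_const_mul, integral_const_mul] at am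
  -- The Dirichlet integral is scale invariant in dimension two: `s²` cancels the Jacobian, and the
  -- dilation ends up on `K` alone.
  have cv : ∫ x, K x * ‖s • g (s • x)‖ ^ 2 = ∫ x, K (s⁻¹ • x) * ‖g x‖ ^ 2 := by
    have := integral_dilation (fun x => K (s⁻¹ • x) * ‖g x‖ ^ 2) s
    simp only [smul_smul, inv_mul_cancel₀ hs0.ne', one_smul, smul_eq_mul] at this
    simp only [norm_smul, mul_pow, Real.norm_eq_abs, sq_abs]
    have e : ∀ x, K x * (s ^ 2 * ‖g (s • x)‖ ^ 2) = s ^ 2 * (K x * ‖g (s • x)‖ ^ 2) :=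
      fun x => by ring
    simp only [e]
    rw [integral_const_mul, this, ← mul_assoc, mul_inv_cancel₀ (by positivity), one_mul]
  obtain ⟨B, hB⟩ := hK.exists_bound
  have c4 : Integrable (fun x => K (s⁻¹ • x) * ‖g x‖ ^ 2) :=
    G.bdd_mul (hK.continuous.comp (continuous_const_smul _)).aestronglyMeasurable
      (Eventually.of_forall fun x => hB _)
  simp only [mul_assoc, sub_mul]
  rw [integral_const_mul, integral_sub c4 c1, ← cv, w1, w2]
  have : (1 - s)⁻¹ * (-∫ x, K x * ‖g x‖ ^ 2) - (1 - s)⁻¹ * (-∫ x, K x * inner ℝ (g x) (s • g (s • x)))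
    ≤ 1 / 2 * ((1 - s)⁻¹ * ((∫ x, K x * ‖s • g (s • x)‖ ^ 2) - ∫ x, K x * ‖g x‖ ^ 2)) := by
    have := mul_le_mul_of_nonneg_left am (inv_nonneg.2 h1s.le)
    linarith
  linarith

end IsCoefficient

/-! ### Weighted energies of strong solutions. -/

lemma integrable_norm_sq {E : Type*} [NormedAddCommGroup E] (f : Lp E 2 (volume : Measure Plane)) :
    Integrable (fun x => ‖f x‖ ^ 2) :=
  (memLp_two_iff_integrable_sq_norm (Lp.memLp f).1).1 (Lp.memLp f)

lemma HasDerivAt.continuousLinearMap_apply {E F : Type*} [NormedAddCommGroup E] [NormedSpace ℝ E]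
    [NormedAddCommGroup F] [NormedSpace ℝ F] (A : E →L[ℝ] F) {f : ℝ → E} {f' : E} {t : ℝ}
    (h : HasDerivAt f f' t) : HasDerivAt (fun s => A (f s)) (A f') t :=
  A.hasFDerivAt.comp_hasDerivAt t h

section OperatorAlgebra

variable {E : Type*} [NormedAddCommGroup E] [InnerProductSpace ℝ E]

lemma inner_mulOp_left {ψ : Plane → ℝ} (hψ : MemLp ψ ⊤ volume)
    (f g : Lp E 2 (volume : Measure Plane)) :
    (inner ℝ (mulOp hψ f) g : ℝ) = ∫ x, ψ x * inner ℝ (f x) (g x) := by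
  rw [L2.inner_def]
  refine integral_congr_ae ?_
  filter_upwards [coeFn_mulOp hψ f] with x hx
  rw [hx, real_inner_smul_left]

lemma inner_mulOp_right {ψ : Plane → ℝ} (hψ : MemLp ψ ⊤ volume)
    (f g : Lp E 2 (volume : Measure Plane)) :
    (inner ℝ f (mulOp hψ g) : ℝ) = ∫ x, ψ x * inner ℝ (f x) (g x) := by
  rw [real_inner_comm, inner_mulOp_left]
  exact integral_congr_ae (Eventually.of_forall fun x => by simp only [real_inner_comm])

lemma inner_mulOp_mulOp {ψ χ : Plane → ℝ} (hψ : MemLp ψ ⊤ volume) (hχ : MemLp χ ⊤ volume)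
    (f g : Lp E 2 (volume : Measure Plane)) :
    (inner ℝ (mulOp hψ f) (mulOp hχ g) : ℝ) = ∫ x, ψ x * (χ x * inner ℝ (f x) (g x)) := by
  rw [inner_mulOp_left]
  refine integral_congr_ae ?_
  filter_upwards [coeFn_mulOp hχ g] with x hx
  rw [hx, real_inner_smul_right]

lemma inner_mulOp_comm {ψ : Plane → ℝ} (hψ : MemLp ψ ⊤ volume)
    (f g : Lp E 2 (volume : Measure Plane)) :
    (inner ℝ (mulOp hψ f) g : ℝ) = inner ℝ f (mulOp hψ g) := by
  rw [inner_mulOp_left, inner_mulOp_right]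

lemma integrable_memLp_top_mul {ψ : Plane → ℝ} (hψ : MemLp ψ ⊤ volume) {F : Plane → ℝ}
    (hF : Integrable F) : Integrable (fun x => ψ x * F x) := by
  have : MemLp (ψ • F) 1 volume := (memLp_one_iff_integrable.2 hF).smul hψ
  exact memLp_one_iff_integrable.1 this

end OperatorAlgebra

/-- A solution of `w_tt = ∇ · (K ∇w)` whose velocity lies in `H¹`, with `W = ∇w`. -/
structure IsStrongSolution {K : Plane → ℝ} (hK : MemLp K ⊤ volume)
    (w w' w'' : ℝ → L2s) (W W' : ℝ → L2v) : Prop where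
  pair : ∀ t, 0 ≤ t → IsWeakGradient (w t) (W t)
  pair_deriv : ∀ t, 0 ≤ t → IsWeakGradient (w' t) (W' t)
  hasDerivAt : ∀ t, 0 ≤ t → HasDerivAt w (w' t) t
  hasDerivAt_deriv : ∀ t, 0 ≤ t → HasDerivAt w' (w'' t) t
  hasDerivAt_grad : ∀ t, 0 ≤ t → HasDerivAt W (W' t) t
  equation : ∀ t, 0 ≤ t → ∀ (φ : L2s) (G : L2v), IsWeakGradient φ G →
    inner ℝ (w'' t) φ = - inner ℝ (mulOp hK (W t)) G

/-- The energy `½ ∫ ψ (|f|² + K |g|²)` weighted by `ψ`. -/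
noncomputable def weightedEnergy {K ψ : Plane → ℝ} (hK : MemLp K ⊤ volume)
    (hψ : MemLp ψ ⊤ volume) (f : L2s) (g : L2v) : ℝ :=
  1 / 2 * (inner ℝ (mulOp hψ f) f + inner ℝ (mulOp hψ g) (mulOp hK g))

lemma weightedEnergy_eq {K ψ : Plane → ℝ} (hK : MemLp K ⊤ volume)
    (hψ : MemLp ψ ⊤ volume) (f : L2s) (g : L2v) :
    weightedEnergy hK hψ f g = 1 / 2 * ∫ x, ψ x * (|f x| ^ 2 + K x * ‖g x‖ ^ 2) := by
  unfold weightedEnergy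
  rw [inner_mulOp_left, inner_mulOp_mulOp, ← integral_add]
  · congr 1
    refine integral_congr_ae (Eventually.of_forall fun x => ?_)
    simp only [real_inner_self_eq_norm_sq, Real.norm_eq_abs, mul_add]
  · exact integrable_memLp_top_mul hψ (L2.integrable_inner f f)
  · exact integrable_memLp_top_mul hψ (integrable_memLp_top_mul hK (L2.integrable_inner g g))

lemma integrable_weightedEnergy {K ψ : Plane → ℝ} (hK : MemLp K ⊤ volume)
    (hψ : MemLp ψ ⊤ volume) (f : L2s) (g : L2v) :
    Integrable (fun x => ψ x * (|f x| ^ 2 + K x * ‖g x‖ ^ 2)) :=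
  integrable_memLp_top_mul hψ ((integrable_norm_sq f).add
    (integrable_memLp_top_mul hK (integrable_norm_sq g)))

namespace IsStrongSolution

variable {K : Plane → ℝ} {hK : MemLp K ⊤ volume} {w w' w'' : ℝ → L2s} {W W' : ℝ → L2v}

/-- The equation is tested with `ψ w'`. Of the gradient `ψ W' + w' ∇ψ`, the first part cancels the
derivative of the elastic energy and the second is the flux that remains. -/
lemma hasDerivAt_weightedEnergy (h : IsStrongSolution hK w w' w'' W W') {ψ : Plane → ℝ}
    (hψ : MemLp ψ ⊤ volume) (hψs : ContDiff ℝ ∞ ψ) (hψg : MemLp (gradient ψ) ⊤ volume)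
    {t : ℝ} (ht : 0 ≤ t) :
    HasDerivAt (fun t => weightedEnergy hK hψ (w' t) (W t))
      (- inner ℝ (mulOp hK (W t)) (smulOp hψg (w' t))) t := by
  have d1 := ((h.hasDerivAt_deriv t ht).continuousLinearMap_apply (mulOp hψ)).inner ℝ
    (h.hasDerivAt_deriv t ht)
  have d2 := ((h.hasDerivAt_grad t ht).continuousLinearMap_apply (mulOp hψ)).inner ℝ
    ((h.hasDerivAt_grad t ht).continuousLinearMap_apply (mulOp hK))
  refine ((d1.add d2).const_mul (1 / 2 : ℝ)).congr_deriv ?_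
  have hp : IsWeakGradient (mulOp hψ (w' t)) (mulOp hψ (W' t) + smulOp hψg (w' t)) := by
    refine (h.pair_deriv t ht).mul hψs (coeFn_mulOp hψ _) ?_
    filter_upwards [Lp.coeFn_add (mulOp hψ (W' t)) (smulOp hψg (w' t)), coeFn_mulOp hψ (W' t),
      coeFn_smulOp hψg (w' t)] with x h1 h2 h3
    rw [h1, Pi.add_apply, h2, h3]
  have e := h.equation t ht _ _ hp
  rw [inner_add_right] at e
  have e1 : (inner ℝ (mulOp hψ (w' t)) (w'' t) : ℝ) = inner ℝ (w'' t) (mulOp hψ (w' t)) :=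
    real_inner_comm _ _
  have e2 : (inner ℝ (mulOp hψ (w'' t)) (w' t) : ℝ) = inner ℝ (w'' t) (mulOp hψ (w' t)) :=
    inner_mulOp_comm _ _ _
  have e3 : (inner ℝ (mulOp hψ (W' t)) (mulOp hK (W t)) : ℝ)
      = inner ℝ (mulOp hK (W t)) (mulOp hψ (W' t)) := real_inner_comm _ _
  have e4 : (inner ℝ (mulOp hψ (W t)) (mulOp hK (W' t)) : ℝ)
      = inner ℝ (mulOp hK (W t)) (mulOp hψ (W' t)) := by
    rw [inner_mulOp_mulOp, inner_mulOp_mulOp]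
    exact integral_congr_ae (Eventually.of_forall fun x => by simp only; ring)
  rw [e1, e2, e3, e4]
  linarith

end IsStrongSolution

lemma memLp_top_one : MemLp (fun _ : Plane => (1:ℝ)) ⊤ volume :=
  memLp_top_of_forall_le aestronglyMeasurable_const (fun _ => le_of_eq norm_one)

namespace IsStrongSolution

variable {K : Plane → ℝ} {hK : MemLp K ⊤ volume} {w w' w'' : ℝ → L2s} {W W' : ℝ → L2v}

lemma hasDerivAt_energy (h : IsStrongSolution hK w w' w'' W W') {t : ℝ} (ht : 0 ≤ t) :
    HasDerivAt (fun t => weightedEnergy hK memLp_top_one (w' t) (W t)) 0 t := by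
  have hg : MemLp (gradient fun _ : Plane => (1:ℝ)) ⊤ volume := by
    have : (gradient fun _ : Plane => (1:ℝ)) = fun _ => 0 := by
      funext x; exact gradient_fun_const x 1
    rw [this]; exact MemLp.zero'
  refine (h.hasDerivAt_weightedEnergy memLp_top_one contDiff_const hg ht).congr_deriv ?_
  have : smulOp hg (w' t) = 0 := by
    refine Lp.ext ?_
    filter_upwards [coeFn_smulOp hg (w' t), Lp.coeFn_zero Plane 2 volume] with x h1 h2
    rw [h1, h2, gradient_fun_const]; simp
  rw [this, inner_zero_right, neg_zero]

lemma energy_eq (h : IsStrongSolution hK w w' w'' W W') {t : ℝ} (ht : 0 ≤ t) :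
    weightedEnergy hK memLp_top_one (w' t) (W t)
      = weightedEnergy hK memLp_top_one (w' 0) (W 0) := by
  have := (convex_Icc 0 t).norm_image_sub_le_of_norm_hasDerivWithin_le (C := 0)
    (fun s hs => (h.hasDerivAt_energy hs.1).hasDerivWithinAt) (fun s _ => by simp)
    (left_mem_Icc.2 ht) (right_mem_Icc.2 ht)
  rw [zero_mul] at this
  exact sub_eq_zero.1 (norm_le_zero_iff.1 this)

end IsStrongSolution

/-- A function with nonpositive derivative on `[0, ∞)` does not exceed its initial value. -/
lemma le_of_hasDerivAt_nonpos {F F' : ℝ → ℝ} {T : ℝ} (hF : ∀ t ∈ Icc 0 T, HasDerivAt F (F' t) t)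
    (h : ∀ t ∈ Icc 0 T, F' t ≤ 0) (hT : 0 ≤ T) : F T ≤ F 0 := by
  refine (antitoneOn_of_deriv_nonpos (convex_Icc 0 T)
    (fun t ht => (hF t ht).continuousAt.continuousWithinAt) (fun t ht => ?_) (fun t ht => ?_))
    (left_mem_Icc.2 hT) (right_mem_Icc.2 hT) hT
  · exact (hF t (interior_subset ht)).differentiableAt.differentiableWithinAt
  · rw [(hF t (interior_subset ht)).deriv]
    exact h t (interior_subset ht)

namespace IsStrongSolution

variable {K : Plane → ℝ} {km k₀ r₀ η : ℝ}
  {w w' w'' : ℝ → L2s} {W W' : ℝ → L2v}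

/-- Exponential growth of weighted energies, with the exterior wave speed `√k₀`. -/
lemma weightedEnergy_le (hc : IsCoefficient K km k₀ r₀ η)
    (h : IsStrongSolution hc.memLp w w' w'' W W') {ψ : Plane → ℝ}
    (hψ : MemLp ψ ⊤ volume) (hψs : ContDiff ℝ ∞ ψ) (hψg : MemLp (gradient ψ) ⊤ volume)
    {l : ℝ} (hl : 0 ≤ l) (hψ0 : ∀ x, 0 ≤ ψ x) (hle : ∀ x, ‖gradient ψ x‖ ≤ l * ψ x)
    (hin : ∀ x, ‖x‖ ≤ r₀ → gradient ψ x = 0) {t : ℝ} (ht : 0 ≤ t) :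
    weightedEnergy hc.memLp hψ (w' t) (W t)
      ≤ Real.exp (√k₀ * l * t) * weightedEnergy hc.memLp hψ (w' 0) (W 0) := by
  have hd := fun t ht => h.hasDerivAt_weightedEnergy hψ hψs hψg (t := t) ht
  -- Where `∇ψ` does not vanish, `K = k₀`; so the flux `k₀ |w'| |W| |∇ψ|` is at most `√k₀ l` times
  -- the weighted energy density.
  have hbound : ∀ t, 0 ≤ t → - inner ℝ (mulOp hc.memLp (W t)) (smulOp hψg (w' t))
      ≤ √k₀ * l * weightedEnergy hc.memLp hψ (w' t) (W t) := by
    intro t _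
    rw [weightedEnergy_eq, inner_mulOp_left, ← integral_neg, ← integral_const_mul,
      ← integral_const_mul]
    refine integral_mono_ae
      (integrable_memLp_top_mul hc.memLp (L2.integrable_inner _ _)).neg
      (((integrable_weightedEnergy hc.memLp hψ (w' t) (W t)).const_mul _).const_mul _) ?_
    filter_upwards [coeFn_smulOp hψg (w' t)] with x hx
    rw [hx, real_inner_smul_right]
    have hKx := hc.pos x
    by_cases hxr : ‖x‖ ≤ r₀
    · rw [hin x hxr]
      simp only [inner_zero_right, mul_zero, neg_zero]
      have := hψ0 x
      positivity
    · rw [hc.eq_const x (not_le.1 hxr)]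
      have hk : √k₀ ^ 2 = k₀ := Real.sq_sqrt hc.k₀_pos.le
      have h1 := abs_real_inner_le_norm (W t x) (gradient ψ x)
      have h2 : |(inner ℝ (W t x) (gradient ψ x) : ℝ)| ≤ ‖W t x‖ * (l * ψ x) :=
        h1.trans (by gcongr; exact hle x)
      have h3 : -(k₀ * (w' t x * inner ℝ (W t x) (gradient ψ x)))
          ≤ k₀ * (|w' t x| * (‖W t x‖ * (l * ψ x))) := by
        refine (neg_le_abs _).trans ?_
        rw [abs_mul, abs_mul, abs_of_pos hc.k₀_pos]
        have := hc.k₀_pos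
        gcongr
      refine h3.trans ?_
      have h4 : √k₀ * (|w' t x| * ‖W t x‖) ≤ 1 / 2 * (|w' t x| ^ 2 + k₀ * ‖W t x‖ ^ 2) := by
        nlinarith [sq_nonneg (|w' t x| - √k₀ * ‖W t x‖)]
      have h5 := mul_le_mul_of_nonneg_left h4
        (mul_nonneg (mul_nonneg (Real.sqrt_nonneg k₀) hl) (hψ0 x))
      calc k₀ * (|w' t x| * (‖W t x‖ * (l * ψ x)))
          = √k₀ ^ 2 * (|w' t x| * (‖W t x‖ * (l * ψ x))) := by rw [hk]
        _ = √k₀ * l * ψ x * (√k₀ * (|w' t x| * ‖W t x‖)) := by ring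
        _ ≤ _ := h5
        _ = _ := by ring
  have key := le_of_hasDerivAt_nonpos (T := t)
    (F := fun t => Real.exp (-(√k₀ * l * t)) * weightedEnergy hc.memLp hψ (w' t) (W t))
    (F' := fun t => Real.exp (-(√k₀ * l * t)) *
      (- inner ℝ (mulOp hc.memLp (W t)) (smulOp hψg (w' t))
        - √k₀ * l * weightedEnergy hc.memLp hψ (w' t) (W t))) ?_ ?_ ht
  · simp only [mul_zero, neg_zero, Real.exp_zero, one_mul] at key
    rw [Real.exp_neg, inv_mul_le_iff₀ (Real.exp_pos _)] at key
    exact key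
  · intro s hs
    have he : HasDerivAt (fun t => Real.exp (-(√k₀ * l * t)))
        (Real.exp (-(√k₀ * l * s)) * -(√k₀ * l)) s := by
      have := ((hasDerivAt_id s).const_mul (√k₀ * l)).neg.exp
      simpa using this
    exact (he.mul (hd s hs.1)).congr_deriv (by ring)
  · intro s hs
    have := hbound s hs.1
    exact mul_nonpos_of_nonneg_of_nonpos (Real.exp_pos _).le (by linarith)

end IsStrongSolution

/-! ### Time averages and finite energy solutions. -/

section WeakGradientClosed

lemma memLp_inner_gradient_test {φ : Plane → ℝ} (hφ : ContDiff ℝ ∞ φ) (hφc : HasCompactSupport φ)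
    (e : Plane) : MemLp (fun x => (inner ℝ (gradient φ x) e : ℝ)) 2 volume :=
  (memLp_gradient_test hφ hφc).inner_const e

lemma memLp_test_smul {φ : Plane → ℝ} (hφ : ContDiff ℝ ∞ φ) (hφc : HasCompactSupport φ)
    (e : Plane) : MemLp (fun x => φ x • e) 2 volume :=
  (hφ.continuous.smul continuous_const).memLp_of_hasCompactSupport hφc.smul_right

/-- Weak gradient pairs are the common kernel of continuous linear functionals on the product of the
two `L²` spaces. Hence they are stable under linear combinations and integration in time. -/
lemma isWeakGradient_iff_inner {f : L2s} {g : L2v} :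
    IsWeakGradient f g ↔ ∀ (φ : Plane → ℝ) (hφ : ContDiff ℝ ∞ φ) (hφc : HasCompactSupport φ)
      (e : Plane), (inner ℝ ((memLp_inner_gradient_test hφ hφc e).toLp _) f : ℝ)
        + inner ℝ ((memLp_test_smul hφ hφc e).toLp _) g = 0 := by
  have key : ∀ (φ : Plane → ℝ) (hφ : ContDiff ℝ ∞ φ) (hφc : HasCompactSupport φ) (e : Plane),
      (inner ℝ ((memLp_inner_gradient_test hφ hφc e).toLp _) f : ℝ)
        + inner ℝ ((memLp_test_smul hφ hφc e).toLp _) g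
      = inner ℝ e ((∫ x, f x • gradient φ x) + ∫ x, φ x • g x) := by
    intro φ hφ hφc e
    rw [inner_add_right,
      ← integral_inner ((Lp.memLp f).integrable_smul_two (memLp_gradient_test hφ hφc)),
      ← integral_inner ((memLp_test hφ hφc).integrable_smul_two (Lp.memLp g)),
      L2.inner_def, L2.inner_def]
    congr 1
    · refine integral_congr_ae ?_
      filter_upwards [(memLp_inner_gradient_test hφ hφc e).coeFn_toLp] with x hx
      rw [hx, real_inner_smul_right, real_inner_comm e]
      simp
    · refine integral_congr_ae ?_
      filter_upwards [(memLp_test_smul hφ hφc e).coeFn_toLp] with x hx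
      rw [hx, real_inner_smul_right, real_inner_smul_left]
  constructor
  · intro h φ hφ hφc e
    rw [key φ hφ hφc, h φ hφ hφc, neg_add_cancel, inner_zero_right]
  · intro h φ hφ hφc
    rw [eq_neg_iff_add_eq_zero]
    refine ext_inner_left ℝ fun e => ?_
    rw [← key φ hφ hφc e, h φ hφ hφc e, inner_zero_right]

lemma IsWeakGradient.sub {f₁ f₂ : L2s} {g₁ g₂ : L2v} (h₁ : IsWeakGradient f₁ g₁)
    (h₂ : IsWeakGradient f₂ g₂) : IsWeakGradient (f₁ - f₂) (g₁ - g₂) := by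
  rw [isWeakGradient_iff_inner] at *
  intro φ hφ hφc e
  rw [inner_sub_right, inner_sub_right]
  linarith [h₁ φ hφ hφc e, h₂ φ hφ hφc e]

lemma IsWeakGradient.const_smul {f : L2s} {g : L2v} (h : IsWeakGradient f g) (c : ℝ) :
    IsWeakGradient (c • f) (c • g) := by
  rw [isWeakGradient_iff_inner] at *
  intro φ hφ hφc e
  rw [real_inner_smul_right, real_inner_smul_right, ← mul_add, h φ hφ hφc e, mul_zero]

lemma intervalIntegral_inner_left {H : Type*} [NormedAddCommGroup H] [InnerProductSpace ℝ H]
    [CompleteSpace H] {f : ℝ → H} (hf : Continuous f) (c : H) (a b : ℝ) :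
    (inner ℝ c (∫ t in a..b, f t) : ℝ) = ∫ t in a..b, inner ℝ c (f t) :=
  ((innerSL ℝ c).intervalIntegral_comp_comm (hf.intervalIntegrable a b)).symm

lemma IsWeakGradient.intervalIntegral {f : ℝ → L2s} {g : ℝ → L2v} (hf : Continuous f)
    (hg : Continuous g) {a b : ℝ} (h : ∀ t ∈ uIcc a b, IsWeakGradient (f t) (g t)) :
    IsWeakGradient (∫ t in a..b, f t) (∫ t in a..b, g t) := by
  rw [isWeakGradient_iff_inner]
  intro φ hφ hφc e
  rw [intervalIntegral_inner_left hf, intervalIntegral_inner_left hg,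
    ← intervalIntegral.integral_add]
  · rw [intervalIntegral.integral_congr (g := fun _ => (0:ℝ)), intervalIntegral.integral_zero]
    intro t ht
    exact isWeakGradient_iff_inner.1 (h t ht) φ hφ hφc e
  · exact (continuous_const.inner hf).intervalIntegrable _ _
  · exact (continuous_const.inner hg).intervalIntegrable _ _

end WeakGradientClosed

section Steklov

variable {E : Type*} [NormedAddCommGroup E] [NormedSpace ℝ E]

/-- The forward difference quotient of step `ε`. -/
noncomputable def steklov (ε : ℝ) (F : ℝ → E) (t : ℝ) : E := ε⁻¹ • (F (t + ε) - F t)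

lemma hasDerivAt_steklov {F F' : ℝ → E} (h : ∀ t, HasDerivAt F (F' t) t) (ε t : ℝ) :
    HasDerivAt (steklov ε F) (steklov ε F' t) t :=
  (((h (t + ε)).comp_add_const t ε).sub (h t)).const_smul ε⁻¹

lemma tendsto_steklov {F : ℝ → E} {F' : E} {t : ℝ} (h : HasDerivAt F F' t) :
    Tendsto (fun ε => steklov ε F t) (𝓝[>] 0) (𝓝 F') :=
  (hasDerivAt_iff_tendsto_slope_zero.1 h).mono_left
    (nhdsWithin_mono 0 (fun _ hx => ne_of_gt hx))

lemma hasDerivAt_primitive [CompleteSpace E] {f : ℝ → E} (hf : Continuous f) (t : ℝ) :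
    HasDerivAt (fun t => ∫ s in (0:ℝ)..t, f s) (f t) t :=
  intervalIntegral.integral_hasDerivAt_right (hf.intervalIntegrable _ _)
    hf.aestronglyMeasurable.stronglyMeasurableAtFilter hf.continuousAt

lemma steklov_primitive [CompleteSpace E] {f : ℝ → E} (hf : Continuous f) (ε t : ℝ) :
    steklov ε (fun t => ∫ s in (0:ℝ)..t, f s) t = ε⁻¹ • ∫ s in t..t + ε, f s := by
  unfold steklov
  rw [intervalIntegral.integral_interval_sub_left (hf.intervalIntegrable _ _)
    (hf.intervalIntegrable _ _)]

end Steklov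

/-- Finite energy solutions of `U_tt = ∇ · (K ∇U)`, extended to negative times, with the equation
integrated in time and tested against `H¹`. -/
structure IsMildSolution {K : Plane → ℝ} (hK : MemLp K ⊤ volume)
    (U a : ℝ → L2s) (D : ℝ → L2v) : Prop where
  continuous_vel : Continuous a
  continuous_grad : Continuous D
  hasDerivAt : ∀ t, HasDerivAt U (a t) t
  pair : ∀ t, 0 ≤ t → IsWeakGradient (U t) (D t)
  equation : ∀ t, 0 ≤ t → ∀ (φ : L2s) (G : L2v), IsWeakGradient φ G →
    inner ℝ (a t - a 0) φ = - inner ℝ (mulOp hK (∫ s in (0:ℝ)..t, D s)) G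

lemma Filter.Tendsto.weightedEnergy {ι : Type*} {l : Filter ι} {f : ι → L2s} {g : ι → L2v}
    {f₀ : L2s} {g₀ : L2v} (hf : Tendsto f l (𝓝 f₀)) {K ψ : Plane → ℝ} (hK : MemLp K ⊤ volume)
    (hψ : MemLp ψ ⊤ volume) (hg : Tendsto g l (𝓝 g₀)) :
    Tendsto (fun i => _root_.weightedEnergy hK hψ (f i) (g i)) l
      (𝓝 (_root_.weightedEnergy hK hψ f₀ g₀)) := by
  have h1 : Tendsto (fun i => mulOp hψ (f i)) l (𝓝 (mulOp hψ f₀)) :=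
    ((mulOp hψ).continuous.tendsto f₀).comp hf
  have h2 : Tendsto (fun i => mulOp hψ (g i)) l (𝓝 (mulOp hψ g₀)) :=
    ((mulOp hψ).continuous.tendsto g₀).comp hg
  have h3 : Tendsto (fun i => mulOp hK (g i)) l (𝓝 (mulOp hK g₀)) :=
    ((mulOp hK).continuous.tendsto g₀).comp hg
  exact ((h1.inner hf).add (h2.inner h3)).const_mul (1 / 2)

namespace IsMildSolution

variable {K : Plane → ℝ} {hK : MemLp K ⊤ volume} {U a : ℝ → L2s} {D : ℝ → L2v}

lemma continuous (h : IsMildSolution hK U a D) : Continuous U :=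
  continuous_iff_continuousAt.2 fun t => (h.hasDerivAt t).continuousAt

lemma pair_primitive (h : IsMildSolution hK U a D) {s t : ℝ} (hs : 0 ≤ s) (ht : 0 ≤ t) :
    IsWeakGradient (∫ τ in s..t, U τ) (∫ τ in s..t, D τ) :=
  IsWeakGradient.intervalIntegral h.continuous h.continuous_grad fun τ hτ => h.pair τ
    ((le_min hs ht).trans hτ.1)

/-- Steklov averages of finite energy solutions are strong solutions. -/
lemma isStrongSolution_steklov (h : IsMildSolution hK U a D) {ε : ℝ} (hε : 0 < ε) :
    IsStrongSolution hK (steklov ε fun t => ∫ s in (0:ℝ)..t, U s) (steklov ε U) (steklov ε a)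
      (steklov ε fun t => ∫ s in (0:ℝ)..t, D s) (steklov ε D) where
  pair t ht := by
    rw [steklov_primitive h.continuous, steklov_primitive h.continuous_grad]
    exact (h.pair_primitive ht (by linarith)).const_smul _
  pair_deriv t ht := ((h.pair _ (by linarith)).sub (h.pair t ht)).const_smul _
  hasDerivAt t _ := hasDerivAt_steklov (hasDerivAt_primitive h.continuous) ε t
  hasDerivAt_deriv t _ := hasDerivAt_steklov h.hasDerivAt ε t
  hasDerivAt_grad t _ := hasDerivAt_steklov (hasDerivAt_primitive h.continuous_grad) ε t
  -- The integrated equation at `t + ε` minus that at `t`; the coefficient, being independent of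
  -- time, commutes with the difference quotient.
  equation t ht φ G hp := by
    have e1 := h.equation (t + ε) (by linarith) φ G hp
    have e2 := h.equation t ht φ G hp
    unfold steklov
    rw [map_smul, real_inner_smul_left, real_inner_smul_left, map_sub, inner_sub_left,
      inner_sub_left]
    rw [inner_sub_left] at e1 e2
    rw [← mul_neg]
    congr 1
    linarith

lemma tendsto_steklov_grad (h : IsMildSolution hK U a D) (t : ℝ) :
    Tendsto (fun ε => steklov ε (fun t => ∫ s in (0:ℝ)..t, D s) t) (𝓝[>] 0) (𝓝 (D t)) :=
  tendsto_steklov (hasDerivAt_primitive h.continuous_grad t)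

lemma tendsto_weightedEnergy (h : IsMildSolution hK U a D) {ψ : Plane → ℝ}
    (hψ : MemLp ψ ⊤ volume) (t : ℝ) :
    Tendsto (fun ε => weightedEnergy hK hψ (steklov ε U t)
      (steklov ε (fun t => ∫ s in (0:ℝ)..t, D s) t)) (𝓝[>] 0)
      (𝓝 (weightedEnergy hK hψ (a t) (D t))) :=
  (tendsto_steklov (h.hasDerivAt t)).weightedEnergy hK hψ (h.tendsto_steklov_grad t)

lemma energy_eq (h : IsMildSolution hK U a D) {t : ℝ} (ht : 0 ≤ t) :
    weightedEnergy hK memLp_top_one (a t) (D t) = weightedEnergy hK memLp_top_one (a 0) (D 0) := by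
  refine tendsto_nhds_unique (h.tendsto_weightedEnergy memLp_top_one t) ?_
  refine (h.tendsto_weightedEnergy memLp_top_one 0).congr' ?_
  filter_upwards [self_mem_nhdsWithin] with ε hε
  exact ((h.isStrongSolution_steklov hε).energy_eq ht).symm

lemma weightedEnergy_le {km k₀ r₀ η : ℝ} (hc : IsCoefficient K km k₀ r₀ η)
    (h : IsMildSolution hc.memLp U a D) {ψ : Plane → ℝ}
    (hψ : MemLp ψ ⊤ volume) (hψs : ContDiff ℝ ∞ ψ) (hψg : MemLp (gradient ψ) ⊤ volume)
    {l : ℝ} (hl : 0 ≤ l) (hψ0 : ∀ x, 0 ≤ ψ x) (hle : ∀ x, ‖gradient ψ x‖ ≤ l * ψ x)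
    (hin : ∀ x, ‖x‖ ≤ r₀ → gradient ψ x = 0) {t : ℝ} (ht : 0 ≤ t) :
    weightedEnergy hc.memLp hψ (a t) (D t)
      ≤ Real.exp (√k₀ * l * t) * weightedEnergy hc.memLp hψ (a 0) (D 0) := by
  refine le_of_tendsto_of_tendsto (h.tendsto_weightedEnergy hψ t)
    ((h.tendsto_weightedEnergy hψ 0).const_mul _) ?_
  filter_upwards [self_mem_nhdsWithin] with ε hε
  exact (h.isStrongSolution_steklov hε).weightedEnergy_le hc hψ hψs hψg hl hψ0 hle hin ht

end IsMildSolution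

/-- Every weak solution extends to a finite energy solution in the integrated sense. -/
lemma IsWaveSolution.exists_isMildSolution {K u₀ u₁ : Plane → ℝ} (hK : MemLp K ⊤ volume)
    {u ut : ℝ → L2s} {Du : ℝ → L2v} (h : IsWaveSolution K u₀ u₁ u ut Du) :
    ∃ (U a : ℝ → L2s) (D : ℝ → L2v), IsMildSolution hK U a D ∧
      ∀ t, 0 ≤ t → U t = u t ∧ a t = ut t ∧ D t = Du t := by
  -- Freezing velocity and gradient for `t < 0` makes the solution differentiable on both sides of
  -- zero; the equation is claimed only for `t ≥ 0`.
  let a : ℝ → L2s := fun t => ut (max t 0)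
  let D : ℝ → L2v := fun t => Du (max t 0)
  have ha : Continuous a := h.continuousOn_deriv.comp_continuous
    (continuous_id.max continuous_const) (fun t => mem_Ici.2 (le_max_right t 0))
  have hD : Continuous D := h.continuousOn_grad.comp_continuous
    (continuous_id.max continuous_const) (fun t => mem_Ici.2 (le_max_right t 0))
  have ea : ∀ t, 0 ≤ t → a t = ut t := fun t ht => by simp only [a, max_eq_left ht]
  have eD : ∀ t, 0 ≤ t → D t = Du t := fun t ht => by simp only [D, max_eq_left ht]
  have hu : ∀ t, 0 ≤ t → u 0 + ∫ s in (0:ℝ)..t, a s = u t := by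
    intro t ht
    rw [intervalIntegral.integral_eq_sub_of_hasDerivAt_of_le ht (f := u) (f' := a)]
    · abel
    · exact fun s hs => ((h.hasDerivWithinAt s hs.1).continuousWithinAt).mono Icc_subset_Ici_self
    · intro s hs
      rw [ea s hs.1.le]
      exact (h.hasDerivWithinAt s hs.1.le).hasDerivAt (Ici_mem_nhds hs.1)
    · exact ha.intervalIntegrable _ _
  refine ⟨fun t => u 0 + ∫ s in (0:ℝ)..t, a s, a, D, ⟨ha, hD, ?_, ?_, ?_⟩, ?_⟩
  · exact fun t => (hasDerivAt_primitive ha t).const_add _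
  · intro t ht
    rw [hu t ht, eD t ht]
    exact h.isWeakGradient t ht
  · intro t ht φ G hp
    rw [eq_neg_iff_add_eq_zero]
    refine inner_weakForm_eq_zero ?_ hp
    intro φ hφ hφc
    have mφ := memLp_test hφ hφc
    have mg := memLp_gradient_test hφ hφc
    have c1 : Continuous fun s => (inner ℝ (mφ.toLp φ) (a s) : ℝ) := continuous_const.inner ha
    have c2 : Continuous fun s => (inner ℝ (mg.toLp _) (mulOp hK (D s)) : ℝ) :=
      continuous_const.inner ((mulOp hK).continuous.comp hD)
    have e1 : ∀ f : L2s, (inner ℝ (mφ.toLp φ) f : ℝ) = ∫ x, f x * φ x := by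
      intro f
      rw [L2.inner_def]
      refine integral_congr_ae ?_
      filter_upwards [mφ.coeFn_toLp] with x hx
      rw [hx]; simp
    have e2 : ∀ g : L2v, (inner ℝ (mg.toLp _) (mulOp hK g) : ℝ)
        = ∫ x, inner ℝ (mulOp hK g x) (gradient φ x) := by
      intro g
      rw [L2.inner_def]
      refine integral_congr_ae ?_
      filter_upwards [mg.coeFn_toLp] with x hx
      rw [hx, real_inner_comm]
    have e3 : ∀ g : L2v, (inner ℝ (mg.toLp _) (mulOp hK g) : ℝ)
        = ∫ x, K x * inner ℝ (g x) (gradient φ x) := by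
      intro g
      rw [e2]
      refine integral_congr_ae ?_
      filter_upwards [coeFn_mulOp hK g] with x hx
      rw [hx, real_inner_smul_left]
    -- The equation is available only for positive times, so the fundamental theorem is used in the
    -- form that needs mere continuity at the endpoints.
    have ftc := intervalIntegral.integral_eq_sub_of_hasDerivAt_of_le ht
      (f := fun s => (inner ℝ (mφ.toLp φ) (a s) : ℝ))
      (f' := fun s => - (inner ℝ (mg.toLp _) (mulOp hK (D s)) : ℝ)) c1.continuousOn ?_
      (c2.neg.intervalIntegrable _ _)
    · have hc : Continuous fun s => mulOp hK (D s) := (mulOp hK).continuous.comp hD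
      rw [← e1, ← e2, inner_sub_right, ← ftc, intervalIntegral.integral_neg,
        ← ContinuousLinearMap.intervalIntegral_comp_comm _ (hD.intervalIntegrable _ _),
        intervalIntegral_inner_left hc, neg_add_cancel]
    · intro s hs
      have hd := h.equation φ hφ hφc s hs.1
      rw [e3, eD s hs.1.le]
      refine hd.congr_of_eventuallyEq ?_
      filter_upwards [Ioi_mem_nhds hs.1] with τ hτ
      rw [e1, ea τ (le_of_lt hτ)]
  · exact fun t ht => ⟨hu t ht, ea t ht, eD t ht⟩

/-! ### Exponential radial weights and finite speed of propagation. -/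

section RadialWeight

/-- A smooth function with values in `[0, 1]`, vanishing outside `[s, N]` and equal to `1` on
`[s + 1, N - 1]`. -/
noncomputable def plateau (s N y : ℝ) : ℝ :=
  Real.smoothTransition (y - s) * Real.smoothTransition (N - y)

lemma contDiff_plateau (s N : ℝ) : ContDiff ℝ ∞ (plateau s N) :=
  (Real.smoothTransition.contDiff.comp (contDiff_id.sub contDiff_const)).mul
    (Real.smoothTransition.contDiff.comp (contDiff_const.sub contDiff_id))

lemma plateau_nonneg (s N y : ℝ) : 0 ≤ plateau s N y :=
  mul_nonneg (Real.smoothTransition.nonneg _) (Real.smoothTransition.nonneg _)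

lemma plateau_le_one (s N y : ℝ) : plateau s N y ≤ 1 :=
  mul_le_one₀ (Real.smoothTransition.le_one _) (Real.smoothTransition.nonneg _)
    (Real.smoothTransition.le_one _)

lemma plateau_eq_zero_left {s N y : ℝ} (h : y ≤ s) : plateau s N y = 0 := by
  rw [plateau, Real.smoothTransition.zero_of_nonpos (by linarith), zero_mul]

lemma plateau_eq_zero_right {s N y : ℝ} (h : N ≤ y) : plateau s N y = 0 := by
  rw [plateau, Real.smoothTransition.zero_of_nonpos (x := N - y) (by linarith), mul_zero]

lemma plateau_eq_one {s N y : ℝ} (h₁ : s + 1 ≤ y) (h₂ : y ≤ N - 1) : plateau s N y = 1 := by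
  rw [plateau, Real.smoothTransition.one_of_one_le (by linarith),
    Real.smoothTransition.one_of_one_le (by linarith), one_mul]

/-- The primitive of `plateau`. -/
noncomputable def ramp (s N y : ℝ) : ℝ := ∫ z in (0:ℝ)..y, plateau s N z

lemma hasDerivAt_ramp (s N y : ℝ) : HasDerivAt (ramp s N) (plateau s N y) y :=
  hasDerivAt_primitive (contDiff_plateau s N).continuous y

lemma contDiff_ramp (s N : ℝ) : ContDiff ℝ ∞ (ramp s N) := by
  rw [contDiff_infty_iff_deriv]
  refine ⟨fun y => (hasDerivAt_ramp s N y).differentiableAt, ?_⟩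
  rw [show deriv (ramp s N) = plateau s N from funext fun y => (hasDerivAt_ramp s N y).deriv]
  exact contDiff_plateau s N

lemma plateau_intervalIntegrable (s N a b : ℝ) :
    IntervalIntegrable (plateau s N) volume a b :=
  (contDiff_plateau s N).continuous.intervalIntegrable a b

lemma ramp_le_self (s N : ℝ) {y : ℝ} (hy : 0 ≤ y) : ramp s N y ≤ y := by
  have := intervalIntegral.integral_mono_on hy (plateau_intervalIntegrable s N 0 y)
    (intervalIntegrable_const (c := (1:ℝ))) (fun z _ => plateau_le_one s N z)
  simpa [ramp] using this

lemma ramp_eq_of_le (s : ℝ) {N y : ℝ} (h : N ≤ y) : ramp s N y = ramp s N N := by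
  have h0 : ∫ z in N..y, plateau s N z = 0 := by
    rw [intervalIntegral.integral_congr (g := fun _ => (0:ℝ)), intervalIntegral.integral_zero]
    intro z hz
    rw [uIcc_of_le h] at hz
    exact plateau_eq_zero_right hz.1
  rw [ramp, ramp, ← intervalIntegral.integral_add_adjacent_intervals
    (plateau_intervalIntegrable s N 0 N) (plateau_intervalIntegrable s N N y), h0, add_zero]

lemma ramp_le (s : ℝ) {N y : ℝ} (hN : 0 ≤ N) (hy : 0 ≤ y) : ramp s N y ≤ N := by
  rcases le_total y N with h | h
  · exact (ramp_le_self s N hy).trans h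
  · rw [ramp_eq_of_le s h]; exact ramp_le_self s N hN

/-- The two transition layers of `plateau`, each of length one, account for the loss of `2`. -/
lemma le_ramp {s N y : ℝ} (hs : 0 ≤ s) (hN : s + 2 ≤ N) (hy : N ≤ y) :
    N - s - 2 ≤ ramp s N y := by
  have h1 : ∫ z in (s+1)..(N-1), plateau s N z = N - s - 2 := by
    rw [intervalIntegral.integral_congr (g := fun _ => (1:ℝ))]
    · simp; ring
    · intro z hz
      rw [uIcc_of_le (by linarith)] at hz
      exact plateau_eq_one hz.1 hz.2
  rw [← h1]
  exact intervalIntegral.integral_mono_interval (by linarith) (by linarith) (by linarith)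
    (Eventually.of_forall fun z => plateau_nonneg s N z) (plateau_intervalIntegrable s N 0 y)

/-- The Japanese bracket `√(1 + |x|²)`. -/
noncomputable def bracket (x : Plane) : ℝ := √(1 + ‖x‖ ^ 2)

lemma bracket_pos (x : Plane) : 0 < bracket x := Real.sqrt_pos.2 (by positivity)

lemma norm_le_bracket (x : Plane) : ‖x‖ ≤ bracket x :=
  Real.le_sqrt_of_sq_le (by linarith)

lemma bracket_le {x : Plane} {r : ℝ} (h : ‖x‖ ≤ r) : bracket x ≤ √(1 + r ^ 2) := by
  unfold bracket
  gcongr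

lemma contDiff_bracket : ContDiff ℝ ∞ bracket := by
  unfold bracket
  exact (contDiff_const.add (contDiff_norm_sq ℝ)).sqrt (fun x => by positivity)

lemma hasFDerivAt_bracket (x : Plane) :
    HasFDerivAt bracket ((bracket x)⁻¹ • innerSL ℝ x) x := by
  have h1 : HasFDerivAt (fun y : Plane => 1 + ‖y‖ ^ 2) (2 • innerSL ℝ x) x :=
    ((hasStrictFDerivAt_norm_sq x).hasFDerivAt).const_add 1
  have h2 := h1.sqrt (by positivity)
  refine h2.congr_fderiv ?_
  ext v
  simp [bracket]
  ring

/-- The radial weight `exp (l · ramp ⟨x⟩)`. -/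
noncomputable def radialWeight (l s N : ℝ) (x : Plane) : ℝ := Real.exp (l * ramp s N (bracket x))

lemma contDiff_radialWeight (l s N : ℝ) : ContDiff ℝ ∞ (radialWeight l s N) :=
  (contDiff_const.mul ((contDiff_ramp s N).comp contDiff_bracket)).exp

lemma radialWeight_pos (l s N : ℝ) (x : Plane) : 0 < radialWeight l s N x := Real.exp_pos _

lemma norm_gradient_radialWeight (l s N : ℝ) (x : Plane) :
    ‖gradient (radialWeight l s N) x‖
      = |radialWeight l s N x * (l * (plateau s N (bracket x) * (bracket x)⁻¹))| * ‖x‖ := by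
  have h := (((hasDerivAt_ramp s N (bracket x)).comp_hasFDerivAt x
    (hasFDerivAt_bracket x)).const_mul l).exp
  have h2 : fderiv ℝ (radialWeight l s N) x = _ := h.fderiv
  unfold gradient
  rw [LinearIsometryEquiv.norm_map, h2]
  simp only [smul_smul, norm_smul, innerSL_apply_norm]
  rfl

/-- Neither the slope of the ramp nor `|x| / ⟨x⟩` exceeds one. The bracket is used because, unlike
`|x|`, it is smooth at the origin. -/
lemma norm_gradient_radialWeight_le {l : ℝ} (hl : 0 ≤ l) (s N : ℝ) (x : Plane) :
    ‖gradient (radialWeight l s N) x‖ ≤ l * radialWeight l s N x := by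
  have hb := bracket_pos x
  have hp := plateau_nonneg s N (bracket x)
  have hr := radialWeight_pos l s N x
  rw [norm_gradient_radialWeight, abs_of_nonneg (by positivity)]
  have : (bracket x)⁻¹ * ‖x‖ ≤ 1 := by
    rw [inv_mul_le_iff₀ hb, mul_one]; exact norm_le_bracket x
  calc radialWeight l s N x * (l * (plateau s N (bracket x) * (bracket x)⁻¹)) * ‖x‖
      = l * radialWeight l s N x * (plateau s N (bracket x) * ((bracket x)⁻¹ * ‖x‖)) := by ring
    _ ≤ l * radialWeight l s N x * (1 * 1) := by
        gcongr
        exact plateau_le_one _ _ _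
    _ = _ := by ring

/-- With `s = √(1 + r₀²)` the weight is constant on the ball where `K` varies, so that only the
exterior speed enters the energy growth. -/
lemma gradient_radialWeight_eq_zero {l s N : ℝ} {x : Plane} (h : bracket x ≤ s) :
    gradient (radialWeight l s N) x = 0 := by
  rw [← norm_eq_zero, norm_gradient_radialWeight, plateau_eq_zero_left h]
  simp

lemma radialWeight_le {l : ℝ} (hl : 0 ≤ l) (s : ℝ) {N : ℝ} (hN : 0 ≤ N) (x : Plane) :
    radialWeight l s N x ≤ Real.exp (l * N) :=
  Real.exp_le_exp.2 (mul_le_mul_of_nonneg_left (ramp_le s hN (bracket_pos x).le) hl)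

lemma memLp_radialWeight {l : ℝ} (hl : 0 ≤ l) (s : ℝ) {N : ℝ} (hN : 0 ≤ N) :
    MemLp (radialWeight l s N) ⊤ volume :=
  memLp_top_of_forall_le (contDiff_radialWeight l s N).continuous.aestronglyMeasurable fun x => by
    rw [Real.norm_of_nonneg (radialWeight_pos l s N x).le]
    exact radialWeight_le hl s hN x

lemma memLp_gradient_radialWeight {l : ℝ} (hl : 0 ≤ l) (s : ℝ) {N : ℝ} (hN : 0 ≤ N) :
    MemLp (gradient (radialWeight l s N)) ⊤ volume :=
  memLp_top_of_forall_le
    (continuous_gradient_of_contDiff (contDiff_radialWeight l s N)).aestronglyMeasurable fun x =>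
    (norm_gradient_radialWeight_le hl s N x).trans
      (mul_le_mul_of_nonneg_left (radialWeight_le hl s hN x) hl)

end RadialWeight

/-- Finite speed of propagation, with the exterior speed `√k₀`. -/
theorem IsMildSolution.vanishesOutside {K : Plane → ℝ} {km k₀ r₀ η : ℝ}
    (hc : IsCoefficient K km k₀ r₀ η) {U a : ℝ → L2s} {D : ℝ → L2v}
    (h : IsMildSolution hc.memLp U a D) {L : ℝ} (ha : VanishesOutside L (a 0))
    (hD : VanishesOutside L (D 0)) {t : ℝ} (ht : 0 ≤ t) :
    VanishesOutside (√k₀ * t + (√(1 + L ^ 2) + √(1 + r₀ ^ 2) + 3)) (a t) ∧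
      VanishesOutside (√k₀ * t + (√(1 + L ^ 2) + √(1 + r₀ ^ 2) + 3)) (D t) := by
  set s := √(1 + r₀ ^ 2) with hs
  set b := √(1 + L ^ 2) with hb
  -- The weight is at least `exp (l (N - s - 2))` where the bracket exceeds `N`, and at most `exp (l
  -- b)` on the support of the data. Since `N - s - 2 = √k₀ t + b + 1`, a factor `exp (-l)` is left
  -- after the growth `exp (√k₀ l t)`; letting `l → ∞` kills the exterior energy.
  set N := √k₀ * t + (b + s + 3) with hN
  have hs0 : 0 ≤ s := Real.sqrt_nonneg _
  have hb0 : 0 ≤ b := Real.sqrt_nonneg _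
  have hct : 0 ≤ √k₀ * t := by positivity
  have hN0 : 0 ≤ N := by positivity
  set e : ℝ → Plane → ℝ := fun t x => |a t x| ^ 2 + K x * ‖D t x‖ ^ 2 with he
  have he0 : ∀ t x, 0 ≤ e t x := fun t x => by have := hc.pos x; positivity
  have hei : ∀ t, Integrable (e t) := fun t => by
    simpa only [one_mul] using integrable_weightedEnergy hc.memLp memLp_top_one (a t) (D t)
  have hmeas : MeasurableSet {x : Plane | N ≤ bracket x} :=
    measurableSet_le measurable_const contDiff_bracket.continuous.measurable
  have main : ∀ l : ℝ, 0 ≤ l →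
      ∫ x in {x : Plane | N ≤ bracket x}, e t x ≤ Real.exp (-l) * ∫ x, e 0 x := by
    intro l hl
    have key := h.weightedEnergy_le hc (memLp_radialWeight hl s hN0) (contDiff_radialWeight l s N)
      (memLp_gradient_radialWeight hl s hN0) hl (fun x => (radialWeight_pos l s N x).le)
      (norm_gradient_radialWeight_le hl s N)
      (fun x hx => gradient_radialWeight_eq_zero (bracket_le hx)) ht
    rw [weightedEnergy_eq, weightedEnergy_eq] at key
    have i1 := integrable_weightedEnergy hc.memLp (memLp_radialWeight hl s hN0) (a t) (D t)
    have i2 := integrable_weightedEnergy hc.memLp (memLp_radialWeight hl s hN0) (a 0) (D 0)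
    have lower : Real.exp (l * (N - s - 2)) * ∫ x in {x : Plane | N ≤ bracket x}, e t x
        ≤ ∫ x, radialWeight l s N x * e t x := by
      rw [← integral_const_mul]
      refine (setIntegral_mono_on ((hei t).const_mul _).integrableOn i1.integrableOn hmeas ?_).trans
        (setIntegral_le_integral i1 (Eventually.of_forall fun x =>
          mul_nonneg (radialWeight_pos l s N x).le (he0 t x)))
      intro x hx
      refine mul_le_mul_of_nonneg_right ?_ (he0 t x)
      exact Real.exp_le_exp.2 (mul_le_mul_of_nonneg_left (le_ramp hs0 (by linarith) hx) hl)
    have upper : ∫ x, radialWeight l s N x * e 0 x ≤ Real.exp (l * b) * ∫ x, e 0 x := by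
      rw [← integral_const_mul]
      refine integral_mono_ae i2 ((hei 0).const_mul _) ?_
      filter_upwards [ha, hD] with x hxa hxD
      by_cases hx : L < ‖x‖
      · simp [he, hxa hx, hxD hx]
      · refine mul_le_mul_of_nonneg_right ?_ (he0 0 x)
        refine Real.exp_le_exp.2 (mul_le_mul_of_nonneg_left ?_ hl)
        exact (ramp_le_self s N (bracket_pos x).le).trans (bracket_le (not_lt.1 hx))
    have hE0 : 0 ≤ ∫ x, e 0 x := integral_nonneg (he0 0)
    have h1 : Real.exp (l * (N - s - 2)) * ∫ x in {x : Plane | N ≤ bracket x}, e t x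
        ≤ Real.exp (√k₀ * l * t) * (Real.exp (l * b) * ∫ x, e 0 x) := by
      refine lower.trans (le_trans ?_ (mul_le_mul_of_nonneg_left upper (Real.exp_pos _).le))
      linarith
    have h2 : Real.exp (√k₀ * l * t) * (Real.exp (l * b) * ∫ x, e 0 x)
        = Real.exp (l * (N - s - 2)) * (Real.exp (-l) * ∫ x, e 0 x) := by
      rw [← mul_assoc, ← mul_assoc, ← Real.exp_add, ← Real.exp_add]
      congr 2
      rw [hN]; ring
    rw [h2] at h1
    exact le_of_mul_le_mul_left h1 (Real.exp_pos _)
  have hzero : ∫ x in {x : Plane | N ≤ bracket x}, e t x = 0 := by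
    refine le_antisymm ?_ (integral_nonneg (he0 t))
    have lim : Tendsto (fun l : ℝ => Real.exp (-l) * ∫ x, e 0 x) atTop (𝓝 0) := by
      have := (Real.tendsto_exp_neg_atTop_nhds_zero).mul_const (∫ x, e 0 x)
      rwa [zero_mul] at this
    exact ge_of_tendsto lim ((eventually_ge_atTop 0).mono main)
  rw [setIntegral_eq_zero_iff_of_nonneg_ae (Eventually.of_forall (he0 t)) (hei t).integrableOn]
    at hzero
  have hz := (ae_restrict_iff' hmeas).1 hzero
  have hfin : ∀ᵐ x, N < ‖x‖ → a t x = 0 ∧ D t x = 0 := by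
    filter_upwards [hz] with x hx hNx
    have h0 : e t x = 0 := hx (hNx.le.trans (norm_le_bracket x))
    have hKx := hc.pos x
    have p1 : 0 ≤ |a t x| ^ 2 := by positivity
    have p2 : 0 ≤ K x * ‖D t x‖ ^ 2 := by positivity
    have q1 : |a t x| ^ 2 = 0 := by simp only [he] at h0; linarith
    have q2 : K x * ‖D t x‖ ^ 2 = 0 := by simp only [he] at h0; linarith
    exact ⟨abs_eq_zero.1 (pow_eq_zero_iff (two_ne_zero) |>.1 q1), norm_eq_zero.1
      (pow_eq_zero_iff two_ne_zero |>.1 ((mul_eq_zero.1 q2).resolve_left hKx.ne'))⟩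
  exact ⟨hfin.mono fun x hx hxr => (hx hxr).1, hfin.mono fun x hx hxr => (hx hxr).2⟩

/-- The weak gradient of a function vanishes where the function does. -/
lemma IsWeakGradient.vanishesOutside {f : L2s} {g : L2v} (h : IsWeakGradient f g) {r : ℝ}
    (hf : VanishesOutside r f) : VanishesOutside r g := by
  have hopen : IsOpen {x : Plane | r < ‖x‖} := isOpen_lt continuous_const continuous_norm
  refine hopen.ae_eq_zero_of_integral_contDiff_smul_eq_zero
    (((Lp.memLp g).locallyIntegrable (by norm_num)).locallyIntegrableOn _) ?_
  intro φ hφ hφc hsub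
  have := h φ hφ hφc
  rw [← neg_eq_zero, ← this]
  refine integral_eq_zero_of_ae ?_
  filter_upwards [hf] with x hx
  by_cases hxr : r < ‖x‖
  · simp [hx hxr]
  · have : gradient φ x = 0 := by
      have hx' : x ∉ tsupport φ := fun hmem => hxr (hsub hmem)
      have : φ =ᶠ[𝓝 x] 0 := notMem_tsupport_iff_eventuallyEq.1 hx'
      have h0 : fderiv ℝ φ x = 0 := by rw [this.fderiv_eq]; simp
      rw [gradient, h0, map_zero]
    simp [this]

/-! ### Supports of sums and time integrals. -/

section VanishCalculus

variable {E : Type*} [NormedAddCommGroup E]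

lemma VanishesOutside.mono {r r' : ℝ} {f : Plane → E} (h : VanishesOutside r f) (hr : r ≤ r') :
    VanishesOutside r' f := Eventually.mono h fun _ hx hxr => hx (hr.trans_lt hxr)

lemma VanishesOutside.congr {r : ℝ} {f g : Plane → E} (h : VanishesOutside r f)
    (hfg : g =ᵐ[volume] f) : VanishesOutside r g := by
  filter_upwards [h, hfg] with x hx hxe hxr
  rw [hxe, hx hxr]

variable [NormedSpace ℝ E]

lemma memLp_exterior (r : ℝ) :
    MemLp ({x : Plane | r < ‖x‖}.indicator fun _ => (1:ℝ)) ⊤ volume :=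
  memLp_top_const 1 |>.indicator (measurableSet_lt measurable_const measurable_norm)

/-- As the kernel of a bounded operator, the condition passes to linear combinations and Bochner
integrals. -/
lemma vanishesOutside_iff {r : ℝ} {f : Lp E 2 (volume : Measure Plane)} :
    VanishesOutside r f ↔ mulOp (memLp_exterior r) f = 0 := by
  constructor
  · intro h
    refine Lp.ext ?_
    filter_upwards [h, coeFn_mulOp (memLp_exterior r) f, Lp.coeFn_zero E 2 volume] with x hx h1 h2
    rw [h1, h2]
    by_cases hxr : r < ‖x‖
    · simp [hx hxr]
    · rw [indicator_of_notMem (by simpa using hxr)]; simp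
  · intro h
    filter_upwards [coeFn_mulOp (memLp_exterior r) f, Lp.coeFn_zero E 2 volume] with x h1 h2 hxr
    rw [h, h2, indicator_of_mem (by simpa using hxr)] at h1
    simpa using h1.symm

lemma vanishesOutside_sub {r : ℝ} {f g : Lp E 2 (volume : Measure Plane)}
    (hf : VanishesOutside r f) (hg : VanishesOutside r g) : VanishesOutside r (f - g :) := by
  rw [vanishesOutside_iff] at *
  rw [map_sub, hf, hg, sub_zero]

lemma vanishesOutside_add {r : ℝ} {f g : Lp E 2 (volume : Measure Plane)}
    (hf : VanishesOutside r f) (hg : VanishesOutside r g) : VanishesOutside r (f + g :) := by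
  rw [vanishesOutside_iff] at *
  rw [map_add, hf, hg, add_zero]

lemma vanishesOutside_const_smul {r : ℝ} {f : Lp E 2 (volume : Measure Plane)}
    (hf : VanishesOutside r f) (c : ℝ) : VanishesOutside r (c • f :) := by
  rw [vanishesOutside_iff] at *
  rw [map_smul, hf, smul_zero]

lemma vanishesOutside_intervalIntegral [CompleteSpace E] {r : ℝ}
    {f : ℝ → Lp E 2 (volume : Measure Plane)}
    (hf : Continuous f) {a b : ℝ} (h : ∀ t ∈ uIcc a b, VanishesOutside r (f t)) :
    VanishesOutside r (∫ t in a..b, f t :) := by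
  rw [vanishesOutside_iff,
    ← ContinuousLinearMap.intervalIntegral_comp_comm _ (hf.intervalIntegrable _ _),
    intervalIntegral.integral_congr (g := fun _ => 0), intervalIntegral.integral_zero]
  exact fun t ht => vanishesOutside_iff.1 (h t ht)

end VanishCalculus

/-! ### Logarithmic Poincaré inequality and growth of the `L²` norm. -/

/-- The multiplier `(B + log (1 + |x|²)) / (1 + |x|²)` of the logarithmic Poincaré inequality. -/
noncomputable def logMultiplier (B : ℝ) (x : Plane) : ℝ :=
  (B + Real.log (1 + ‖x‖ ^ 2)) / (1 + ‖x‖ ^ 2)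

lemma contDiff_logMultiplier (B : ℝ) : ContDiff ℝ ∞ (logMultiplier B) := by
  have h : ContDiff ℝ ∞ (fun x : Plane => 1 + ‖x‖ ^ 2) := contDiff_const.add (contDiff_norm_sq ℝ)
  have h0 : ∀ x : Plane, 1 + ‖x‖ ^ 2 ≠ 0 := fun x => by positivity
  exact (contDiff_const.add (h.log h0)).div h h0

lemma inner_gradient_logMultiplier (B : ℝ) (x : Plane) :
    inner ℝ x (gradient (logMultiplier B) x)
      = 2 * ‖x‖ ^ 2 * (1 - (B + Real.log (1 + ‖x‖ ^ 2))) / (1 + ‖x‖ ^ 2) ^ 2 := by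
  have h0 : 1 + ‖x‖ ^ 2 ≠ 0 := by positivity
  have h1 : HasFDerivAt (fun y : Plane => 1 + ‖y‖ ^ 2) (2 • innerSL ℝ x) x :=
    ((hasStrictFDerivAt_norm_sq x).hasFDerivAt).const_add 1
  have h2 : HasDerivAt (fun s : ℝ => (B + Real.log s) / s)
      (((1 + ‖x‖ ^ 2)⁻¹ * (1 + ‖x‖ ^ 2) - (B + Real.log (1 + ‖x‖ ^ 2)) * 1) / (1 + ‖x‖ ^ 2) ^ 2)
      (1 + ‖x‖ ^ 2) :=
    ((Real.hasDerivAt_log h0).const_add B).div (hasDerivAt_id _) h0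
  have h3 := h2.comp_hasFDerivAt x h1
  have h4 : fderiv ℝ (logMultiplier B) x = _ := h3.fderiv
  rw [real_inner_comm, inner_gradient_apply, h4, inv_mul_cancel₀ h0]
  simp
  ring

/-- Logarithmic Poincaré inequality in the plane. -/
theorem IsWeakGradient.setIntegral_sq_le {f : L2s} {g : L2v} (h : IsWeakGradient f g) {r B : ℝ}
    (hf : VanishesOutside r f) (hg : VanishesOutside r g) (hB : 0 < B)
    (hr : Real.log (1 + r ^ 2) ≤ B) (L : ℝ) :
    ∫ x in Metric.closedBall (0 : Plane) L, f x ^ 2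
      ≤ 4 * B * (1 + L ^ 2) ^ 2 * ∫ x, ‖g x‖ ^ 2 := by
  have hm := contDiff_logMultiplier B
  have m1 := hf.memLp_smul (Lp.memLp f) hm.continuous
  have m2 := hg.memLp_smul (Lp.memLp g) hm.continuous
  have m3 := hf.memLp_smul_vec (Lp.memLp f) (continuous_gradient_of_contDiff hm)
  have hp : IsWeakGradient (m1.toLp _) ((m2.add m3).toLp _) :=
    h.mul hm m1.coeFn_toLp (m2.add m3).coeFn_toLp
  have hF : VanishesOutside r (m1.toLp _) := by
    refine VanishesOutside.congr ?_ m1.coeFn_toLp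
    filter_upwards [hf] with x hx hxr
    rw [hx hxr, smul_zero]
  have hG : VanishesOutside r ((m2.add m3).toLp _) := by
    refine VanishesOutside.congr ?_ (m2.add m3).coeFn_toLp
    filter_upwards [hf, hg] with x hx hx2 hxr
    simp [hx hxr, hx2 hxr]
  have key := integral_mul_inner_position_add h hp hF hG
  -- The divergence of `m x` is `2 Y`, where `m` is the multiplier; so the identity `key` amounts to
  -- `∫ f² Y = - ∫ m f x·g`.
  set Y : Plane → ℝ := fun x => (B + Real.log (1 + ‖x‖ ^ 2)) / (1 + ‖x‖ ^ 2) ^ 2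
    + ‖x‖ ^ 2 / (1 + ‖x‖ ^ 2) ^ 2 with hY
  have hYc : Continuous Y := by
    have h0 : ∀ x : Plane, 1 + ‖x‖ ^ 2 ≠ 0 := fun x => by positivity
    have h1 : ∀ x : Plane, (1 + ‖x‖ ^ 2) ^ 2 ≠ 0 := fun x => by positivity
    have hn : Continuous fun x : Plane => 1 + ‖x‖ ^ 2 := by fun_prop
    exact ((continuous_const.add (hn.log h0)).div (hn.pow 2) h1).add
      (Continuous.div (by fun_prop) (hn.pow 2) h1)
  have mx := hg.memLp_inner (Lp.memLp g) (continuous_id (X := Plane))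
  have mY := hf.memLp_smul (Lp.memLp f) hYc
  have i1 : Integrable (fun x => f x ^ 2 * Y x) := by
    refine ((Lp.memLp f).integrable_mul_two mY).congr (Eventually.of_forall fun x => ?_)
    simp only [smul_eq_mul]; ring
  have i2 : Integrable (fun x => (logMultiplier B x * f x) * inner ℝ x (g x)) :=
    m1.integrable_mul_two mx
  have e1 : ∫ x, m1.toLp _ x * inner ℝ x (g x)
      = ∫ x, (logMultiplier B x * f x) * inner ℝ x (g x) := by
    refine integral_congr_ae ?_
    filter_upwards [m1.coeFn_toLp] with x hx
    rw [hx, smul_eq_mul]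
  have i3 : Integrable (fun x => f x * (logMultiplier B x * f x)) :=
    (Lp.memLp f).integrable_mul_two m1
  have e2 : ∫ x, f x * inner ℝ x ((m2.add m3).toLp _ x)
      = (∫ x, (logMultiplier B x * f x) * inner ℝ x (g x))
        + ((2 * ∫ x, f x ^ 2 * Y x) - 2 * ∫ x, f x * (logMultiplier B x * f x)) := by
    have i4 : Integrable (fun x => 2 * (f x ^ 2 * Y x) - 2 * (f x * (logMultiplier B x * f x))) :=
      (i1.const_mul 2).sub (i3.const_mul 2)
    rw [← integral_const_mul, ← integral_const_mul, ← integral_sub (i1.const_mul 2) (i3.const_mul 2),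
      ← integral_add i2 i4]
    refine integral_congr_ae ?_
    filter_upwards [(m2.add m3).coeFn_toLp] with x hx
    have h0 : 1 + ‖x‖ ^ 2 ≠ 0 := by positivity
    rw [hx]
    simp only [Pi.add_apply, inner_add_right, real_inner_smul_right, inner_gradient_logMultiplier,
      hY, logMultiplier]
    field_simp
    ring
  have e3 : ∫ x, f x * m1.toLp _ x = ∫ x, f x * (logMultiplier B x * f x) := by
    refine integral_congr_ae ?_
    filter_upwards [m1.coeFn_toLp] with x hx
    rw [hx, smul_eq_mul]
  rw [e1, e2, e3] at key
  have G := integrable_norm_sq g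
  have bound : - ∫ x, (logMultiplier B x * f x) * inner ℝ x (g x)
      ≤ (1 / 2 * ∫ x, f x ^ 2 * Y x) + 2 * B ^ 2 * ∫ x, ‖g x‖ ^ 2 := by
    rw [← integral_neg, ← integral_const_mul, ← integral_const_mul,
      ← integral_add (i1.const_mul _) (G.const_mul _)]
    refine integral_mono_ae i2.neg ((i1.const_mul _).add (G.const_mul _)) ?_
    filter_upwards [hf] with x hx
    by_cases hxr : r < ‖x‖
    · simp only [hx hxr]
      have : 0 ≤ 2 * B ^ 2 * ‖g x‖ ^ 2 := by positivity
      simpa using this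
    · have hl0 : 0 ≤ Real.log (1 + ‖x‖ ^ 2) := Real.log_nonneg (by nlinarith [sq_nonneg ‖x‖])
      have hlB : Real.log (1 + ‖x‖ ^ 2) ≤ B := by
        refine le_trans (Real.log_le_log (by positivity) ?_) hr
        have := not_lt.1 hxr
        gcongr
      have hp : 0 < 1 + ‖x‖ ^ 2 := by positivity
      have hYnn : 0 ≤ Y x := by simp only [hY]; positivity
      have hmn : 0 ≤ logMultiplier B x := by unfold logMultiplier; positivity
      -- On the support the logarithm is at most `B`, so the numerator of `m` is at most `2 B`; and
      -- `|x|² / (1 + |x|²)²` is the second summand of `Y`.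
      have hsq : (logMultiplier B x * ‖x‖) ^ 2 ≤ (2 * B * √(Y x)) ^ 2 := by
        rw [mul_pow, mul_pow, Real.sq_sqrt hYnn]
        simp only [hY, logMultiplier]
        rw [div_pow, div_mul_eq_mul_div, ← add_div, mul_div_assoc']
        refine div_le_div_of_nonneg_right ?_ (by positivity)
        have : (B + Real.log (1 + ‖x‖ ^ 2)) ^ 2 ≤ (2 * B) ^ 2 := by gcongr; linarith
        exact mul_le_mul this (by linarith) (by positivity) (by positivity)
      have hle := abs_le_of_sq_le_sq' hsq (by positivity) |>.2
      have h1 : -(logMultiplier B x * f x * inner ℝ x (g x))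
          ≤ (logMultiplier B x * ‖x‖) * (|f x| * ‖g x‖) := by
        refine (neg_le_abs _).trans ?_
        rw [abs_mul, abs_mul, abs_of_nonneg hmn]
        have := abs_real_inner_le_norm x (g x)
        calc logMultiplier B x * |f x| * |inner ℝ x (g x)|
            ≤ logMultiplier B x * |f x| * (‖x‖ * ‖g x‖) := by gcongr
          _ = _ := by ring
      have h2 : (logMultiplier B x * ‖x‖) * (|f x| * ‖g x‖)
          ≤ (2 * B * √(Y x)) * (|f x| * ‖g x‖) := by gcongr
      have h3 := Real.sq_sqrt hYnn
      have h4 := sq_abs (f x)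
      refine (h1.trans h2).trans ?_
      have h5 : f x ^ 2 * Y x = (√(Y x) * |f x|) ^ 2 := by rw [mul_pow, h3, h4]; ring
      rw [h5]
      nlinarith [sq_nonneg (√(Y x) * |f x| - 2 * B * ‖g x‖)]
  have final : ∫ x, f x ^ 2 * Y x ≤ 4 * B ^ 2 * ∫ x, ‖g x‖ ^ 2 := by linarith
  -- The first summand of `Y` supplies a factor `B`, which reduces `B²` to `B`. This is what makes
  -- the growth `√(log t)` rather than `log t`.
  have lower : B / (1 + L ^ 2) ^ 2 * ∫ x in Metric.closedBall (0 : Plane) L, f x ^ 2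
      ≤ ∫ x, f x ^ 2 * Y x := by
    have hYpos : ∀ x, B / (1 + ‖x‖ ^ 2) ^ 2 ≤ Y x := by
      intro x
      have hl0 : 0 ≤ Real.log (1 + ‖x‖ ^ 2) := Real.log_nonneg (by nlinarith [sq_nonneg ‖x‖])
      simp only [hY, ← add_div]
      gcongr
      nlinarith [sq_nonneg ‖x‖]
    have hY0 : ∀ x, 0 ≤ Y x := fun x => le_trans (by positivity) (hYpos x)
    have F2 : Integrable (fun x => f x ^ 2) := (Lp.memLp f).integrable_sq
    rw [← integral_const_mul]
    refine (setIntegral_mono_on (F2.const_mul _).integrableOn i1.integrableOn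
      measurableSet_closedBall ?_).trans (setIntegral_le_integral i1 (Eventually.of_forall fun x =>
        mul_nonneg (sq_nonneg _) (hY0 x)))
    intro x hx
    rw [mul_comm]
    refine mul_le_mul_of_nonneg_left ?_ (sq_nonneg _)
    refine le_trans ?_ (hYpos x)
    have : ‖x‖ ≤ L := by simpa using hx
    gcongr
  have hfin := lower.trans final
  rw [div_mul_eq_mul_div, div_le_iff₀ (by positivity)] at hfin
  refine le_of_mul_le_mul_left ?_ hB
  linarith

namespace IsMildSolution

variable {K : Plane → ℝ} {km k₀ r₀ η : ℝ} {U a : ℝ → L2s} {D : ℝ → L2v}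

lemma vanishesOutside_primitives (hc : IsCoefficient K km k₀ r₀ η)
    (h : IsMildSolution hc.memLp U a D) {M : ℝ}
    (hU₀ : VanishesOutside M (U 0))
    (ha : ∀ t, 0 ≤ t → VanishesOutside (√k₀ * t + M) (a t))
    (hD : ∀ t, 0 ≤ t → VanishesOutside (√k₀ * t + M) (D t)) {t : ℝ} (ht : 0 ≤ t) :
    VanishesOutside (√k₀ * t + M) (U t) ∧
    VanishesOutside (√k₀ * t + M) (∫ s in (0:ℝ)..t, D s :) := by
  have hmono : ∀ s ∈ uIcc 0 t, √k₀ * s + M ≤ √k₀ * t + M := by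
    intro s hs
    rw [uIcc_of_le ht] at hs
    have := mul_le_mul_of_nonneg_left hs.2 (Real.sqrt_nonneg k₀)
    linarith
  have hpos : ∀ s ∈ uIcc 0 t, 0 ≤ s := fun s hs => by rw [uIcc_of_le ht] at hs; exact hs.1
  constructor
  · have e : U t = U 0 + ∫ s in (0:ℝ)..t, a s := by
      rw [intervalIntegral.integral_eq_sub_of_hasDerivAt (fun s _ => h.hasDerivAt s)
        (h.continuous_vel.intervalIntegrable _ _)]
      abel
    rw [e]
    refine vanishesOutside_add (hU₀.mono ?_) ?_
    · have : 0 ≤ √k₀ * t := by positivity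
      linarith
    · exact vanishesOutside_intervalIntegral h.continuous_vel
        fun s hs => (ha s (hpos s hs)).mono (hmono s hs)
  · exact vanishesOutside_intervalIntegral h.continuous_grad
        fun s hs => (hD s (hpos s hs)).mono (hmono s hs)

/-- The energy identity for the time primitive of the solution. -/
lemma primitive_energy_eq {hK : MemLp K ⊤ volume} (h : IsMildSolution hK U a D) {t : ℝ}
    (ht : 0 ≤ t) :
    ‖U t‖ ^ 2 + inner ℝ (mulOp hK (∫ s in (0:ℝ)..t, D s)) (∫ s in (0:ℝ)..t, D s)
      = ‖U 0‖ ^ 2 + 2 * inner ℝ (a 0) (∫ s in (0:ℝ)..t, U s) := by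
  -- The integrated equation tested with `U s` itself, whose gradient `D s` is the time derivative
  -- of the primitive of `D`.
  have hd : ∀ s ∈ Icc 0 t, HasDerivAt (fun t => (inner ℝ (U t) (U t) : ℝ)
      + inner ℝ (mulOp hK (∫ s in (0:ℝ)..t, D s)) (∫ s in (0:ℝ)..t, D s)
      - 2 * inner ℝ (a 0) (∫ s in (0:ℝ)..t, U s)) 0 s := by
    intro s hs
    have d1 := (h.hasDerivAt s).inner ℝ (h.hasDerivAt s)
    have d2 := ((hasDerivAt_primitive h.continuous_grad s).continuousLinearMap_apply
      (mulOp hK)).inner ℝ (hasDerivAt_primitive h.continuous_grad s)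
    have d3 := ((hasDerivAt_const s (a 0)).inner ℝ (hasDerivAt_primitive h.continuous s)).const_mul 2
    refine ((d1.add d2).sub d3).congr_deriv ?_
    have e := h.equation s hs.1 (U s) (D s) (h.pair s hs.1)
    rw [inner_sub_left] at e
    have c1 : (inner ℝ (mulOp hK (D s)) (∫ s in (0:ℝ)..s, D s) : ℝ)
        = inner ℝ (mulOp hK (∫ s in (0:ℝ)..s, D s)) (D s) := by
      rw [inner_mulOp_comm, real_inner_comm]
    have c2 : (inner ℝ (U s) (a s) : ℝ) = inner ℝ (a s) (U s) := real_inner_comm _ _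
    rw [c1, c2, inner_zero_left]
    linarith
  have := (convex_Icc 0 t).norm_image_sub_le_of_norm_hasDerivWithin_le (C := 0)
    (fun s hs => (hd s hs).hasDerivWithinAt) (fun s _ => by simp)
    (left_mem_Icc.2 ht) (right_mem_Icc.2 ht)
  rw [zero_mul] at this
  have := sub_eq_zero.1 (norm_le_zero_iff.1 this)
  simp only [intervalIntegral.integral_same, map_zero, inner_zero_right,
    mul_zero, real_inner_self_eq_norm_sq] at this
  linarith

/-- In the plane, the `L²` norm of the solution grows at most like `√(log t)`. -/
theorem exists_norm_le_sqrt_log (hc : IsCoefficient K km k₀ r₀ η)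
    (h : IsMildSolution hc.memLp U a D) {L M : ℝ} (hM : 0 ≤ M)
    (ha₀ : VanishesOutside L (a 0)) (hU₀ : VanishesOutside M (U 0))
    (ha : ∀ t, 0 ≤ t → VanishesOutside (√k₀ * t + M) (a t))
    (hD : ∀ t, 0 ≤ t → VanishesOutside (√k₀ * t + M) (D t)) :
    ∃ C, 0 ≤ C ∧ ∀ t, 2 ≤ t → ‖U t‖ ≤ C * √(Real.log t) := by
  set c := √k₀ with hcdef
  have hc0 : 0 ≤ c := Real.sqrt_nonneg _
  have hmain : ∀ t, 2 ≤ t → ‖U t‖ ^ 2 ≤ ‖U 0‖ ^ 2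
      + 4 * (1 + L ^ 2) ^ 2 / km * ‖a 0‖ ^ 2 * (1 + Real.log (1 + (c * t + M) ^ 2)) := by
    intro t ht
    have ht0 : 0 ≤ t := by linarith
    set B := 1 + Real.log (1 + (c * t + M) ^ 2) with hB
    have hlog : 0 ≤ Real.log (1 + (c * t + M) ^ 2) :=
      Real.log_nonneg (by nlinarith [sq_nonneg (c * t + M)])
    have hBpos : 0 < B := by linarith
    have hpair := h.pair_primitive le_rfl ht0
    set v := ∫ s in (0:ℝ)..t, U s with hv
    set V := ∫ s in (0:ℝ)..t, D s with hV
    have hVv : VanishesOutside (c * t + M) V :=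
      (h.vanishesOutside_primitives hc hU₀ ha hD ht0).2
    have hvv : VanishesOutside (c * t + M) v := by
      refine vanishesOutside_intervalIntegral h.continuous fun s hs => ?_
      rw [uIcc_of_le ht0] at hs
      refine (h.vanishesOutside_primitives hc hU₀ ha hD hs.1).1.mono ?_
      have := mul_le_mul_of_nonneg_left hs.2 hc0
      linarith
    have hP := hpair.setIntegral_sq_le hvv hVv hBpos (by linarith) L
    have hE := h.primitive_energy_eq ht0
    rw [← hv, ← hV] at hE
    have hnV : ∫ x, ‖V x‖ ^ 2 = ‖V‖ ^ 2 := by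
      rw [← real_inner_self_eq_norm_sq, L2.inner_def]
      exact integral_congr_ae (Eventually.of_forall fun x => (real_inner_self_eq_norm_sq _).symm)
    have hna : ∫ x, (a 0 x) ^ 2 = ‖a 0‖ ^ 2 := by
      rw [← real_inner_self_eq_norm_sq, L2.inner_def]
      exact integral_congr_ae (Eventually.of_forall fun x => by simp [sq])
    have hKV : km * ‖V‖ ^ 2 ≤ inner ℝ (mulOp hc.memLp V) V := by
      rw [inner_mulOp_left, ← hnV, ← integral_const_mul]
      refine integral_mono ((integrable_norm_sq V).const_mul _)
        (integrable_memLp_top_mul hc.memLp (L2.integrable_inner V V)) fun x => ?_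
      simp only [real_inner_self_eq_norm_sq]
      exact mul_le_mul_of_nonneg_right (hc.km_le x) (sq_nonneg _)
    -- The Young parameter is the Poincaré constant divided by `km`, so that `lam⁻¹ ∫ v²` over the
    -- ball is absorbed by `km ‖V‖²`. Only `lam ‖a 0‖²` remains, and `lam` is proportional to `B`,
    -- hence logarithmic in `t`.
    set lam := 4 * B * (1 + L ^ 2) ^ 2 / km with hlam
    have hkm := hc.km_pos
    have hlampos : 0 < lam := by positivity
    have a2 : Integrable (fun x => (a 0 x) ^ 2) := (Lp.memLp (a 0)).integrable_sq
    have v2 : Integrable (fun x => (v x) ^ 2) := (Lp.memLp v).integrable_sq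
    have hin : 2 * inner ℝ (a 0) v
        ≤ lam * ‖a 0‖ ^ 2 + lam⁻¹ * ∫ x in Metric.closedBall (0 : Plane) L, v x ^ 2 := by
      rw [L2.inner_def, ← hna, ← integral_const_mul, ← integral_const_mul, ← integral_const_mul,
        ← integral_indicator measurableSet_closedBall,
        ← integral_add (a2.const_mul _) ((v2.const_mul _).indicator measurableSet_closedBall)]
      refine integral_mono_ae ((L2.integrable_inner _ _).const_mul _)
        ((a2.const_mul _).add ((v2.const_mul _).indicator measurableSet_closedBall)) ?_
      filter_upwards [ha₀] with x hx
      by_cases hxL : L < ‖x‖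
      · rw [indicator_of_notMem (by simpa using hxL), hx hxL]
        simp
      · rw [indicator_of_mem (by simpa using hxL)]
        simp only [RCLike.inner_apply, conj_trivial]
        have h1 : lam⁻¹ * (lam * a 0 x - v x) ^ 2
            = lam * a 0 x ^ 2 + lam⁻¹ * v x ^ 2 - 2 * (v x * a 0 x) := by
          field_simp
          ring
        have h2 : 0 ≤ lam⁻¹ * (lam * a 0 x - v x) ^ 2 := by positivity
        linarith
    have hP2 : lam⁻¹ * ∫ x in Metric.closedBall (0 : Plane) L, v x ^ 2 ≤ km * ‖V‖ ^ 2 := by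
      rw [inv_mul_le_iff₀ hlampos, ← hnV]
      refine hP.trans (le_of_eq ?_)
      rw [hlam]; field_simp
    have hfin : lam * ‖a 0‖ ^ 2 = 4 * (1 + L ^ 2) ^ 2 / km * ‖a 0‖ ^ 2 * B := by
      rw [hlam]; ring
    linarith
  set A := 4 * (1 + L ^ 2) ^ 2 / km * ‖a 0‖ ^ 2 with hA
  have hkm := hc.km_pos
  have hA0 : 0 ≤ A := by positivity
  set G := 1 + c + M with hG
  have hG1 : 1 ≤ G := by linarith
  have hlog2 : 0 < Real.log 2 := Real.log_pos (by norm_num)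
  have hGlog : 0 ≤ Real.log G := Real.log_nonneg hG1
  -- For `t ≥ 2` the constant terms are multiples of `log t` after division by `log 2`.
  set Z := (‖U 0‖ ^ 2 + A * (1 + 2 * Real.log G)) / Real.log 2 + 2 * A with hZ
  have hZ0 : 0 ≤ Z := by positivity
  refine ⟨√Z, Real.sqrt_nonneg _, fun t ht => ?_⟩
  have hlt : Real.log 2 ≤ Real.log t := Real.log_le_log (by norm_num) ht
  rw [← Real.sqrt_mul hZ0]
  refine Real.le_sqrt_of_sq_le ((hmain t ht).trans ?_)
  have h1 : 1 + (c * t + M) ^ 2 ≤ (G * t) ^ 2 := by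
    have p1 : 1 ≤ t := by linarith
    have p2 : c * t + M ≤ (c + M) * t := by nlinarith
    have p3 : 0 ≤ c * t + M := by positivity
    have p4 : (c * t + M) ^ 2 ≤ ((c + M) * t) ^ 2 := by gcongr
    have p5 : (G * t) ^ 2 = ((c + M) * t) ^ 2 + 2 * ((c + M) * t ^ 2) + t ^ 2 := by rw [hG]; ring
    have p6 : 0 ≤ (c + M) * t ^ 2 := by positivity
    nlinarith
  have h2 : Real.log (1 + (c * t + M) ^ 2) ≤ 2 * Real.log G + 2 * Real.log t := by
    refine (Real.log_le_log (by positivity) h1).trans (le_of_eq ?_)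
    rw [Real.log_pow, Real.log_mul (by positivity) (by positivity)]
    push_cast; ring
  have h3 : ‖U 0‖ ^ 2 + A * (1 + 2 * Real.log G)
      ≤ (‖U 0‖ ^ 2 + A * (1 + 2 * Real.log G)) / Real.log 2 * Real.log t := by
    rw [div_mul_eq_mul_div, le_div_iff₀ hlog2]
    gcongr
  calc ‖U 0‖ ^ 2 + A * (1 + Real.log (1 + (c * t + M) ^ 2))
      ≤ ‖U 0‖ ^ 2 + A * (1 + (2 * Real.log G + 2 * Real.log t)) := by gcongr
    _ = (‖U 0‖ ^ 2 + A * (1 + 2 * Real.log G)) + 2 * A * Real.log t := by ring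
    _ ≤ Z * Real.log t := by rw [hZ, add_mul]; linarith

end IsMildSolution

/-! ### The Morawetz inequality. -/

lemma memLp_ball (r : ℝ) :
    MemLp ((Metric.closedBall (0 : Plane) r).indicator fun _ => (1:ℝ)) ⊤ volume :=
  memLp_top_const 1 |>.indicator measurableSet_closedBall

/-- The position vector, truncated outside a ball. -/
lemma memLp_position (r : ℝ) :
    MemLp ((Metric.closedBall (0 : Plane) r).indicator fun x => x) ⊤ volume := by
  refine memLp_top_of_forall_le (C := |r|)
    (measurable_id.indicator measurableSet_closedBall).aestronglyMeasurable fun x => ?_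
  by_cases hx : x ∈ Metric.closedBall (0 : Plane) r
  · rw [indicator_of_mem hx]
    exact (by simpa using hx : ‖x‖ ≤ r).trans (le_abs_self r)
  · rw [indicator_of_notMem hx]; simp

lemma inner_dotOp_position {r : ℝ} {g : L2v} (hg : VanishesOutside r g) (f : L2s) :
    (inner ℝ f (dotOp (memLp_position r) g) : ℝ) = ∫ x, f x * inner ℝ x (g x) := by
  rw [L2.inner_def]
  refine integral_congr_ae ?_
  filter_upwards [coeFn_dotOp (memLp_position r) g, hg] with x hx hgx
  rw [hx]
  by_cases hxr : r < ‖x‖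
  · simp [hgx hxr]
  · rw [indicator_of_mem (by simpa using hxr)]
    simp [mul_comm]

lemma weightedEnergy_ball {K : Plane → ℝ} (hK : MemLp K ⊤ volume) (r : ℝ) (f : L2s) (g : L2v) :
    weightedEnergy hK (memLp_ball r) f g
      = 1 / 2 * ∫ x in Metric.closedBall (0 : Plane) r, (|f x| ^ 2 + K x * ‖g x‖ ^ 2) := by
  rw [weightedEnergy_eq, ← integral_indicator measurableSet_closedBall]
  congr 1
  refine integral_congr_ae (Eventually.of_forall fun x => ?_)
  by_cases hx : x ∈ Metric.closedBall (0 : Plane) r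
  · simp only [indicator_of_mem hx, one_mul]
  · simp only [indicator_of_notMem hx, zero_mul]

namespace IsStrongSolution

variable {K : Plane → ℝ} {km k₀ r₀ η : ℝ} {w w' w'' : ℝ → L2s} {W W' : ℝ → L2v}

/-- The Morawetz functional `t E(t) + ∫ w_t x · ∇w + ½ ∫ w_t w`. -/
lemma morawetz_le (hc : IsCoefficient K km k₀ r₀ η)
    (h : IsStrongSolution hc.memLp w w' w'' W W') (hWc : Continuous W) {r T : ℝ} (hT : 0 ≤ T)
    (hw : ∀ t ∈ Icc 0 T, VanishesOutside r (w t)) (hw' : ∀ t ∈ Icc 0 T, VanishesOutside r (w' t))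
    (hW : ∀ t ∈ Icc 0 T, VanishesOutside r (W t)) (hW' : ∀ t ∈ Icc 0 T, VanishesOutside r (W' t)) :
    T * weightedEnergy hc.memLp memLp_top_one (w' T) (W T)
        + inner ℝ (w' T) (dotOp (memLp_position r) (W T)) + 1 / 2 * inner ℝ (w' T) (w T)
      ≤ inner ℝ (w' 0) (dotOp (memLp_position r) (W 0)) + 1 / 2 * inner ℝ (w' 0) (w 0)
        + η * ∫ s in (0:ℝ)..T, weightedEnergy hc.memLp (memLp_ball r₀) 0 (W s) := by
  set l : ℝ → ℝ := fun s => weightedEnergy hc.memLp (memLp_ball r₀) 0 (W s) with hl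
  have hlc : Continuous l := continuous_iff_continuousAt.2 fun s =>
    (tendsto_const_nhds (x := (0 : L2s))).weightedEnergy hc.memLp (memLp_ball r₀) (hWc.tendsto s)
  -- In the derivative, `t E` gives `E`, the radial term gives `∫ w'' x·W - ‖w'‖²`, and the last
  -- product gives `½ ‖w'‖² - ½ ∫ K |W|²`. All but `∫ w'' x·W` cancels, and the Rellich inequality
  -- controls that term.
  have key := le_of_hasDerivAt_nonpos (T := T)
    (F := fun t => t * weightedEnergy hc.memLp memLp_top_one (w' t) (W t)
        + inner ℝ (w' t) (dotOp (memLp_position r) (W t)) + 1 / 2 * inner ℝ (w' t) (w t)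
        - η * ∫ s in (0:ℝ)..t, l s)
    (F' := fun t => inner ℝ (w'' t) (dotOp (memLp_position r) (W t)) - η * l t) ?_ ?_ hT
  · simp only [intervalIntegral.integral_same, mul_zero, zero_mul, zero_add, sub_zero] at key
    linarith
  · intro t ht
    have d1 := (hasDerivAt_id t).mul (h.hasDerivAt_energy ht.1)
    have d2 := (h.hasDerivAt_deriv t ht.1).inner ℝ
      ((h.hasDerivAt_grad t ht.1).continuousLinearMap_apply (dotOp (memLp_position r)))
    have d3 := ((h.hasDerivAt_deriv t ht.1).inner ℝ (h.hasDerivAt t ht.1)).const_mul (1 / 2 : ℝ)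
    have d4 := (hasDerivAt_primitive hlc t).const_mul η
    refine (((d1.add d2).add d3).sub d4).congr_deriv ?_
    have e1 := integral_mul_inner_position_add (h.pair_deriv t ht.1) (h.pair_deriv t ht.1)
      (hw' t ht) (hW' t ht)
    have e2 : ∫ x, w' t x * w' t x = inner ℝ (w' t) (w' t) := by
      rw [L2.inner_def]; exact integral_congr_ae (Eventually.of_forall fun x => by simp [sq])
    rw [← inner_dotOp_position (hW' t ht), e2] at e1
    have e3 := h.equation t ht.1 _ _ (h.pair t ht.1)
    have e4 : weightedEnergy hc.memLp memLp_top_one (w' t) (W t)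
        = 1 / 2 * (inner ℝ (w' t) (w' t) + inner ℝ (mulOp hc.memLp (W t)) (W t)) := by
      unfold weightedEnergy
      rw [inner_mulOp_left, inner_mulOp_mulOp, inner_mulOp_left, L2.inner_def]
      simp only [one_mul]
    simp only [id, e4]
    linarith
  · intro t ht
    have hR := hc.rellich_le (h.pair t ht.1) (hw t ht) (hW t ht) (h.equation t ht.1)
    rw [← inner_dotOp_position (hW t ht)] at hR
    have e : l t = 1 / 2 * ∫ x in Metric.closedBall (0 : Plane) r₀, K x * ‖W t x‖ ^ 2 := by
      rw [hl]
      simp only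
      rw [weightedEnergy_ball]
      congr 1
      refine setIntegral_congr_ae measurableSet_closedBall ?_
      filter_upwards [Lp.coeFn_zero ℝ 2 (volume : Measure Plane)] with x hx _
      rw [hx]; simp
    rw [e]
    linarith

end IsStrongSolution

lemma weightedEnergy_mono {K ψ χ : Plane → ℝ} (hK : MemLp K ⊤ volume) (hK0 : ∀ x, 0 ≤ K x)
    (hψ : MemLp ψ ⊤ volume) (hχ : MemLp χ ⊤ volume) (hle : ∀ x, ψ x ≤ χ x) (f : L2s) (g : L2v) :
    weightedEnergy hK hψ f g ≤ weightedEnergy hK hχ f g := by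
  rw [weightedEnergy_eq, weightedEnergy_eq]
  refine mul_le_mul_of_nonneg_left ?_ (by norm_num)
  refine integral_mono (integrable_weightedEnergy hK hψ f g) (integrable_weightedEnergy hK hχ f g)
    fun x => ?_
  have := hK0 x
  exact mul_le_mul_of_nonneg_right (hle x) (by positivity)

lemma weightedEnergy_nonneg {K ψ : Plane → ℝ} (hK : MemLp K ⊤ volume) (hK0 : ∀ x, 0 ≤ K x)
    (hψ : MemLp ψ ⊤ volume) (h : ∀ x, 0 ≤ ψ x) (f : L2s) (g : L2v) :
    0 ≤ weightedEnergy hK hψ f g := by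
  rw [weightedEnergy_eq]
  refine mul_nonneg (by norm_num) (integral_nonneg fun x => ?_)
  have := hK0 x
  have := h x
  positivity

lemma weightedEnergy_zero_left_le {K ψ : Plane → ℝ} (hK : MemLp K ⊤ volume)
    (hψ : MemLp ψ ⊤ volume) (h : ∀ x, 0 ≤ ψ x) (f : L2s) (g : L2v) :
    weightedEnergy hK hψ 0 g ≤ weightedEnergy hK hψ f g := by
  unfold weightedEnergy
  rw [inner_zero_right]
  have : (0:ℝ) ≤ inner ℝ (mulOp hψ f) f := by
    rw [inner_mulOp_left]
    exact integral_nonneg fun x => mul_nonneg (h x) (real_inner_self_nonneg)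
  linarith

namespace IsMildSolution

variable {K : Plane → ℝ} {km k₀ r₀ η : ℝ} {U a : ℝ → L2s} {D : ℝ → L2v}

lemma continuous_weightedEnergy {hK : MemLp K ⊤ volume} (h : IsMildSolution hK U a D)
    {ψ : Plane → ℝ} (hψ : MemLp ψ ⊤ volume) :
    Continuous fun t => weightedEnergy hK hψ (a t) (D t) :=
  continuous_iff_continuousAt.2 fun t =>
    (h.continuous_vel.tendsto t).weightedEnergy hK hψ (h.continuous_grad.tendsto t)

/-- Limit `ε → 0` of the inequality for the Steklov averages. Every term is continuous in the energy
norm; only the time integral needs dominated convergence. -/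
theorem morawetz_le (hc : IsCoefficient K km k₀ r₀ η) (h : IsMildSolution hc.memLp U a D) {M : ℝ}
    (hU₀ : VanishesOutside M (U 0))
    (ha : ∀ t, 0 ≤ t → VanishesOutside (√k₀ * t + M) (a t))
    (hD : ∀ t, 0 ≤ t → VanishesOutside (√k₀ * t + M) (D t)) {T : ℝ} (hT : 0 ≤ T) :
    T * weightedEnergy hc.memLp memLp_top_one (a T) (D T)
        + (∫ x, a T x * inner ℝ x (D T x)) + 1 / 2 * inner ℝ (a T) (U T)
      ≤ (∫ x, a 0 x * inner ℝ x (D 0 x)) + 1 / 2 * inner ℝ (a 0) (U 0)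
        + η * ∫ s in (0:ℝ)..T, weightedEnergy hc.memLp (memLp_ball r₀) 0 (D s) := by
  have hK0 : ∀ x, 0 ≤ K x := fun x => (hc.pos x).le
  have hball : ∀ (r : ℝ) x,
      (0:ℝ) ≤ (Metric.closedBall (0 : Plane) r).indicator (fun _ => (1:ℝ)) x :=
    fun r x => indicator_nonneg (fun _ _ => zero_le_one) x
  have hball1 : ∀ (r : ℝ) x,
      (Metric.closedBall (0 : Plane) r).indicator (fun _ => (1:ℝ)) x ≤ 1 :=
    fun r x => indicator_le_self' (fun _ _ => zero_le_one) x
  -- An average at time `T` looks ahead to `T + ε`; one radius for all times up to `T + 1` covers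
  -- every `ε < 1`.
  set r := √k₀ * (T + 1) + M with hr
  have hc0 : 0 ≤ √k₀ := Real.sqrt_nonneg _
  have hmono : ∀ t, t ≤ T + 1 → √k₀ * t + M ≤ r := fun t ht => by
    have := mul_le_mul_of_nonneg_left ht hc0
    linarith
  have va : ∀ t, 0 ≤ t → t ≤ T + 1 → VanishesOutside r (a t) := fun t h0 h1 =>
    (ha t h0).mono (hmono t h1)
  have vD : ∀ t, 0 ≤ t → t ≤ T + 1 → VanishesOutside r (D t) := fun t h0 h1 =>
    (hD t h0).mono (hmono t h1)
  have vU : ∀ t, 0 ≤ t → t ≤ T + 1 → VanishesOutside r (U t) := fun t h0 h1 =>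
    (h.vanishesOutside_primitives hc hU₀ ha hD h0).1.mono (hmono t h1)
  have vV : ∀ t, 0 ≤ t → t ≤ T + 1 → VanishesOutside r (∫ s in (0:ℝ)..t, D s :) := fun t h0 h1 =>
    (h.vanishesOutside_primitives hc hU₀ ha hD h0).2.mono (hmono t h1)
  have vI : ∀ t, 0 ≤ t → t ≤ T + 1 → VanishesOutside r (∫ s in (0:ℝ)..t, U s :) := by
    intro t h0 h1
    refine vanishesOutside_intervalIntegral h.continuous fun s hs => ?_
    rw [uIcc_of_le h0] at hs
    exact vU s hs.1 (hs.2.trans h1)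
  set V : ℝ → L2v := fun t => ∫ s in (0:ℝ)..t, D s with hV
  set I : ℝ → L2s := fun t => ∫ s in (0:ℝ)..t, U s with hI
  have hVc : Continuous V := continuous_iff_continuousAt.2 fun t =>
    (hasDerivAt_primitive h.continuous_grad t).continuousAt
  have strong : ∀ᶠ ε in 𝓝[>] (0:ℝ),
      T * weightedEnergy hc.memLp memLp_top_one (steklov ε U T) (steklov ε V T)
        + inner ℝ (steklov ε U T) (dotOp (memLp_position r) (steklov ε V T))
        + 1 / 2 * inner ℝ (steklov ε U T) (steklov ε I T)
      ≤ inner ℝ (steklov ε U 0) (dotOp (memLp_position r) (steklov ε V 0))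
        + 1 / 2 * inner ℝ (steklov ε U 0) (steklov ε I 0)
        + η * ∫ s in (0:ℝ)..T, weightedEnergy hc.memLp (memLp_ball r₀) 0 (steklov ε V s) := by
    filter_upwards [Ioo_mem_nhdsGT (zero_lt_one (α := ℝ))] with ε hε
    have hcont : Continuous (steklov ε V) := by
      unfold steklov
      exact ((hVc.comp (continuous_id.add continuous_const)).sub hVc).const_smul ε⁻¹
    have st : ∀ {E : Type} [NormedAddCommGroup E] [NormedSpace ℝ E]
        (F : ℝ → Lp E 2 (volume : Measure Plane)),
        (∀ t, 0 ≤ t → t ≤ T + 1 → VanishesOutside r (F t)) → ∀ t ∈ Icc 0 T,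
        VanishesOutside r (steklov ε F t :) := by
      intro E _ _ F hF t ht
      exact vanishesOutside_const_smul (vanishesOutside_sub
        (hF _ (by linarith [ht.1, hε.1]) (by linarith [ht.2, hε.2]))
        (hF t ht.1 (by linarith [ht.2]))) _
    exact (h.isStrongSolution_steklov hε.1).morawetz_le hc hcont hT (st I vI) (st U vU) (st V vV)
      (st D vD)
  have lU := fun t => tendsto_steklov (h.hasDerivAt t)
  have lV := fun t => tendsto_steklov (hasDerivAt_primitive h.continuous_grad t)
  have lI := fun t => tendsto_steklov (hasDerivAt_primitive h.continuous t)
  have lX : ∀ t, Tendsto (fun ε => dotOp (memLp_position r) (steklov ε V t)) (𝓝[>] 0)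
      (𝓝 (dotOp (memLp_position r) (D t))) := fun t =>
    ((dotOp (memLp_position r)).continuous.tendsto (D t)).comp (lV t)
  have lint : Tendsto (fun ε => ∫ s in (0:ℝ)..T,
      weightedEnergy hc.memLp (memLp_ball r₀) 0 (steklov ε V s)) (𝓝[>] 0)
      (𝓝 (∫ s in (0:ℝ)..T, weightedEnergy hc.memLp (memLp_ball r₀) 0 (D s))) := by
    -- Energy conservation for the averages bounds the integrand at every time by their energy at
    -- time zero, which converges to `E₀`.
    set E₀ := weightedEnergy hc.memLp memLp_top_one (a 0) (D 0) with hE₀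
    have hEb : ∀ᶠ ε in 𝓝[>] (0:ℝ),
        weightedEnergy hc.memLp memLp_top_one (steklov ε U 0) (steklov ε V 0) ≤ E₀ + 1 :=
      (h.tendsto_weightedEnergy memLp_top_one 0).eventually_le_const (lt_add_one _)
    refine intervalIntegral.tendsto_integral_filter_of_dominated_convergence (fun _ => E₀ + 1)
      ?_ ?_ intervalIntegrable_const ?_
    · refine Eventually.of_forall fun ε => ?_
      have hcont : Continuous (steklov ε V) := by
        unfold steklov
        exact ((hVc.comp (continuous_id.add continuous_const)).sub hVc).const_smul ε⁻¹
      have : Continuous fun s => weightedEnergy hc.memLp (memLp_ball r₀) 0 (steklov ε V s) :=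
        continuous_iff_continuousAt.2 fun s => (tendsto_const_nhds (x := (0 : L2s))).weightedEnergy
          hc.memLp (memLp_ball r₀) (hcont.tendsto s)
      exact this.aestronglyMeasurable
    · filter_upwards [hEb, self_mem_nhdsWithin] with ε hε hε0
      refine Eventually.of_forall fun s hs => ?_
      rw [uIoc_of_le hT] at hs
      rw [Real.norm_of_nonneg (weightedEnergy_nonneg _ hK0 _ (hball r₀) _ _)]
      refine le_trans ?_ hε
      rw [← (h.isStrongSolution_steklov hε0).energy_eq hs.1.le]
      exact (weightedEnergy_zero_left_le _ _ (hball r₀) (steklov ε U s) _).trans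
        (weightedEnergy_mono _ hK0 _ _ (hball1 r₀) _ _)
    · refine Eventually.of_forall fun s _ => ?_
      exact (tendsto_const_nhds (x := (0 : L2s))).weightedEnergy hc.memLp (memLp_ball r₀) (lV s)
  have l1 := (((h.tendsto_weightedEnergy memLp_top_one T).const_mul T).add
    ((lU T).inner (lX T))).add (((lU T).inner (lI T)).const_mul (1 / 2 : ℝ))
  have l2 := (((lU 0).inner (lX 0)).add (((lU 0).inner (lI 0)).const_mul (1 / 2 : ℝ))).add
    (lint.const_mul η)
  have := le_of_tendsto_of_tendsto l1 l2 strong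
  rwa [inner_dotOp_position (vD T hT (by linarith)),
    inner_dotOp_position (vD 0 le_rfl (by linarith))] at this

end IsMildSolution

/-! ### Gronwall argument and conclusion. -/

lemma le_div_mul_of_le {x b S : ℝ} (hx : 0 ≤ x) (hb : 0 < b) (h : b ≤ S) : x ≤ x / b * S := by
  rw [div_mul_eq_mul_div, le_div_iff₀ hb]
  exact mul_le_mul_of_nonneg_left h hx

/-- A Gronwall-type decay estimate. -/
lemma isBigO_of_mul_le_integral {e : ℝ → ℝ} (he : Continuous e) (h0 : ∀ t, 0 ≤ t → 0 ≤ e t)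
    {η A c : ℝ} (hη : 0 ≤ η) (hA : 0 ≤ A)
    (h : ∀ t, 2 ≤ t → (t - c) * e t ≤ A * √(Real.log t) + η * ∫ s in (0:ℝ)..t, e s) :
    e =O[atTop] fun t => t ^ (η - 1) * √(Real.log t) := by
  set c' := max c 0 with hc'
  have hc0 : 0 ≤ c' := le_max_right _ _
  set T := max 2 (c' + 1) with hT
  have hT2 : 2 ≤ T := le_max_left _ _
  have hTc : c' + 1 ≤ T := le_max_right _ _
  set F : ℝ → ℝ := fun t => ∫ s in (0:ℝ)..t, e s with hF
  have hFd : ∀ t, HasDerivAt F (e t) t := hasDerivAt_primitive he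
  have hF0 : ∀ t, 0 ≤ t → 0 ≤ F t := fun t ht =>
    intervalIntegral.integral_nonneg ht fun s hs => h0 s hs.1
  have h' : ∀ t, 2 ≤ t → (t - c') * e t ≤ A * √(Real.log t) + η * F t := fun t ht =>
    le_trans (mul_le_mul_of_nonneg_right (sub_le_sub_left (le_max_left _ _) _)
      (h0 t (by linarith))) (h t ht)
  have hl2 : 0 < √(Real.log 2) := Real.sqrt_pos.2 (Real.log_pos (by norm_num))
  -- The factor `2` comes from `t - c' ≥ t / 2`, valid once `t ≥ 2 c'`.
  refine IsBigO.of_bound (2 * (A + η * F T / √(Real.log 2))) ?_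
  filter_upwards [eventually_ge_atTop (max T (2 * c'))] with t ht
  have htT : T ≤ t := (le_max_left _ _).trans ht
  have htc : 2 * c' ≤ t := (le_max_right _ _).trans ht
  have ht0 : 0 < t := by linarith
  set S := √(Real.log t) with hS
  have hS0 : 0 ≤ S := Real.sqrt_nonneg _
  have hSl : √(Real.log 2) ≤ S := Real.sqrt_le_sqrt (Real.log_le_log (by norm_num) (by linarith))
  -- With `S` frozen at the final time `t`, which dominates `√(log s)` for `s ≤ t`, the hypothesis
  -- says exactly that `H` is nonincreasing. The choice `T ≥ c' + 1` makes the power at `T` at most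
  -- one.
  set H : ℝ → ℝ := fun s => (A * S + η * F s) * (s - c') ^ (-η) with hH
  have hHd : ∀ s, T ≤ s → HasDerivAt H
      (η * e s * (s - c') ^ (-η) + (A * S + η * F s) * (1 * -η * (s - c') ^ (-η - 1))) s := by
    intro s hs
    have hpos : 0 < s - c' := by linarith
    have d1 : HasDerivAt (fun s => A * S + η * F s) (η * e s) s :=
      ((hFd s).const_mul η).const_add _
    have d2 : HasDerivAt (fun s => (s - c') ^ (-η)) (1 * -η * (s - c') ^ (-η - 1)) s :=
      ((hasDerivAt_id s).sub_const c').rpow_const (Or.inl hpos.ne')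
    exact d1.mul d2
  have hanti : AntitoneOn H (Icc T t) := by
    refine antitoneOn_of_deriv_nonpos (convex_Icc T t)
      (fun s hs => (hHd s hs.1).continuousAt.continuousWithinAt)
      (fun s hs => (hHd s (interior_subset hs).1).differentiableAt.differentiableWithinAt) ?_
    intro s hs
    have hs' := interior_subset hs
    rw [(hHd s hs'.1).deriv]
    have hpos : 0 < s - c' := by linarith [hs'.1]
    have e1 : (s - c') ^ (-η) = (s - c') * (s - c') ^ (-η - 1) := by
      rw [Real.rpow_sub_one hpos.ne']; field_simp
    have e2 := h' s (by linarith [hs'.1])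
    have e3 : √(Real.log s) ≤ S :=
      Real.sqrt_le_sqrt (Real.log_le_log (by linarith [hs'.1]) hs'.2)
    have e4 : (s - c') * e s - (A * S + η * F s) ≤ 0 := by
      have := mul_le_mul_of_nonneg_left e3 hA
      linarith
    have e5 : 0 ≤ η * (s - c') ^ (-η - 1) := mul_nonneg hη (Real.rpow_nonneg hpos.le _)
    rw [e1]
    have := mul_nonpos_of_nonneg_of_nonpos e5 e4
    linarith
  have hle := hanti (left_mem_Icc.2 htT) (right_mem_Icc.2 htT) htT
  have hτ : 0 < t - c' := by linarith
  have hB : 0 ≤ A * S + η * F T := by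
    have := hF0 T (by linarith)
    positivity
  have hle2 : A * S + η * F t ≤ (A * S + η * F T) * t ^ η := by
    have h1 : H T ≤ A * S + η * F T := by
      refine mul_le_of_le_one_right hB ?_
      rw [Real.rpow_neg (by linarith)]
      exact inv_le_one_of_one_le₀ (Real.one_le_rpow (by linarith) hη)
    have h2 : (A * S + η * F t) = H t * (t - c') ^ η := by
      simp only [hH]
      rw [mul_assoc, ← Real.rpow_add hτ, neg_add_cancel, Real.rpow_zero, mul_one]
    rw [h2]
    have h3 : (t - c') ^ η ≤ t ^ η := Real.rpow_le_rpow hτ.le (by linarith) hη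
    exact mul_le_mul (hle.trans h1) h3 (Real.rpow_nonneg hτ.le _) hB
  have hfin := (h' t (by linarith)).trans hle2
  have he0 := h0 t ht0.le
  have hhalf : t / 2 * e t ≤ (t - c') * e t := mul_le_mul_of_nonneg_right (by linarith) he0
  have hcoef : A * S + η * F T ≤ (A + η * F T / √(Real.log 2)) * S := by
    rw [add_mul]
    have := hF0 T (by linarith)
    exact add_le_add_right (le_div_mul_of_le (by positivity) hl2 hSl) _
  have htη : 0 ≤ t ^ η := Real.rpow_nonneg ht0.le _
  have hlast : t / 2 * e t ≤ (A + η * F T / √(Real.log 2)) * S * t ^ η :=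
    (hhalf.trans hfin).trans (mul_le_mul_of_nonneg_right hcoef htη)
  rw [Real.norm_of_nonneg he0, Real.norm_of_nonneg (by positivity), Real.rpow_sub_one ht0.ne']
  have : e t = (t / 2 * e t) * (2 / t) := by field_simp
  rw [this]
  refine (mul_le_mul_of_nonneg_right hlast (by positivity)).trans (le_of_eq ?_)
  field_simp

/-- Lower bound for the Morawetz density by the local energy. -/
lemma le_morawetz {K : Plane → ℝ} {km k₀ r₀ η : ℝ} (hc : IsCoefficient K km k₀ r₀ η)
    {f : L2s} {g : L2v} {R M t : ℝ} (hR : r₀ < R) (hM : 0 ≤ M) (ht : 0 ≤ t)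
    (hf : VanishesOutside (√k₀ * t + M) f) (hg : VanishesOutside (√k₀ * t + M) g) :
    (t - R / √km) * weightedEnergy hc.memLp (memLp_ball R) f g
        - M / √k₀ * weightedEnergy hc.memLp memLp_top_one f g
      ≤ t * weightedEnergy hc.memLp memLp_top_one f g + ∫ x, f x * inner ℝ x (g x) := by
  have hkm := hc.km_pos
  have hk₀ := hc.k₀_pos
  have skm := Real.sqrt_pos.2 hkm
  have sk₀ := Real.sqrt_pos.2 hk₀
  have hR0 : 0 < R := hc.r₀_pos.trans hR
  rw [weightedEnergy_eq, weightedEnergy_eq]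
  have i1 := integrable_weightedEnergy hc.memLp (memLp_ball R) f g
  have i2 := integrable_weightedEnergy hc.memLp memLp_top_one f g
  have i3 : Integrable (fun x => f x * inner ℝ x (g x)) :=
    (Lp.memLp f).integrable_mul_two (hg.memLp_inner (Lp.memLp g) continuous_id)
  simp only [← integral_const_mul]
  rw [← integral_sub ((i1.const_mul _).const_mul _) ((i2.const_mul _).const_mul _),
    ← integral_add ((i2.const_mul _).const_mul _) i3]
  refine integral_mono_ae (((i1.const_mul _).const_mul _).sub ((i2.const_mul _).const_mul _))
    (((i2.const_mul _).const_mul _).add i3) ?_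
  filter_upwards [hf, hg] with x hfx hgx
  set e := |f x| ^ 2 + K x * ‖g x‖ ^ 2 with he
  have hKx := hc.pos x
  have he0 : 0 ≤ e := by positivity
  have hMe : 0 ≤ M / √k₀ * (1 / 2 * (1 * e)) := by positivity
  have hcs : -(‖x‖ * (|f x| * ‖g x‖)) ≤ f x * inner ℝ x (g x) := by
    have h1 := abs_real_inner_le_norm x (g x)
    have h2 : |f x * inner ℝ x (g x)| ≤ |f x| * (‖x‖ * ‖g x‖) := by
      rw [abs_mul]; gcongr
    linarith [neg_abs_le (f x * inner ℝ x (g x))]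
  -- Used with `k = km` inside the ball and with `k = k₀` outside. In the latter case `|x| / √k₀ ≤ t
  -- + M / √k₀` on the support, which matches the coefficient of the total energy.
  have young : ∀ k : ℝ, 0 < k → k ≤ K x → |f x| * ‖g x‖ ≤ 1 / √k * (1 / 2 * e) := by
    intro k hk hkK
    have sk := Real.sqrt_pos.2 hk
    rw [one_div_mul_eq_div, le_div_iff₀ sk]
    have h1 : k * ‖g x‖ ^ 2 ≤ K x * ‖g x‖ ^ 2 := by gcongr
    have h2 : √k ^ 2 = k := Real.sq_sqrt hk.le
    have h3 : k * ‖g x‖ ^ 2 = (√k * ‖g x‖) ^ 2 := by rw [mul_pow, h2]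
    nlinarith [sq_nonneg (|f x| - √k * ‖g x‖)]
  by_cases hxR : x ∈ Metric.closedBall (0 : Plane) R
  · have hxR' : ‖x‖ ≤ R := by simpa using hxR
    rw [indicator_of_mem hxR]
    have h1 := young km hkm (hc.km_le x)
    have h2 : ‖x‖ * (|f x| * ‖g x‖) ≤ R * (1 / √km * (1 / 2 * e)) :=
      mul_le_mul hxR' h1 (by positivity) hR0.le
    have h3 : R / √km * (1 / 2 * (1 * e)) = R * (1 / √km * (1 / 2 * e)) := by ring
    linarith
  · have hxR' : R < ‖x‖ := by simpa using hxR
    rw [indicator_of_notMem hxR]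
    by_cases hxs : √k₀ * t + M < ‖x‖
    · have : e = 0 := by rw [he, hfx hxs, hgx hxs]; simp
      rw [this, hfx hxs]; simp
    · have h1 := young k₀ hk₀ (hc.eq_const x (hR.trans hxR')).ge
      have h2 : ‖x‖ * (|f x| * ‖g x‖) ≤ (√k₀ * t + M) * (1 / √k₀ * (1 / 2 * e)) :=
        mul_le_mul (not_lt.1 hxs) h1 (by positivity) (by positivity)
      have h3 : (√k₀ * t + M) * (1 / √k₀ * (1 / 2 * e))
          = t * (1 / 2 * (1 * e)) + M / √k₀ * (1 / 2 * (1 * e)) := by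
        field_simp
      linarith

/-- Local energy decay for finite energy solutions with compactly supported data. -/
theorem IsMildSolution.localEnergy_isBigO {K : Plane → ℝ} {km k₀ r₀ η : ℝ}
    (hc : IsCoefficient K km k₀ r₀ η) {U a : ℝ → L2s} {D : ℝ → L2v}
    (h : IsMildSolution hc.memLp U a D) {L : ℝ} (hU₀ : VanishesOutside L (U 0))
    (ha₀ : VanishesOutside L (a 0)) {R : ℝ} (hR : r₀ < R) :
    (fun t => weightedEnergy hc.memLp (memLp_ball R) (a t) (D t))
      =O[atTop] fun t => t ^ (η - 1) * √(Real.log t) := by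
  have hD₀ : VanishesOutside L (D 0) := (h.pair 0 le_rfl).vanishesOutside hU₀
  have hsp := fun t (ht : 0 ≤ t) => h.vanishesOutside hc ha₀ hD₀ ht
  set M := √(1 + L ^ 2) + √(1 + r₀ ^ 2) + 3 with hM
  have hM0 : 0 ≤ M := by positivity
  have hLM : L ≤ M := by
    have h1 : L ≤ √(1 + L ^ 2) := Real.le_sqrt_of_sq_le (by linarith)
    have h2 := Real.sqrt_nonneg (1 + r₀ ^ 2)
    linarith
  have hUM := hU₀.mono hLM
  have va := fun t ht => (hsp t ht).1
  have vD := fun t ht => (hsp t ht).2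
  obtain ⟨C, hC0, hC⟩ := h.exists_norm_le_sqrt_log hc hM0 ha₀ hUM va vD
  have hK0 : ∀ x, 0 ≤ K x := fun x => (hc.pos x).le
  have hball : ∀ (r : ℝ) x,
      (0:ℝ) ≤ (Metric.closedBall (0 : Plane) r).indicator (fun _ => (1:ℝ)) x :=
    fun r x => indicator_nonneg (fun _ _ => zero_le_one) x
  have hk₀ := hc.k₀_pos
  set E₀ := weightedEnergy hc.memLp memLp_top_one (a 0) (D 0) with hE₀
  have hE₀0 : 0 ≤ E₀ := weightedEnergy_nonneg _ hK0 _ (fun _ => zero_le_one) _ _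
  set P := |(∫ x, a 0 x * inner ℝ x (D 0 x)) + 1 / 2 * inner ℝ (a 0) (U 0)| with hP
  have hP0 : 0 ≤ P := abs_nonneg _
  have hl2 : 0 < √(Real.log 2) := Real.sqrt_pos.2 (Real.log_pos (by norm_num))
  -- The first summand absorbs the terms constant in time, as `t ≥ 2`; the second bounds `½ ∫ u_t u`
  -- through `‖u_t‖ ≤ √(2 E₀)` and the growth of `‖u‖`.
  set A := (P + M / √k₀ * E₀) / √(Real.log 2) + √(2 * E₀) * C with hA
  refine isBigO_of_mul_le_integral (h.continuous_weightedEnergy (memLp_ball R))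
    (fun t _ => weightedEnergy_nonneg _ hK0 _ (hball R) _ _) hc.eta_nonneg
    (A := A) (c := R / √km) (by positivity) fun t ht => ?_
  have ht0 : 0 ≤ t := by linarith
  have hmor := h.morawetz_le hc hUM va vD ht0
  have hlow := le_morawetz hc hR hM0 ht0 (va t ht0) (vD t ht0)
  have hE := h.energy_eq ht0
  rw [← hE₀] at hE
  have hnorm : ‖a t‖ ≤ √(2 * E₀) := by
    refine Real.le_sqrt_of_sq_le ?_
    rw [← hE]
    unfold weightedEnergy
    have h1 : (inner ℝ (mulOp memLp_top_one (a t)) (a t) : ℝ) = ‖a t‖ ^ 2 := by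
      rw [inner_mulOp_left, ← real_inner_self_eq_norm_sq, L2.inner_def]
      simp only [one_mul]
    have h2 : (0:ℝ) ≤ inner ℝ (mulOp memLp_top_one (D t)) (mulOp hc.memLp (D t)) := by
      rw [inner_mulOp_mulOp]
      exact integral_nonneg fun x => mul_nonneg zero_le_one
        (mul_nonneg (hK0 x) real_inner_self_nonneg)
    rw [h1]
    linarith
  have hS0 := Real.sqrt_nonneg (Real.log t)
  have hinner : - (1 / 2 * inner ℝ (a t) (U t)) ≤ √(2 * E₀) * C * √(Real.log t) := by
    have h1 := abs_real_inner_le_norm (a t) (U t)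
    have h2 : ‖a t‖ * ‖U t‖ ≤ √(2 * E₀) * (C * √(Real.log t)) :=
      mul_le_mul hnorm (hC t ht) (norm_nonneg _) (Real.sqrt_nonneg _)
    have h3 := neg_abs_le (inner ℝ (a t) (U t) : ℝ)
    have h4 : 0 ≤ √(2 * E₀) * (C * √(Real.log t)) := by positivity
    linarith
  have hconst : P + M / √k₀ * E₀ ≤ (P + M / √k₀ * E₀) / √(Real.log 2) * √(Real.log t) :=
    le_div_mul_of_le (by positivity) hl2 (Real.sqrt_le_sqrt (Real.log_le_log (by norm_num) ht))
  -- Since `r₀ < R`, the Morawetz remainder is controlled by the very quantity being estimated,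
  -- which closes the inequality.
  have hint : ∫ s in (0:ℝ)..t, weightedEnergy hc.memLp (memLp_ball r₀) 0 (D s)
      ≤ ∫ s in (0:ℝ)..t, weightedEnergy hc.memLp (memLp_ball R) (a s) (D s) := by
    have hcont : Continuous fun s => weightedEnergy hc.memLp (memLp_ball r₀) 0 (D s) :=
      continuous_iff_continuousAt.2 fun s => (tendsto_const_nhds (x := (0 : L2s))).weightedEnergy
        hc.memLp (memLp_ball r₀) (h.continuous_grad.tendsto s)
    refine intervalIntegral.integral_mono_on ht0 (hcont.intervalIntegrable _ _)
      ((h.continuous_weightedEnergy (memLp_ball R)).intervalIntegrable _ _) fun s _ => ?_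
    refine (weightedEnergy_zero_left_le _ _ (hball r₀) (a s) (D s)).trans
      (weightedEnergy_mono _ hK0 _ _ (fun x => ?_) _ _)
    exact indicator_le_indicator_of_subset (Metric.closedBall_subset_closedBall hR.le)
      (fun _ => zero_le_one) x
  have hint' := mul_le_mul_of_nonneg_left hint hc.eta_nonneg
  rw [hE] at hmor hlow
  have hPle := le_abs_self ((∫ x, a 0 x * inner ℝ x (D 0 x)) + 1 / 2 * inner ℝ (a 0) (U 0))
  rw [← hP] at hPle
  have hAe : A * √(Real.log t) = (P + M / √k₀ * E₀) / √(Real.log 2) * √(Real.log t)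
      + √(2 * E₀) * C * √(Real.log t) := by rw [hA, add_mul]
  rw [hAe]
  linarith

/-- The coefficients of the theorem are admissible, with `η = r₀ ‖∇K‖_∞ / k_m`. -/
lemma isCoefficient_of_gradSupNorm {K : Plane → ℝ} {km k₀ r₀ : ℝ}
    (hLip : ∃ C : ℝ≥0, LipschitzWith C K) (hkm : 0 < km) (hK1 : ∀ x, km ≤ K x) (hr₀ : 0 < r₀)
    (hK3 : ∀ x : Plane, r₀ < ‖x‖ → K x = k₀) :
    IsCoefficient K km k₀ r₀ (r₀ / km * gradSupNorm K) where
  lipschitz := hLip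
  km_pos := hkm
  km_le := hK1
  r₀_pos := hr₀
  eq_const := hK3
  eta_nonneg := mul_nonneg (by positivity) ENNReal.toReal_nonneg
  radial_le := by
    obtain ⟨C, hC⟩ := hLip
    -- Finiteness is needed because `toReal` would send an infinite supremum to zero.
    have hfin : eLpNormEssSup (gradient K) (volume : Measure Plane) ≠ ⊤ := by
      refine ne_top_of_le_ne_top (b := ENNReal.ofReal C) ENNReal.ofReal_ne_top ?_
      refine eLpNormEssSup_le_of_ae_bound (Eventually.of_forall fun x => ?_)
      rw [gradient, LinearIsometryEquiv.norm_map]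
      exact norm_fderiv_le_of_lipschitz ℝ hC
    filter_upwards [ae_le_eLpNormEssSup (f := gradient K) (μ := volume)] with x hx hxr
    have h1 : ‖gradient K x‖ ≤ gradSupNorm K := by
      rw [gradSupNorm, eLpNorm_exponent_top, ← toReal_enorm]
      exact ENNReal.toReal_mono hfin hx
    have hG : 0 ≤ gradSupNorm K := ENNReal.toReal_nonneg
    rw [← inner_gradient_apply]
    calc (inner ℝ (gradient K x) x : ℝ) ≤ ‖gradient K x‖ * ‖x‖ := real_inner_le_norm _ _
      _ ≤ gradSupNorm K * r₀ := by gcongr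
      _ = r₀ / km * gradSupNorm K * km := by field_simp
      _ ≤ r₀ / km * gradSupNorm K * K x := by gcongr; exact hK1 x

theorem theorem5p1
    (K : Plane → ℝ) (k_m k₀ r₀ : ℝ)
    (hLip : ∃ C : ℝ≥0, LipschitzWith C K)
    (hkm : 0 < k_m) (hK1 : ∀ x, k_m ≤ K x)
    (hr₀ : 0 < r₀) (hK3 : ∀ x : Plane, r₀ < ‖x‖ → K x = k₀)
    (η₀ : ℝ) (hη₀ : η₀ = r₀ / k_m * gradSupNorm K) (hη₀_mem : η₀ ∈ Set.Ico (0 : ℝ) 1)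
    (u₀ u₁ : Plane → ℝ) (hu₀ : ContDiff ℝ ∞ u₀) (hu₁ : ContDiff ℝ ∞ u₁)
    (L : ℝ) (hL : 0 < L)
    (hsupp₀ : tsupport u₀ ⊆ Metric.closedBall 0 L) (hsupp₁ : tsupport u₁ ⊆ Metric.closedBall 0 L)
    (u ut : ℝ → Lp ℝ 2 (volume : Measure Plane)) (Du : ℝ → Lp Plane 2 (volume : Measure Plane))
    (hu : IsWaveSolution K u₀ u₁ u ut Du)
    (R : ℝ) (hR : r₀ < R) :
    (fun t : ℝ => localEnergy K ut Du R t)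
      =O[atTop] (fun t : ℝ => t ^ (η₀ - 1) * Real.sqrt (Real.log t)) := by
  have hc := isCoefficient_of_gradSupNorm hLip hkm hK1 hr₀ hK3
  rw [← hη₀] at hc
  obtain ⟨U, a, D, h, heq⟩ := hu.exists_isMildSolution hc.memLp
  have hzero : ∀ f : Plane → ℝ, tsupport f ⊆ Metric.closedBall 0 L → VanishesOutside L f := by
    intro f hf
    refine Eventually.of_forall fun x hx => ?_
    refine image_eq_zero_of_notMem_tsupport fun hmem => ?_
    have := hf hmem
    simp only [Metric.mem_closedBall, dist_zero_right] at this
    linarith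
  obtain ⟨e1, e2, -⟩ := heq 0 le_rfl
  have hU₀ : VanishesOutside L (U 0) := by
    rw [e1]; exact (hzero u₀ hsupp₀).congr hu.initial
  have ha₀ : VanishesOutside L (a 0) := by
    rw [e2]; exact (hzero u₁ hsupp₁).congr hu.initial_deriv
  refine (h.localEnergy_isBigO hc hU₀ ha₀ hR).congr' ?_ EventuallyEq.rfl
  filter_upwards [eventually_ge_atTop 0] with t ht
  obtain ⟨-, e4, e5⟩ := heq t ht
  rw [weightedEnergy_ball, e4, e5, localEnergy]
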